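/- Let $(X,\mathsf d)$ be a complete separable metric space endowed with a Borel positive measure $\mathfrak m$ with full support such that, for some $o\in X$ and $\kappa\ge 0$, $\mathfrak m(\{x:\mathsf d(x,o)<r\})\le e^{\kappa r^2}$ for every $r>0$. For $f:X\to\mathbb R$ let $|\mathrm Df|(x)=\limsup_{y\to x}\frac{|f(y)-f(x)|}{\mathsf d(x,y)}$ (and $|\mathrm Df|(x)=0$ if $x$ is isolated), and define the Cheeger energy $\mathsf{Ch}:L^2(X,\mathfrak m)\to[0,+\infty]$ by $$\mathsf{Ch}(f)=\inf\Big\{\liminf_{n\to\infty}\tfrac12\int_X|\mathrm Df_n|^2\,d\mathfrak m:\ f_n\in \mathrm{Lip}_b(X)\cap L^2(X,\mathfrak m),\ f_n\to f\text{ in }L^2(X,\mathfrak m)\Big\},$$ where $\mathrm{Lip}_b(X)$ is the set of bounded Lipschitz functions on $X$. For $\mathsf{Ch}(f)<\infty$, write $l\in\partial\mathsf{Ch}(f)$ if $l\in L^2(X,\mathfrak m)$ and $\int_X l\,(g-f)\,d\mathfrak m\le\mathsf{Ch}(g)-\mathsf{Ch}(f)$ for all $g\in L^2(X,\mathfrak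 m)$; put $\partial\mathsf{Ch}(f)=\emptyset$ otherwise. Then for every $f\in L^2(X,\mathfrak m)$ there is a unique curve $[0,\infty)\ni t\mapsto \mathsf P_tf\in L^2(X,\mathfrak m)$ with $\mathsf P_0 f=f$ which is locally absolutely continuous in $(0,\infty)$, satisfies $\mathsf P_tf\to f$ in $L^2(X,\mathfrak m)$ as $t\downarrow0$, and is differentiable with $\frac{d}{dt}\mathsf P_tf\in-\partial\mathsf{Ch}(\mathsf P_tf)$ for a.e. $t>0$ (the maps $\mathsf P_t$, possibly nonlinear, are the heat semigroup). Moreover, let $E:\mathbb R^2\to\mathbb R\cup\{+\infty\}$ be proper, lower semicontinuous and convex, and assume in addition that $E\ge0$ and $E(0,0)=0$ if $\mathfrak m(X)=+\infty$. Then for all $f,g\in L^2(X,\mathfrak m)$ the negative part of $E(f,g)$ is $\mathfrak m$-integrable, so that $\int_XE(f,g)\,d\mathfrak m\in(-\infty,+\infty]$ is well defined, and $$\int_XE(\mathsf P_tf,\mathsf P_tg)\,d\mathfrak m\le\int_XE(f,g)\,d\mathfrak m\qquad\text{for all }f,g\in L^2(X,\mathfrak m)\text{ and all }t\ge0.$$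 -/

import Mathlib

open MeasureTheory Filter Topology Set
open scoped ENNReal

noncomputable section

namespace MetricMeasure

section Integrand

variable {X : Type*} [MeasurableSpace X]

/-- Convexity of a function with values in `(-∞, ∞]`. -/
def IsConvexEReal (E : ℝ × ℝ → EReal) : Prop :=
  ∀ p q : ℝ × ℝ, ∀ a b : ℝ, 0 ≤ a → 0 ≤ b → a + b = 1 →
    E (a • p + b • q) ≤ (a : EReal) * E p + (b : EReal) * E q

/-- `E` is a proper (never `-∞`, not identically `+∞`), lower semicontinuous, convex integrand
on `ℝ²`, which in addition is nonnegative and vanishes at the origin if `m(X) = ∞`. -/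
structure IsConvexIntegrand (m : Measure X) (E : ℝ × ℝ → EReal) : Prop where
  ne_bot : ∀ p, E p ≠ ⊥
  ne_top : ∃ p, E p ≠ ⊤
  lsc : LowerSemicontinuous E
  convex : IsConvexEReal E
  nonneg : m univ = ⊤ → ∀ p, 0 ≤ E p
  zero : m univ = ⊤ → E (0, 0) = 0

/-- The integral of an extended-real function, as the integral of the positive part minus the
integral of the negative part; meaningful whenever the latter is finite. -/
def integralEReal (m : Measure X) (h : X → EReal) : EReal :=
  ((∫⁻ x, (h x).toENNReal ∂m : ℝ≥0∞) : EReal) - ((∫⁻ x, (-h x).toENNReal ∂m : ℝ≥0∞) : EReal)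

/-- The functional `(f, g) ↦ ∫ E(f, g) dm` on `L² × L²`. -/
def convexFunctional (m : Measure X) (E : ℝ × ℝ → EReal) (f g : Lp ℝ 2 m) : EReal :=
  integralEReal m (fun x => E (f x, g x))

end Integrand

section Heat

variable {X : Type*} [MetricSpace X]

/-- The local slope `|Df|(x) = limsup_{y → x, y ≠ x} |f y - f x| / d(y, x)`, with values in `[0, ∞]`.
At an isolated point the filter `𝓝[≠] x` is trivial and the `limsup` in `[0, ∞]` is `0`
(see `localSlope_eq_zero_of_isolated`). -/
def localSlope (f : X → ℝ) (x : X) : ℝ≥0∞ :=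
  limsup (fun y => ENNReal.ofReal (|f y - f x| / dist y x)) (𝓝[≠] x)

theorem localSlope_eq_zero_of_isolated {Y : Type*} [MetricSpace Y] (f : Y → ℝ) (x : Y)
    (hx : 𝓝[≠] x = ⊥) : localSlope f x = 0 := by
  simp [localSlope, hx]

/-- Bounded Lipschitz functions, `Lip_b(X)`. -/
def IsLipBdd (f : X → ℝ) : Prop :=
  (∃ K : NNReal, LipschitzWith K f) ∧ ∃ C : ℝ, ∀ x, |f x| ≤ C

variable [MeasurableSpace X]

/-- The growth condition: for some centre `o` and some `κ ≥ 0`, every ball of radius `r` around `o`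
has measure at most `exp (κ r²)`. -/
def GrowthCondition (m : Measure X) : Prop :=
  ∃ o : X, ∃ κ : ℝ, 0 ≤ κ ∧
    ∀ r : ℝ, 0 < r → m (Metric.ball o r) ≤ ENNReal.ofReal (Real.exp (κ * r ^ 2))

/-- The Cheeger energy `Ch : L²(X, m) → [0, ∞]`: the infimum of `liminf ½ ∫ |D fₙ|² dm` over all
sequences of bounded Lipschitz functions in `L²` converging to `f` in `L²(X, m)`. -/
def cheegerEnergy (m : Measure X) (f : Lp ℝ 2 m) : ℝ≥0∞ :=
  sInf {c : ℝ≥0∞ | ∃ F : ℕ → X → ℝ,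
    (∀ n, IsLipBdd (F n)) ∧ (∀ n, MemLp (F n) 2 m) ∧
    Tendsto (fun n => eLpNorm (fun x => F n x - f x) 2 m) atTop (𝓝 0) ∧
    c = liminf (fun n => 2⁻¹ * ∫⁻ x, localSlope (F n) x ^ 2 ∂m) atTop}

/-- The subdifferential of the Cheeger energy in `L²(X, m)`. It is empty outside the domain of `Ch`;
the inequality is trivial when `Ch g = ∞`. -/
def cheegerSubdifferential (m : Measure X) (f : Lp ℝ 2 m) : Set (Lp ℝ 2 m) :=
  {l | cheegerEnergy m f ≠ ⊤ ∧ ∀ g : Lp ℝ 2 m, cheegerEnergy m g ≠ ⊤ →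
    inner ℝ l (g - f) ≤ (cheegerEnergy m g).toReal - (cheegerEnergy m f).toReal}

/-- `u` (on `[0, ∞)`; its values at negative times are irrelevant) is the `L²`-gradient flow of the
Cheeger energy started at `f`: it is locally absolutely continuous in `(0, ∞)`, tends to `f` as
`t ↓ 0`, and satisfies `u'(t) ∈ -∂Ch(u(t))` for almost every `t > 0`. -/
structure IsHeatFlow (m : Measure X) (f : Lp ℝ 2 m) (u : ℝ → Lp ℝ 2 m) : Prop where
  zero : u 0 = f
  tendsto : Tendsto u (𝓝[>] 0) (𝓝 f)
  absolutelyContinuous : ∀ a b : ℝ, 0 < a → a ≤ b → AbsolutelyContinuousOnInterval u a b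
  deriv_mem : ∀ᵐ t : ℝ, 0 < t → ∃ l ∈ cheegerSubdifferential m (u t), HasDerivAt u (-l) t

/-- The heat semigroup `P_t f`: the value at time `t` of the gradient flow of the Cheeger energy
started at `f`. (Nothing is known about the value if there is no such flow.) -/
def heatSemigroup (m : Measure X) (t : ℝ) (f : Lp ℝ 2 m) : Lp ℝ 2 m :=
  Classical.epsilon (IsHeatFlow m f) t

end Heat

end MetricMeasure

end

/-! The Cheeger energy is convex, lower semicontinuous and densely defined on the Hilbert space L²,
so its gradient flow is the limit of implicit Euler schemes, that is, of iterated resolvents.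
Kobayashi's estimate (`norm_euler_sub_euler_sq_le`) gives convergence, and the limit satisfies an
evolution variational inequality (`isEVI_flow`). This makes it Lipschitz away from time 0, hence
differentiable a.e. because L² is separable, with derivative in minus the subdifferential.
Monotonicity of the subdifferential gives uniqueness.

For the inequality, let E first be smooth and convex with bounded first and second derivatives, and
put T = id - ε∇E on ℝ² with ε small. The Jacobian I - εD²E is symmetric with values between 0 and I.
For a symmetric 2×2 matrix the sign of the off-diagonal entry does not affect the eigenvalues, so
the matrix of absolute values is a contraction as well. The chain rule for slopes then gives
Ch(T₁(y,z)) + Ch(T₂(y,z)) ≤ Ch(y) + Ch(z) (`cheegerEnergy_comp_add_le`). When y, z are the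
resolvents of f, g, testing their variational inequalities with T(y,z) yields ⟨E₁(y,z), f - y⟩ +
⟨E₂(y,z), g - z⟩ ≥ 0, and the tangent inequality for E turns this into ∫E(y,z) ≤ ∫E(f,g)
(`integral_resolvent_le`). Linearity of the flow plays no role. Iterating and passing to the limit
gives the claim for the flow.

A general E is an increasing limit of such smooth functions, built as iterated smoothed maxima of
countably many affine minorants (`IsConvexIntegrand.exists_smooth_approx`). Monotone convergence
concludes. -/

namespace GradientFlow

/-! ### Resolvents of a convex functional and the implicit Euler scheme. -/

section

variable {H : Type*} [NormedAddCommGroup H] [InnerProductSpace ℝ H]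

/-- A densely defined, convex and lower semicontinuous functional with values in `[0, ∞]`. -/
structure IsConvexLsc (φ : H → ℝ≥0∞) : Prop where
  lsc : LowerSemicontinuous φ
  convex : ∀ (x y : H) (a b : ℝ), 0 ≤ a → 0 ≤ b → a + b = 1 →
    φ (a • x + b • y) ≤ ENNReal.ofReal a * φ x + ENNReal.ofReal b * φ y
  dense : Dense {x | φ x ≠ ⊤}

/-- The subdifferential of a functional with values in `[0, ∞]`. -/
def subdifferential (φ : H → ℝ≥0∞) (x : H) : Set H :=
  {l | φ x ≠ ⊤ ∧ ∀ v, φ v ≠ ⊤ → inner ℝ l (v - x) ≤ (φ v).toReal - (φ x).toReal}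

variable {φ : H → ℝ≥0∞}

theorem IsConvexLsc.exists_ne_top (hφ : IsConvexLsc φ) : ∃ x, φ x ≠ ⊤ := by
  obtain ⟨x, hx⟩ := hφ.dense.nonempty
  exact ⟨x, hx⟩

theorem IsConvexLsc.toReal_combo_le (hφ : IsConvexLsc φ) {x y : H} (hx : φ x ≠ ⊤) (hy : φ y ≠ ⊤)
    {a b : ℝ} (ha : 0 ≤ a) (hb : 0 ≤ b) (hab : a + b = 1) :
    φ (a • x + b • y) ≠ ⊤ ∧
      (φ (a • x + b • y)).toReal ≤ a * (φ x).toReal + b * (φ y).toReal := by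
  have h := hφ.convex x y a b ha hb hab
  have h1 : ENNReal.ofReal a * φ x ≠ ⊤ := ENNReal.mul_ne_top ENNReal.ofReal_ne_top hx
  have h2 : ENNReal.ofReal b * φ y ≠ ⊤ := ENNReal.mul_ne_top ENNReal.ofReal_ne_top hy
  have h3 := ENNReal.add_ne_top.2 ⟨h1, h2⟩
  refine ⟨ne_top_of_le_ne_top h3 h, (ENNReal.toReal_mono h3 h).trans ?_⟩
  rw [ENNReal.toReal_add h1 h2, ENNReal.toReal_mul, ENNReal.toReal_mul,
    ENNReal.toReal_ofReal ha, ENNReal.toReal_ofReal hb]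

/-- The form in which lower semicontinuity enters every limit: convergent real upper bounds survive,
and finiteness of the limit energy comes with them. -/
theorem IsConvexLsc.toReal_le_of_tendsto (hφ : IsConvexLsc φ) {ι : Type*} {F : Filter ι} [NeBot F]
    {x : ι → H} {c : ι → ℝ} {x₀ : H} {c₀ : ℝ} (hx : Tendsto x F (𝓝 x₀)) (hc : Tendsto c F (𝓝 c₀))
    (h : ∀ᶠ n in F, φ (x n) ≠ ⊤ ∧ (φ (x n)).toReal ≤ c n) :
    φ x₀ ≠ ⊤ ∧ (φ x₀).toReal ≤ c₀ := by
  have h0 : 0 ≤ c₀ := ge_of_tendsto hc (h.mono fun n hn => ENNReal.toReal_nonneg.trans hn.2)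
  have key : φ x₀ ≤ ENNReal.ofReal c₀ := by
    refine le_of_forall_lt fun y hy => ?_
    obtain ⟨y', hyy', hy'⟩ := exists_between hy
    refine hyy'.trans_le ?_
    refine ge_of_tendsto ((ENNReal.continuous_ofReal.tendsto c₀).comp hc) ?_
    filter_upwards [h, hx.eventually (hφ.lsc x₀ y' hy')] with n hn hn'
    refine hn'.le.trans ?_
    rw [← ENNReal.ofReal_toReal hn.1]
    exact ENNReal.ofReal_le_ofReal hn.2
  refine ⟨ne_top_of_le_ne_top ENNReal.ofReal_ne_top key, ?_⟩
  have := ENNReal.toReal_mono ENNReal.ofReal_ne_top key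
  rwa [ENNReal.toReal_ofReal h0] at this

theorem norm_sub_sq_expand (x y z : H) :
    ‖y - z‖ ^ 2 = ‖x - y‖ ^ 2 + ‖x - z‖ ^ 2 - 2 * inner ℝ (x - y) (x - z) := by
  have : y - z = (x - z) - (x - y) := by abel
  rw [this, norm_sub_sq_real, real_inner_comm]
  ring

/-- The point is the minimiser of `Φ = τ φ + ‖x - ·‖² / 2`. Strong convexity makes minimising
sequences Cauchy, and the variational inequality is the first-order condition along segments. -/
theorem IsConvexLsc.exists_resolvent [CompleteSpace H] (hφ : IsConvexLsc φ) {τ : ℝ} (hτ : 0 < τ)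
    (x : H) : ∃ z, φ z ≠ ⊤ ∧ ∀ v, φ v ≠ ⊤ →
      inner ℝ (x - z) (v - z) ≤ τ * ((φ v).toReal - (φ z).toReal) := by
  obtain ⟨v₀, hv₀⟩ := hφ.exists_ne_top
  set D : Set H := {v | φ v ≠ ⊤} with hD
  set Φ : H → ℝ := fun v => τ * (φ v).toReal + ‖x - v‖ ^ 2 / 2 with hΦ
  have hΦ0 : ∀ v, 0 ≤ Φ v := fun v =>
    add_nonneg (mul_nonneg hτ.le ENNReal.toReal_nonneg) (by positivity)
  have hne : (Φ '' D).Nonempty := ⟨Φ v₀, v₀, hv₀, rfl⟩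
  have hbdd : BddBelow (Φ '' D) := ⟨0, by rintro _ ⟨v, -, rfl⟩; exact hΦ0 v⟩
  set I := sInf (Φ '' D) with hI
  have hIle : ∀ v, φ v ≠ ⊤ → I ≤ Φ v := fun v hv => csInf_le hbdd ⟨v, hv, rfl⟩
  have hex : ∀ n : ℕ, ∃ v, φ v ≠ ⊤ ∧ Φ v < I + 1 / ((n : ℝ) + 1) := by
    intro n
    obtain ⟨_, ⟨v, hv, rfl⟩, hlt⟩ := exists_lt_of_csInf_lt hne
      (show sInf (Φ '' D) < I + 1 / ((n : ℝ) + 1) by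
        have : (0 : ℝ) < 1 / ((n : ℝ) + 1) := by positivity
        linarith)
    exact ⟨v, hv, hlt⟩
  choose z hzD hzlt using hex
  -- Parallelogram identity: the midpoint has `Φ`-value at least `I`, so two near-minimisers are
  -- close.
  have hmid : ∀ v w, φ v ≠ ⊤ → φ w ≠ ⊤ → ‖v - w‖ ^ 2 ≤ 4 * (Φ v + Φ w - 2 * I) := by
    intro v w hv hw
    obtain ⟨h1, h2⟩ := hφ.toReal_combo_le hv hw (a := 1 / 2) (b := 1 / 2)
      (by norm_num) (by norm_num) (by norm_num)
    have h3 := hIle _ h1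
    have h4 : ‖x - ((1 / 2 : ℝ) • v + (1 / 2 : ℝ) • w)‖ ^ 2
        = ‖x - v‖ ^ 2 / 2 + ‖x - w‖ ^ 2 / 2 - ‖v - w‖ ^ 2 / 4 := by
      have : x - ((1 / 2 : ℝ) • v + (1 / 2 : ℝ) • w)
          = (1 / 2 : ℝ) • ((x - v) + (x - w)) := by module
      rw [this, norm_smul, mul_pow, norm_add_sq_real, norm_sub_sq_expand x v w]
      norm_num
      ring
    simp only [hΦ] at h3 ⊢
    rw [h4] at h3
    nlinarith
  have hlim0 : Tendsto (fun n : ℕ => 1 / ((n : ℝ) + 1)) atTop (𝓝 0) :=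
    tendsto_one_div_add_atTop_nhds_zero_nat
  have hcauchy : CauchySeq z := by
    refine Metric.cauchySeq_iff'.2 fun ε hε => ?_
    obtain ⟨N, hN⟩ := (hlim0.eventually (gt_mem_nhds (show 0 < ε ^ 2 / 8 by positivity))).exists
    refine ⟨N, fun n hn => ?_⟩
    have h1 := hmid (z n) (z N) (hzD n) (hzD N)
    have h2 : 1 / ((n : ℝ) + 1) ≤ 1 / ((N : ℝ) + 1) := by gcongr
    have h3 := hzlt n
    have h4 := hzlt N
    rw [dist_eq_norm]
    exact lt_of_pow_lt_pow_left₀ 2 hε.le (by linarith)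
  obtain ⟨z₀, hz₀⟩ := cauchySeq_tendsto_of_complete hcauchy
  have hnorm : Tendsto (fun n => ‖x - z n‖ ^ 2 / 2) atTop (𝓝 (‖x - z₀‖ ^ 2 / 2)) :=
    ((tendsto_const_nhds.sub hz₀).norm.pow 2).div_const 2
  obtain ⟨hz₀D, hz₀le⟩ := hφ.toReal_le_of_tendsto hz₀
    (c := fun n : ℕ => (I + 1 / ((n : ℝ) + 1) - ‖x - z n‖ ^ 2 / 2) / τ)
    (c₀ := (I + 0 - ‖x - z₀‖ ^ 2 / 2) / τ)
    (((tendsto_const_nhds.add hlim0).sub hnorm).div_const τ)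
    (Eventually.of_forall fun n => ⟨hzD n, by
      rw [le_div_iff₀ hτ]
      have := hzlt n
      simp only [hΦ] at this
      nlinarith⟩)
  rw [le_div_iff₀ hτ] at hz₀le
  refine ⟨z₀, hz₀D, fun v hv => ?_⟩
  -- Compare `z₀` with `(1 - θ) z₀ + θ v` and divide by `θ`; the error linear in `θ` then vanishes.
  have hθ : ∀ θ : ℝ, 0 < θ → θ ≤ 1 →
      inner ℝ (x - z₀) (v - z₀) ≤ τ * ((φ v).toReal - (φ z₀).toReal) + θ * (‖v - z₀‖ ^ 2 / 2) := by
    intro θ h0 h1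
    obtain ⟨g1, g2⟩ := hφ.toReal_combo_le hz₀D hv (a := 1 - θ) (b := θ)
      (by linarith) h0.le (by ring)
    have g3 := hIle _ g1
    have g4 : ‖x - ((1 - θ) • z₀ + θ • v)‖ ^ 2
        = ‖x - z₀‖ ^ 2 - 2 * θ * inner ℝ (x - z₀) (v - z₀) + θ ^ 2 * ‖v - z₀‖ ^ 2 := by
      have : x - ((1 - θ) • z₀ + θ • v) = (x - z₀) - θ • (v - z₀) := by module
      rw [this, norm_sub_sq_real, norm_smul, real_inner_smul_right, mul_pow, Real.norm_eq_abs,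
        sq_abs]
      ring
    simp only [hΦ] at g3
    rw [g4] at g3
    have g5 := mul_le_mul_of_nonneg_left g2 hτ.le
    have : θ * inner ℝ (x - z₀) (v - z₀)
        ≤ θ * (τ * ((φ v).toReal - (φ z₀).toReal) + θ * (‖v - z₀‖ ^ 2 / 2)) := by
      nlinarith
    exact le_of_mul_le_mul_left this h0
  refine ge_of_tendsto (f := fun θ : ℝ =>
    τ * ((φ v).toReal - (φ z₀).toReal) + θ * (‖v - z₀‖ ^ 2 / 2)) (x := 𝓝[>] 0) ?_ ?_
  · have : Tendsto (fun θ : ℝ => τ * ((φ v).toReal - (φ z₀).toReal) + θ * (‖v - z₀‖ ^ 2 / 2))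
        (𝓝 0) (𝓝 (τ * ((φ v).toReal - (φ z₀).toReal) + 0 * (‖v - z₀‖ ^ 2 / 2))) :=
      Continuous.tendsto (by fun_prop) 0
    rw [zero_mul, add_zero] at this
    exact this.mono_left nhdsWithin_le_nhds
  · filter_upwards [Ioc_mem_nhdsGT (show (0 : ℝ) < 1 by norm_num)] with θ h
    exact hθ θ h.1 h.2

/-- The resolvent `x ↦ (1 + τ ∂φ)⁻¹ x`. -/
noncomputable def resolvent (φ : H → ℝ≥0∞) (τ : ℝ) (x : H) : H :=
  Classical.epsilon fun z => φ z ≠ ⊤ ∧ ∀ v, φ v ≠ ⊤ →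
    inner ℝ (x - z) (v - z) ≤ τ * ((φ v).toReal - (φ z).toReal)

section Resolvent

variable [CompleteSpace H] (hφ : IsConvexLsc φ) {τ : ℝ} (hτ : 0 < τ)
include hφ hτ

theorem resolvent_ne_top (x : H) : φ (resolvent φ τ x) ≠ ⊤ :=
  (Classical.epsilon_spec (hφ.exists_resolvent hτ x)).1

theorem inner_resolvent_le (x : H) {v : H} (hv : φ v ≠ ⊤) :
    inner ℝ (x - resolvent φ τ x) (v - resolvent φ τ x)
      ≤ τ * ((φ v).toReal - (φ (resolvent φ τ x)).toReal) :=
  (Classical.epsilon_spec (hφ.exists_resolvent hτ x)).2 v hv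

/-- Polarisation turns the variational inequality into a discrete evolution variational inequality,
which involves only distances and energies. -/
theorem resolvent_sq_le (x : H) {v : H} (hv : φ v ≠ ⊤) :
    ‖x - resolvent φ τ x‖ ^ 2 + ‖resolvent φ τ x - v‖ ^ 2 - ‖x - v‖ ^ 2
      ≤ 2 * τ * ((φ v).toReal - (φ (resolvent φ τ x)).toReal) := by
  have h := inner_resolvent_le hφ hτ x hv
  have h2 := norm_sub_sq_expand (resolvent φ τ x) x v
  have h3 : inner ℝ (resolvent φ τ x - x) (resolvent φ τ x - v)
      = inner ℝ (x - resolvent φ τ x) (v - resolvent φ τ x) := by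
    rw [← neg_sub x, ← neg_sub v, inner_neg_neg]
  rw [h3, norm_sub_rev (resolvent φ τ x) x] at h2
  linarith

theorem norm_resolvent_sub_le (x y : H) :
    ‖resolvent φ τ x - resolvent φ τ y‖ ≤ ‖x - y‖ := by
  have h1 := inner_resolvent_le hφ hτ x (resolvent_ne_top hφ hτ y)
  have h2 := inner_resolvent_le hφ hτ y (resolvent_ne_top hφ hτ x)
  set a := resolvent φ τ x
  set b := resolvent φ τ y
  have h3 : inner ℝ (x - a) (b - a) + inner ℝ (y - b) (a - b)
      = ‖a - b‖ ^ 2 - inner ℝ (x - y) (a - b) := by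
    rw [← neg_sub a b, inner_neg_right, ← real_inner_self_eq_norm_sq, neg_add_eq_sub,
      ← inner_sub_left, ← inner_sub_left]
    congr 1
    abel
  have h4 : ‖a - b‖ ^ 2 ≤ ‖x - y‖ * ‖a - b‖ :=
    le_trans (by linarith) (real_inner_le_norm (x - y) (a - b))
  by_contra hlt
  push Not at hlt
  nlinarith [norm_nonneg (x - y)]

theorem norm_resolvent_sub_self_le {x l : H} (hl : l ∈ subdifferential φ x) :
    ‖resolvent φ τ x - x‖ ≤ τ * ‖l‖ := by
  have h1 := inner_resolvent_le hφ hτ x hl.1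
  have h2 := hl.2 _ (resolvent_ne_top hφ hτ x)
  have h3 := real_inner_le_norm (-l) (resolvent φ τ x - x)
  rw [inner_neg_left, norm_neg] at h3
  rw [real_inner_self_eq_norm_sq, norm_sub_rev] at h1
  set z := resolvent φ τ x
  have h4 : ‖z - x‖ ^ 2 ≤ τ * ‖l‖ * ‖z - x‖ := by
    have : τ * ((φ x).toReal - (φ z).toReal) ≤ τ * (‖l‖ * ‖z - x‖) :=
      mul_le_mul_of_nonneg_left (by linarith) hτ.le
    linarith
  by_contra hlt
  push Not at hlt
  have : 0 ≤ τ * ‖l‖ := by positivity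
  nlinarith

theorem resolvent_mem_subdifferential (x : H) :
    τ⁻¹ • (x - resolvent φ τ x) ∈ subdifferential φ (resolvent φ τ x) := by
  refine ⟨resolvent_ne_top hφ hτ x, fun v hv => ?_⟩
  rw [real_inner_smul_left, inv_mul_le_iff₀ hτ]
  exact inner_resolvent_le hφ hτ x hv

end Resolvent

/-- Resolvents always have a subgradient, and for small `τ` they stay close to a starting point of
finite energy. -/
theorem IsConvexLsc.dense_subdifferential [CompleteSpace H] (hφ : IsConvexLsc φ) :
    Dense {x | (subdifferential φ x).Nonempty} := by
  refine Metric.dense_iff.2 fun x r hr => ?_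
  obtain ⟨y, hy, hyD⟩ := Metric.dense_iff.1 hφ.dense x (r / 2) (by positivity)
  set c := (φ y).toReal
  have hc : 0 ≤ c := ENNReal.toReal_nonneg
  -- Chosen so that `τ (2c + 1) = r² / 4`; the summand 1 covers the case `c = 0`.
  set τ : ℝ := r ^ 2 / 4 / (2 * c + 1)
  have hτ : 0 < τ := by positivity
  refine ⟨resolvent φ τ y, ?_, _, resolvent_mem_subdifferential hφ hτ y⟩
  have h1 := resolvent_sq_le hφ hτ y hyD
  rw [sub_self, norm_zero, norm_sub_rev y] at h1
  have h2 : 2 * τ * ((φ y).toReal - (φ (resolvent φ τ y)).toReal) ≤ τ * (2 * c + 1) := by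
    have : 0 ≤ (φ (resolvent φ τ y)).toReal := ENNReal.toReal_nonneg
    change 2 * τ * (c - _) ≤ _
    nlinarith
  have h3 : τ * (2 * c + 1) = r ^ 2 / 4 := by
    simp only [τ]
    field_simp
  have h4 : ‖resolvent φ τ y - y‖ < r / 2 :=
    lt_of_pow_lt_pow_left₀ 2 (by positivity) (by nlinarith [sq_nonneg ‖resolvent φ τ y - y‖])
  rw [Metric.mem_ball] at hy ⊢
  calc dist (resolvent φ τ y) x ≤ dist (resolvent φ τ y) y + dist y x := dist_triangle _ _ _
    _ < r / 2 + r / 2 := add_lt_add (by rwa [dist_eq_norm]) hy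
    _ = r := by ring

/-- The `n`-th step of the implicit Euler scheme with step size `τ`. -/
noncomputable def euler (φ : H → ℝ≥0∞) (τ : ℝ) (n : ℕ) (x : H) : H :=
  (resolvent φ τ)^[n] x

@[simp]
theorem euler_zero (φ : H → ℝ≥0∞) (τ : ℝ) (x : H) : euler φ τ 0 x = x := rfl

theorem euler_succ (φ : H → ℝ≥0∞) (τ : ℝ) (n : ℕ) (x : H) :
    euler φ τ (n + 1) x = resolvent φ τ (euler φ τ n x) :=
  Function.iterate_succ_apply' _ _ _

section Euler

variable [CompleteSpace H] (hφ : IsConvexLsc φ) {τ : ℝ} (hτ : 0 < τ)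
include hφ hτ

theorem norm_euler_sub_le (n : ℕ) (x y : H) : ‖euler φ τ n x - euler φ τ n y‖ ≤ ‖x - y‖ := by
  induction n with
  | zero => simp
  | succ n ih =>
    rw [euler_succ, euler_succ]
    exact (norm_resolvent_sub_le hφ hτ _ _).trans ih

theorem norm_euler_succ_sub_le (n : ℕ) {x l : H} (hl : l ∈ subdifferential φ x) :
    ‖euler φ τ (n + 1) x - euler φ τ n x‖ ≤ τ * ‖l‖ := by
  induction n with
  | zero => exact norm_resolvent_sub_self_le hφ hτ hl
  | succ n ih =>
    rw [euler_succ, euler_succ φ τ n]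
    refine (norm_resolvent_sub_le hφ hτ _ _).trans ?_
    rwa [euler_succ] at ih

theorem norm_euler_sub_self_le (n : ℕ) {x l : H} (hl : l ∈ subdifferential φ x) :
    ‖euler φ τ n x - x‖ ≤ n * τ * ‖l‖ := by
  induction n with
  | zero => simp
  | succ n ih =>
    calc ‖euler φ τ (n + 1) x - x‖
        = ‖(euler φ τ (n + 1) x - euler φ τ n x) + (euler φ τ n x - x)‖ := by congr 1; abel
      _ ≤ τ * ‖l‖ + n * τ * ‖l‖ :=
        (norm_add_le _ _).trans (add_le_add (norm_euler_succ_sub_le hφ hτ n hl) ih)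
      _ = (n + 1 : ℕ) * τ * ‖l‖ := by push_cast; ring

theorem euler_ne_top {n : ℕ} (hn : 0 < n) (x : H) : φ (euler φ τ n x) ≠ ⊤ := by
  obtain ⟨k, rfl⟩ := Nat.exists_eq_succ_of_ne_zero hn.ne'
  rw [Nat.succ_eq_add_one, euler_succ]
  exact resolvent_ne_top hφ hτ _

theorem toReal_euler_succ_le {n : ℕ} (hn : 0 < n) (x : H) :
    (φ (euler φ τ (n + 1) x)).toReal ≤ (φ (euler φ τ n x)).toReal := by
  have h := resolvent_sq_le hφ hτ (euler φ τ n x) (euler_ne_top hφ hτ hn x)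
  rw [← euler_succ, sub_self, norm_zero] at h
  by_contra! hlt
  have : 2 * τ * ((φ (euler φ τ n x)).toReal - (φ (euler φ τ (n + 1) x)).toReal) < 0 :=
    mul_neg_of_pos_of_neg (by positivity) (by linarith)
  nlinarith [sq_nonneg ‖euler φ τ n x - euler φ τ (n + 1) x‖,
    sq_nonneg ‖euler φ τ (n + 1) x - euler φ τ n x‖]

/-- Sum the one-step inequalities; since the energy decreases along the scheme, all energies may be
replaced with the last one. -/
theorem euler_evi (m k : ℕ) (x : H) {v : H} (hv : φ v ≠ ⊤) :
    ‖euler φ τ (m + k) x - v‖ ^ 2 - ‖euler φ τ m x - v‖ ^ 2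
      ≤ 2 * (k * τ) * ((φ v).toReal - (φ (euler φ τ (m + k) x)).toReal) := by
  induction k with
  | zero => simp
  | succ k ih =>
    have h := resolvent_sq_le hφ hτ (euler φ τ (m + k) x) hv
    rw [← euler_succ] at h
    rw [← add_assoc]
    have h2 : 0 ≤ (k : ℝ) * τ *
        ((φ (euler φ τ (m + k) x)).toReal - (φ (euler φ τ (m + k + 1) x)).toReal) := by
      -- At `m = k = 0` the starting energy may be infinite, with `toReal` equal to the default 0,
      -- so energy monotonicity is not available. The factor `k` removes that term.
      rcases Nat.eq_zero_or_pos k with rfl | hk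
      · simp
      · exact mul_nonneg (by positivity)
          (sub_nonneg.2 (toReal_euler_succ_le hφ hτ (by omega) x))
    push_cast
    nlinarith [sq_nonneg ‖euler φ τ (m + k) x - euler φ τ (m + k + 1) x‖]

/-- Kobayashi's comparison of two implicit Euler schemes with different step sizes. -/
theorem norm_euler_sub_euler_sq_le {σ : ℝ} (hσ : 0 < σ) {x l : H} (hl : l ∈ subdifferential φ x)
    (n m : ℕ) :
    ‖euler φ τ n x - euler φ σ m x‖ ^ 2
      ≤ ‖l‖ ^ 2 * ((n * τ - m * σ) ^ 2 + n * τ ^ 2 + m * σ ^ 2) := by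
  induction n generalizing m with
  | zero =>
    have h := norm_euler_sub_self_le hφ hσ m hl
    rw [euler_zero, norm_sub_rev]
    have := pow_le_pow_left₀ (norm_nonneg _) h 2
    have h3 : 0 ≤ ‖l‖ ^ 2 * (m * σ ^ 2) := by positivity
    push_cast
    nlinarith
  | succ n ihn =>
    induction m with
    | zero =>
      have h := norm_euler_sub_self_le hφ hτ (n + 1) hl
      rw [euler_zero]
      have := pow_le_pow_left₀ (norm_nonneg _) h 2
      have h3 : 0 ≤ ‖l‖ ^ 2 * ((n + 1 : ℕ) * τ ^ 2) := by positivity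
      push_cast at *
      nlinarith
    | succ m ihm =>
      have h1 := resolvent_sq_le hφ hτ (euler φ τ n x)
        (euler_ne_top hφ hσ (Nat.succ_pos m) x)
      have h2 := resolvent_sq_le hφ hσ (euler φ σ m x)
        (euler_ne_top hφ hτ (Nat.succ_pos n) x)
      rw [← euler_succ] at h1 h2
      have h3 := ihn (m + 1)
      rw [Nat.succ_eq_add_one] at h1 h2
      rw [norm_sub_rev (euler φ σ (m + 1) x), norm_sub_rev (euler φ σ m x)
        (euler φ τ (n + 1) x)] at h2
      set a := ‖euler φ τ (n + 1) x - euler φ σ (m + 1) x‖ ^ 2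
      set b := ‖euler φ τ n x - euler φ σ (m + 1) x‖ ^ 2
      set c := ‖euler φ τ (n + 1) x - euler φ σ m x‖ ^ 2
      -- Each scheme is tested with the new point of the other. With weights `σ` and `τ` the
      -- energies cancel.
      have h4 : (σ + τ) * a ≤ σ * b + τ * c := by
        have e1 := mul_le_mul_of_nonneg_left h1 hσ.le
        have e2 := mul_le_mul_of_nonneg_left h2 hτ.le
        have e3 := mul_nonneg hσ.le (sq_nonneg ‖euler φ τ n x - euler φ τ (n + 1) x‖)
        have e4 := mul_nonneg hτ.le (sq_nonneg ‖euler φ σ m x - euler φ σ (m + 1) x‖)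
        nlinarith
      -- The claimed bound solves this recursion with equality.
      have h5 : σ * b + τ * c ≤ (σ + τ) * (‖l‖ ^ 2 *
          (((n + 1 : ℕ) * τ - (m + 1 : ℕ) * σ) ^ 2 + (n + 1 : ℕ) * τ ^ 2
            + (m + 1 : ℕ) * σ ^ 2)) := by
        have e1 := mul_le_mul_of_nonneg_left h3 hσ.le
        have e2 := mul_le_mul_of_nonneg_left ihm hτ.le
        refine (add_le_add e1 e2).trans (le_of_eq ?_)
        push_cast
        ring
      exact le_of_mul_le_mul_left (h4.trans h5) (by positivity)

end Euler

end

end GradientFlow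

/-! ### Convergence of the Euler scheme and the evolution variational inequality. -/

namespace GradientFlow

section

variable {H : Type*} [NormedAddCommGroup H] [InnerProductSpace ℝ H] {φ : H → ℝ≥0∞}

/-- The implicit Euler scheme with step size `1 / (k + 1)`, evaluated at time `t`. -/
noncomputable def eulerAt (φ : H → ℝ≥0∞) (x : H) (k : ℕ) (t : ℝ) : H :=
  euler φ ((k : ℝ) + 1)⁻¹ ⌊t * ((k : ℝ) + 1)⌋₊ x

theorem tendsto_floor_mul_inv {t : ℝ} (ht : 0 ≤ t) :
    Tendsto (fun k : ℕ => (⌊t * ((k : ℝ) + 1)⌋₊ : ℝ) * ((k : ℝ) + 1)⁻¹) atTop (𝓝 t) := by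
  have h1 : Tendsto (fun k : ℕ => (k : ℝ) + 1) atTop atTop :=
    tendsto_atTop_add_const_right _ _ tendsto_natCast_atTop_atTop
  exact (tendsto_nat_floor_mul_div_atTop ht).comp h1

section Complete

variable [CompleteSpace H] (hφ : IsConvexLsc φ)
include hφ

theorem norm_eulerAt_sub_le (x y : H) (k : ℕ) (t : ℝ) :
    ‖eulerAt φ x k t - eulerAt φ y k t‖ ≤ ‖x - y‖ :=
  norm_euler_sub_le hφ (by positivity) _ _ _

theorem cauchySeq_eulerAt_of_mem {x l : H} (hl : l ∈ subdifferential φ x) (t : ℝ) :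
    CauchySeq fun k => eulerAt φ x k t := by
  set T : ℝ := max t 0
  have hT : 0 ≤ T := le_max_right _ _
  have hlim0 : Tendsto (fun n : ℕ => ((n : ℝ) + 1)⁻¹) atTop (𝓝 0) := by
    simpa using tendsto_one_div_add_atTop_nhds_zero_nat (𝕜 := ℝ)
  -- The rounded time lies at most one step below `T`. For negative `t` the natural floor is 0,
  -- hence `T = max t 0`.
  have hfl : ∀ k : ℕ, (⌊t * ((k : ℝ) + 1)⌋₊ : ℝ) * ((k : ℝ) + 1)⁻¹ ≤ T ∧
      T - ((k : ℝ) + 1)⁻¹ ≤ (⌊t * ((k : ℝ) + 1)⌋₊ : ℝ) * ((k : ℝ) + 1)⁻¹ := by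
    intro k
    have hk : (0 : ℝ) < (k : ℝ) + 1 := by positivity
    rw [← div_eq_mul_inv, div_le_iff₀ hk, le_div_iff₀ hk, sub_mul, inv_mul_cancel₀ hk.ne']
    rcases le_total 0 t with h | h
    · have : T = t := max_eq_left h
      rw [this]
      exact ⟨Nat.floor_le (by positivity), by linarith [Nat.lt_floor_add_one (t * ((k : ℝ) + 1))]⟩
    · have h0 : T = 0 := max_eq_right h
      rw [h0, Nat.floor_of_nonpos (mul_nonpos_of_nonpos_of_nonneg h hk.le)]
      simp
  refine Metric.cauchySeq_iff'.2 fun ε hε => ?_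
  have hev : Tendsto (fun n : ℕ => ‖l‖ ^ 2 * (4 + 2 * T) * ((n : ℝ) + 1)⁻¹) atTop (𝓝 0) := by
    simpa using hlim0.const_mul (‖l‖ ^ 2 * (4 + 2 * T))
  obtain ⟨N, hN⟩ := (hev.eventually (gt_mem_nhds (show 0 < ε ^ 2 by positivity))).exists
  refine ⟨N, fun n hn => ?_⟩
  rw [dist_eq_norm]
  refine lt_of_pow_lt_pow_left₀ 2 hε.le (lt_of_le_of_lt ?_ hN)
  have hσ : (0 : ℝ) < ((N : ℝ) + 1)⁻¹ := by positivity
  have hτ : (0 : ℝ) < ((n : ℝ) + 1)⁻¹ := by positivity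
  refine (norm_euler_sub_euler_sq_le hφ hτ hσ hl _ _).trans ?_
  rw [mul_assoc]
  refine mul_le_mul_of_nonneg_left ?_ (sq_nonneg _)
  obtain ⟨a1, a2⟩ := hfl n
  obtain ⟨b1, b2⟩ := hfl N
  have hle : ((n : ℝ) + 1)⁻¹ ≤ ((N : ℝ) + 1)⁻¹ := by gcongr
  have hσ1 : ((N : ℝ) + 1)⁻¹ ≤ 1 := inv_le_one_of_one_le₀ (by linarith [N.cast_nonneg (α := ℝ)])
  set τ := ((n : ℝ) + 1)⁻¹
  set σ := ((N : ℝ) + 1)⁻¹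
  set p := (⌊t * ((n : ℝ) + 1)⌋₊ : ℝ)
  set q := (⌊t * ((N : ℝ) + 1)⌋₊ : ℝ)
  have c1 : (p * τ - q * σ) ^ 2 ≤ σ ^ 2 := sq_le_sq' (by linarith) (by linarith)
  have c2 : p * τ ^ 2 ≤ T * σ := by nlinarith
  have c3 : q * σ ^ 2 ≤ T * σ := by nlinarith
  nlinarith

/-- The scheme is nonexpansive in its starting point, so convergence extends from the dense set of
points with a subgradient. -/
theorem cauchySeq_eulerAt (x : H) (t : ℝ) : CauchySeq fun k => eulerAt φ x k t := by
  refine Metric.cauchySeq_iff'.2 fun ε hε => ?_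
  obtain ⟨y, hy, l, hl⟩ := Metric.dense_iff.1 hφ.dense_subdifferential x (ε / 3) (by positivity)
  obtain ⟨N, hN⟩ := Metric.cauchySeq_iff'.1 (cauchySeq_eulerAt_of_mem hφ hl t) (ε / 3)
    (by positivity)
  rw [Metric.mem_ball, dist_comm, dist_eq_norm] at hy
  refine ⟨N, fun n hn => ?_⟩
  calc dist (eulerAt φ x n t) (eulerAt φ x N t)
      ≤ dist (eulerAt φ x n t) (eulerAt φ y n t) + dist (eulerAt φ y n t) (eulerAt φ y N t)
        + dist (eulerAt φ y N t) (eulerAt φ x N t) := dist_triangle4 _ _ _ _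
    _ < ε / 3 + ε / 3 + ε / 3 := by
        refine add_lt_add_of_lt_of_le (add_lt_add ?_ (hN n hn)) ?_
        · rw [dist_eq_norm]
          exact (norm_eulerAt_sub_le hφ _ _ _ _).trans_lt hy
        · rw [dist_comm, dist_eq_norm]
          exact (norm_eulerAt_sub_le hφ _ _ _ _).trans hy.le
    _ = ε := by ring

end Complete

/-- The gradient flow of `φ` started at `x`, as the limit of the implicit Euler scheme. -/
noncomputable def flow (φ : H → ℝ≥0∞) (x : H) (t : ℝ) : H :=
  limUnder atTop fun k => eulerAt φ x k t

/-- Curves satisfying the evolution variational inequality in integrated form. -/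
def IsEVI {H : Type*} [NormedAddCommGroup H] (φ : H → ℝ≥0∞) (u : ℝ → H) : Prop :=
  ∀ s t : ℝ, 0 ≤ s → s < t → φ (u t) ≠ ⊤ ∧ ∀ v, φ v ≠ ⊤ →
    ‖u t - v‖ ^ 2 - ‖u s - v‖ ^ 2 ≤ 2 * (t - s) * ((φ v).toReal - (φ (u t)).toReal)

section Complete

variable [CompleteSpace H] (hφ : IsConvexLsc φ)
include hφ

theorem tendsto_eulerAt (x : H) (t : ℝ) :
    Tendsto (fun k => eulerAt φ x k t) atTop (𝓝 (flow φ x t)) :=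
  (cauchySeq_eulerAt hφ x t).tendsto_limUnder

theorem flow_zero (x : H) : flow φ x 0 = x := by
  refine tendsto_nhds_unique (tendsto_eulerAt hφ x 0) ?_
  simp [eulerAt]

theorem isEVI_flow (x : H) : IsEVI φ (flow φ x) := by
  intro s t hs hst
  -- The inequality is solved for the energy at time `t`, so that lower semicontinuity applies to
  -- the limit of `euler_evi`.
  have key : ∀ v, φ v ≠ ⊤ → φ (flow φ x t) ≠ ⊤ ∧ (φ (flow φ x t)).toReal ≤
      (φ v).toReal - (‖flow φ x t - v‖ ^ 2 - ‖flow φ x s - v‖ ^ 2) / (2 * (t - s)) := by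
    intro v hv
    have h1 := tendsto_floor_mul_inv (hs.trans hst.le)
    have h2 := tendsto_floor_mul_inv hs
    have h3 := h1.sub h2
    refine hφ.toReal_le_of_tendsto (tendsto_eulerAt hφ x t)
      (c := fun k : ℕ => (φ v).toReal - (‖eulerAt φ x k t - v‖ ^ 2 - ‖eulerAt φ x k s - v‖ ^ 2) /
        (2 * ((⌊t * ((k : ℝ) + 1)⌋₊ : ℝ) * ((k : ℝ) + 1)⁻¹
          - (⌊s * ((k : ℝ) + 1)⌋₊ : ℝ) * ((k : ℝ) + 1)⁻¹))) ?_ ?_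
    · refine tendsto_const_nhds.sub (Tendsto.div ?_ (h3.const_mul 2) (by linarith))
      exact (((tendsto_eulerAt hφ x t).sub_const v).norm.pow 2).sub
        (((tendsto_eulerAt hφ x s).sub_const v).norm.pow 2)
    -- For large `k` the two rounded times are distinct, so at least one Euler step separates them:
    -- this gives finite energy and a positive denominator.
    · filter_upwards [h3.eventually (lt_mem_nhds (sub_pos.2 hst))] with k hk
      have hk1 : (0 : ℝ) < ((k : ℝ) + 1)⁻¹ := by positivity
      rw [← sub_mul] at hk ⊢
      have hlt : (⌊s * ((k : ℝ) + 1)⌋₊ : ℝ) < ⌊t * ((k : ℝ) + 1)⌋₊ :=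
        sub_pos.1 (pos_of_mul_pos_left hk hk1.le)
      have hlt' : ⌊s * ((k : ℝ) + 1)⌋₊ < ⌊t * ((k : ℝ) + 1)⌋₊ := by exact_mod_cast hlt
      obtain ⟨j, hj⟩ := Nat.exists_eq_add_of_lt hlt'
      have h := euler_evi hφ hk1 ⌊s * ((k : ℝ) + 1)⌋₊ (j + 1) x hv
      rw [← add_assoc, ← hj] at h
      have hj' : ((j + 1 : ℕ) : ℝ) = (⌊t * ((k : ℝ) + 1)⌋₊ : ℝ) - ⌊s * ((k : ℝ) + 1)⌋₊ := by
        rw [hj]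
        push_cast
        ring
      rw [hj'] at h
      refine ⟨euler_ne_top hφ hk1 (by omega) x, ?_⟩
      have h5 := (div_le_iff₀' (show (0 : ℝ) < 2 * (((⌊t * ((k : ℝ) + 1)⌋₊ : ℝ)
        - ⌊s * ((k : ℝ) + 1)⌋₊) * ((k : ℝ) + 1)⁻¹) by linarith)).2 h
      unfold eulerAt
      linarith
  obtain ⟨v₀, hv₀⟩ := hφ.exists_ne_top
  refine ⟨(key v₀ hv₀).1, fun v hv => ?_⟩
  have h := (key v hv).2
  have h' : (‖flow φ x t - v‖ ^ 2 - ‖flow φ x s - v‖ ^ 2) / (2 * (t - s))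
    ≤ (φ v).toReal - (φ (flow φ x t)).toReal := by linarith
  rwa [div_le_iff₀' (by linarith)] at h'

/-- A nearby `y` with subgradient `l` moves with speed at most `‖l‖`, and the scheme started at `x`
stays within `‖x - y‖` of the one started at `y`. -/
theorem tendsto_flow_zero (x : H) : Tendsto (flow φ x) (𝓝[>] 0) (𝓝 x) := by
  refine Metric.tendsto_nhds.2 fun ε hε => ?_
  obtain ⟨y, hy, l, hl⟩ := Metric.dense_iff.1 hφ.dense_subdifferential x (ε / 4) (by positivity)
  rw [Metric.mem_ball, dist_comm, dist_eq_norm] at hy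
  have hlim : Tendsto (fun t : ℝ => t * ‖l‖) (𝓝[>] 0) (𝓝 0) := by
    have : Tendsto (fun t : ℝ => t * ‖l‖) (𝓝 0) (𝓝 (0 * ‖l‖)) := tendsto_id.mul_const _
    rw [zero_mul] at this
    exact this.mono_left nhdsWithin_le_nhds
  filter_upwards [hlim.eventually (gt_mem_nhds (show 0 < ε / 4 by positivity)),
    self_mem_nhdsWithin] with t ht ht0
  rw [dist_eq_norm]
  have hb : ∀ k, ‖eulerAt φ x k t - x‖ ≤ ε / 4 + ε / 4 + ε / 4 := by
    intro k
    have h1 := norm_eulerAt_sub_le hφ x y k t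
    have h2 : ‖eulerAt φ y k t - y‖ ≤ t * ‖l‖ := by
      refine (norm_euler_sub_self_le hφ (by positivity) _ hl).trans
        (mul_le_mul_of_nonneg_right ?_ (norm_nonneg _))
      rw [← div_eq_mul_inv, div_le_iff₀ (by positivity)]
      exact Nat.floor_le (mul_nonneg (le_of_lt ht0) (by positivity))
    calc ‖eulerAt φ x k t - x‖
        = ‖(eulerAt φ x k t - eulerAt φ y k t) + (eulerAt φ y k t - y) - (x - y)‖ := by
          congr 1; abel
      _ ≤ ‖eulerAt φ x k t - eulerAt φ y k t‖ + ‖eulerAt φ y k t - y‖ + ‖x - y‖ :=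
          (norm_sub_le _ _).trans (by gcongr; exact norm_add_le _ _)
      _ ≤ ε / 4 + ε / 4 + ε / 4 := by gcongr <;> linarith
  have := le_of_tendsto ((tendsto_eulerAt hφ x t).sub_const x).norm (Eventually.of_forall hb)
  linarith

end Complete

end

/-! ### Contraction, regularity and derivatives of curves satisfying the variational inequality. -/

namespace IsEVI

section

variable {H : Type*} [NormedAddCommGroup H] {φ : H → ℝ≥0∞} {u w : ℝ → H}

theorem shift (hu : IsEVI φ u) {h : ℝ} (hh : 0 ≤ h) : IsEVI φ fun t => u (t + h) := by
  intro s t hs hst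
  have := hu (s + h) (t + h) (by linarith) (by linarith)
  rwa [add_sub_add_right_eq_sub] at this

theorem sq_norm_sub_le (hu : IsEVI φ u) {s t : ℝ} (hs : 0 < s) (hst : s ≤ t) :
    ‖u t - u s‖ ^ 2 ≤ 2 * (t - s) * ((φ (u s)).toReal - (φ (u t)).toReal) := by
  rcases hst.eq_or_lt with rfl | hst
  · simp
  · have h := (hu s t hs.le hst).2 (u s) (hu 0 s le_rfl hs).1
    simpa using h

theorem toReal_antitone (hu : IsEVI φ u) {s t : ℝ} (hs : 0 < s) (hst : s ≤ t) :
    (φ (u t)).toReal ≤ (φ (u s)).toReal := by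
  rcases hst.eq_or_lt with rfl | hst
  · rfl
  · have h := (sq_nonneg _).trans (hu.sq_norm_sub_le hs hst.le)
    by_contra! hlt
    have : 2 * (t - s) * ((φ (u s)).toReal - (φ (u t)).toReal) < 0 :=
      mul_neg_of_pos_of_neg (by linarith) (by linarith)
    linarith

theorem norm_sub_antitone (hu : IsEVI φ u) (hw : IsEVI φ w) {s t : ℝ} (hs : 0 < s) (hst : s ≤ t) :
    ‖u t - w t‖ ≤ ‖u s - w s‖ := by
  -- Test `u` with `w b` and `w` with `u a`: the energy of `w` cancels and only the energy drop of
  -- `u` is left.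
  have step : ∀ a b : ℝ, 0 < a → a ≤ b → ‖u b - w b‖ ^ 2 - ‖u a - w a‖ ^ 2
      ≤ 2 * (b - a) * ((φ (u a)).toReal - (φ (u b)).toReal) := by
    intro a b ha hab
    rcases hab.eq_or_lt with rfl | hab
    · simp
    · have h1 := (hu a b ha.le hab).2 (w b) (hw 0 b le_rfl (ha.trans hab)).1
      have h2 := (hw a b ha.le hab).2 (u a) (hu 0 a le_rfl ha).1
      rw [norm_sub_rev (w b), norm_sub_rev (w a)] at h2
      linarith
  set d := (φ (u s)).toReal - (φ (u t)).toReal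
  -- Over `N + 1` equal subintervals the drops telescope, so the total error is of order `1 / (N +
  -- 1)`.
  have key : ∀ N : ℕ, ‖u t - w t‖ ^ 2 - ‖u s - w s‖ ^ 2
      ≤ 2 * (t - s) * d * (1 / ((N : ℝ) + 1)) := by
    intro N
    set δ := (t - s) / ((N : ℝ) + 1)
    have hδ : 0 ≤ δ := div_nonneg (by linarith) (by positivity)
    have ind : ∀ i : ℕ, ‖u (s + i * δ) - w (s + i * δ)‖ ^ 2 - ‖u s - w s‖ ^ 2
        ≤ 2 * δ * ((φ (u s)).toReal - (φ (u (s + i * δ))).toReal) := by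
      intro i
      induction i with
      | zero => simp
      | succ i ih =>
        have hi : 0 ≤ i * δ := by positivity
        have h := step (s + i * δ) (s + (i + 1 : ℕ) * δ) (by linarith) (by push_cast; linarith)
        have e : s + (i + 1 : ℕ) * δ - (s + i * δ) = δ := by push_cast; ring
        rw [e] at h
        linarith
    have h := ind (N + 1)
    have e : s + ((N + 1 : ℕ) : ℝ) * δ = t := by
      simp only [δ]
      push_cast
      field_simp
      ring
    rw [e] at h
    refine h.trans (le_of_eq ?_)
    simp only [δ, d]
    ring
  have hlim : Tendsto (fun N : ℕ => 2 * (t - s) * d * (1 / ((N : ℝ) + 1))) atTop (𝓝 0) := by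
    simpa using (tendsto_one_div_add_atTop_nhds_zero_nat (𝕜 := ℝ)).const_mul (2 * (t - s) * d)
  have := ge_of_tendsto' hlim key
  exact le_of_sq_le_sq (by linarith) (norm_nonneg _)

/-- Contraction between `u` and its shift makes increments of length `h` nonincreasing in time. The
last increment is thus bounded by the average of about `a / h` earlier ones, whose squares are
controlled by the energy drop. -/
theorem norm_add_sub_le (hu : IsEVI φ u) {a t h : ℝ} (ha : 0 < a) (ht : 2 * a ≤ t) (hh : 0 < h) :
    ‖u (t + h) - u t‖ ^ 2 ≤ 4 * (φ (u a)).toReal / a * h ^ 2 := by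
  have mono : ∀ s, 0 < s → s ≤ t → ‖u (t + h) - u t‖ ≤ ‖u (s + h) - u s‖ := fun s hs hst =>
    (hu.shift hh.le).norm_sub_antitone hu hs hst
  have hφ0 : 0 ≤ (φ (u a)).toReal := ENNReal.toReal_nonneg
  have hφa : ∀ s, a ≤ s → (φ (u s)).toReal ≤ (φ (u a)).toReal := fun s hs =>
    hu.toReal_antitone ha hs
  rcases le_total a h with hah | hah
  · have h1 := hu.sq_norm_sub_le (show 0 < t by linarith) (show t ≤ t + h by linarith)
    have h2 := hφa t (by linarith)
    have h3 : 0 ≤ (φ (u (t + h))).toReal := ENNReal.toReal_nonneg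
    refine h1.trans ?_
    rw [div_mul_eq_mul_div, le_div_iff₀ ha]
    have h4 : (φ (u t)).toReal - (φ (u (t + h))).toReal ≤ (φ (u a)).toReal := by linarith
    calc 2 * (t + h - t) * ((φ (u t)).toReal - (φ (u (t + h))).toReal) * a
        ≤ 2 * (t + h - t) * (φ (u a)).toReal * h := by
          rw [add_sub_cancel_left]
          gcongr
      _ ≤ 4 * (φ (u a)).toReal * h ^ 2 := by
          rw [add_sub_cancel_left]
          nlinarith [mul_nonneg hφ0 (sq_nonneg h)]
  -- Go back `n` steps of length `h` from `t`: this stays above time `a` as long as `n h ≤ a`,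
  -- because `2 a ≤ t`.
  · have ind : ∀ n : ℕ, n * h ≤ a → n * ‖u (t + h) - u t‖ ^ 2
        ≤ 2 * h * ((φ (u (t - n * h))).toReal - (φ (u t)).toReal) := by
      intro n
      induction n with
      | zero => simp
      | succ n ih =>
        intro hn
        push_cast at hn ⊢
        have ih' := ih (by linarith)
        have hn0 : 0 ≤ n * h := by positivity
        have h1 := hu.sq_norm_sub_le (s := t - (n + 1) * h) (t := t - n * h) (by linarith)
          (by linarith)
        have h2 := mono (t - (n + 1) * h) (by linarith) (by linarith)
        have e : t - (n + 1) * h + h = t - n * h := by ring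
        have e2 : t - n * h - (t - (n + 1) * h) = h := by ring
        rw [e] at h2
        rw [e2] at h1
        have h3 := pow_le_pow_left₀ (norm_nonneg _) h2 2
        linarith
    set n := ⌊a / h⌋₊
    have hn1 : (1 : ℝ) ≤ n := by
      have : 1 ≤ n := Nat.le_floor (by rw [Nat.cast_one, le_div_iff₀ hh]; linarith)
      exact_mod_cast this
    have hn2 : n * h ≤ a := (le_div_iff₀ hh).1 (Nat.floor_le (by positivity))
    have hn3 : a < (n + 1) * h := (div_lt_iff₀ hh).1 (Nat.lt_floor_add_one _)
    have h1 := ind n hn2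
    have h2 := hφa (t - n * h) (by linarith)
    have h3 : 0 ≤ (φ (u t)).toReal := ENNReal.toReal_nonneg
    rw [div_mul_eq_mul_div, le_div_iff₀ ha]
    set q := ‖u (t + h) - u t‖ ^ 2
    have hq : 0 ≤ q := sq_nonneg _
    have h4 : n * q ≤ 2 * h * (φ (u a)).toReal :=
      h1.trans (mul_le_mul_of_nonneg_left (by linarith) (by positivity))
    calc q * a ≤ q * (2 * n * h) := mul_le_mul_of_nonneg_left (by nlinarith) hq
      _ = 2 * h * (n * q) := by ring
      _ ≤ 2 * h * (2 * h * (φ (u a)).toReal) := mul_le_mul_of_nonneg_left h4 (by positivity)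
      _ = 4 * (φ (u a)).toReal * h ^ 2 := by ring

theorem exists_lipschitzOnWith (hu : IsEVI φ u) {a : ℝ} (ha : 0 < a) :
    ∃ K, LipschitzOnWith K u (Ici a) := by
  set c := 4 * (φ (u (a / 2))).toReal / (a / 2)
  have hc : 0 ≤ c := by positivity
  refine ⟨Real.toNNReal √c, LipschitzOnWith.of_dist_le_mul fun x hx y hy => ?_⟩
  rw [Real.coe_toNNReal _ (Real.sqrt_nonneg c)]
  wlog hxy : y ≤ x generalizing x y
  · rw [dist_comm, dist_comm x]
    exact this y hy x hx (le_of_not_ge hxy)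
  rcases hxy.eq_or_lt with rfl | hxy
  · simp
  have h := hu.norm_add_sub_le (a := a / 2) (t := y) (h := x - y) (by linarith)
    (by rw [mul_div_cancel₀ _ two_ne_zero]; exact hy) (by linarith)
  rw [add_sub_cancel] at h
  rw [dist_eq_norm, Real.dist_eq, abs_of_pos (sub_pos.2 hxy)]
  refine le_of_sq_le_sq ?_ (mul_nonneg (Real.sqrt_nonneg c) (by linarith))
  rwa [mul_pow, Real.sq_sqrt hc]

end

/-- Divide the variational inequality on `[t, s]` by `s - t` and let `s` decrease to `t`, using
lower semicontinuity of the energy. -/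
theorem neg_mem_subdifferential {H : Type*} [NormedAddCommGroup H] [InnerProductSpace ℝ H]
    {φ : H → ℝ≥0∞} {u : ℝ → H} (hφ : IsConvexLsc φ) (hu : IsEVI φ u) {t : ℝ} (ht : 0 < t) {w : H}
    (hw : HasDerivAt u w t) : -w ∈ subdifferential φ (u t) := by
  refine ⟨(hu 0 t le_rfl ht).1, fun v hv => ?_⟩
  have hd : HasDerivAt (fun s => ‖u s - v‖ ^ 2) (2 * inner ℝ (u t - v) w) t :=
    (hw.sub_const v).norm_sq
  have hslope : Tendsto (fun s => (s - t)⁻¹ * (‖u s - v‖ ^ 2 - ‖u t - v‖ ^ 2)) (𝓝[>] t)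
      (𝓝 (2 * inner ℝ (u t - v) w)) := by
    have := hd.hasDerivWithinAt (s := Ioi t)
    rw [hasDerivWithinAt_iff_tendsto_slope' self_notMem_Ioi] at this
    simpa [slope_def_field, div_eq_inv_mul, slope_fun_def] using this
  have hcont : Tendsto u (𝓝[>] t) (𝓝 (u t)) := hw.continuousAt.tendsto.mono_left nhdsWithin_le_nhds
  have h := hφ.toReal_le_of_tendsto hcont
    (c := fun s => (φ v).toReal - (s - t)⁻¹ * (‖u s - v‖ ^ 2 - ‖u t - v‖ ^ 2) / 2)
    (tendsto_const_nhds.sub (hslope.div_const 2)) ?_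
  · have e : inner ℝ (-w) (v - u t) = inner ℝ (u t - v) w := by
      rw [← neg_sub (u t) v, inner_neg_neg, real_inner_comm]
    rw [e]
    linarith [h.2]
  · filter_upwards [self_mem_nhdsWithin] with s hs
    obtain ⟨h1, h2⟩ := hu t s ht.le hs
    refine ⟨h1, ?_⟩
    have hpos : 0 < s - t := sub_pos.2 hs
    have : (s - t)⁻¹ * (‖u s - v‖ ^ 2 - ‖u t - v‖ ^ 2) ≤ 2 * ((φ v).toReal - (φ (u s)).toReal) := by
      rw [inv_mul_le_iff₀ hpos]
      linarith [h2 v hv]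
    linarith

end IsEVI

end GradientFlow

/-! ### Almost everywhere differentiability in separable Hilbert spaces, and uniqueness. -/

namespace GradientFlow

section

variable {H : Type*} [NormedAddCommGroup H] [InnerProductSpace ℝ H]

/-- Lipschitz curves in a separable Hilbert space are differentiable almost everywhere. -/
theorem ae_differentiableAt_of_lipschitzWith [CompleteSpace H] [SecondCountableTopology H]
    {u : ℝ → H} {K : NNReal} (hu : LipschitzWith K u) : ∀ᵐ t, DifferentiableAt ℝ u t := by
  -- Project onto increasing finite-dimensional subspaces with dense union, where a.e.
  -- differentiability is known. The derivatives `D n` of the projections converge a.e. to some `w`;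
  -- then `u` is a primitive of `w`, and Lebesgue differentiation applies.
  obtain ⟨d, hd⟩ := TopologicalSpace.exists_dense_seq H
  set V : ℕ → Submodule ℝ H := fun n => Submodule.span ℝ (d '' {i | i ≤ n})
  have hVfin : ∀ n, FiniteDimensional ℝ (V n) := fun n =>
    FiniteDimensional.span_of_finite ℝ ((finite_le_nat n).image d)
  have hVmono : Monotone V := fun m n h =>
    Submodule.span_mono (image_mono fun i (hi : i ≤ m) => hi.trans h)
  have hdV : ∀ k n, k ≤ n → d k ∈ V n := fun k n h =>
    Submodule.subset_span ⟨k, h, rfl⟩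
  set P : (n : ℕ) → H →L[ℝ] V n := fun n => (V n).orthogonalProjectionOnto with hP
  have hPlip : ∀ n, LipschitzWith K (fun t => P n (u t)) := by
    intro n
    have h1 : LipschitzWith 1 (P n) := (P n).lipschitzWith_of_opNorm_le
      ((V n).orthogonalProjectionOnto_norm_le)
    simpa [Function.comp_def] using h1.comp hu
  set D : ℕ → ℝ → H := fun n t => ((deriv (fun s => P n (u s)) t : V n) : H) with hD
  have hDmeas : ∀ n, AEStronglyMeasurable (D n) volume := fun n =>
    ((V n).subtypeL.continuous.comp_stronglyMeasurable
      (stronglyMeasurable_deriv _)).aestronglyMeasurable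
  have hae : ∀ᵐ t, ∀ n, HasDerivAt (fun s => P n (u s)) (deriv (fun s => P n (u s)) t) t :=
    ae_all_iff.2 fun n => (hPlip n).ae_differentiableAt_real.mono fun t ht => ht.hasDerivAt
  have hDnorm : ∀ n t, ‖D n t‖ ≤ K := fun n t => by
    have := norm_deriv_le_of_lipschitz (hPlip n) (x₀ := t)
    simpa [hD] using this
  -- inner products with elements of `V n` only see the projection
  have hinner : ∀ n (v : V n) (x : H), inner ℝ (v : H) ((P n x : V n) : H) = inner ℝ (v : H) x :=
    fun n v x => by
      simp only [hP]
      exact Submodule.inner_orthogonalProjectionOnto_eq_of_mem_left v x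
  have hderivV : ∀ᵐ t, ∀ n, ∀ v : V n,
      HasDerivAt (fun s => inner ℝ (v : H) (u s)) (inner ℝ (v : H) (D n t)) t := by
    filter_upwards [hae] with t ht n v
    have h1 : HasDerivAt (fun s => ((P n (u s) : V n) : H)) (D n t) t :=
      ((V n).subtypeL.hasFDerivAt.comp_hasDerivAt t (ht n))
    have h2 := (innerSL ℝ (v : H)).hasFDerivAt.comp_hasDerivAt t h1
    refine (h2.congr_of_eventuallyEq (Eventually.of_forall fun s => ?_))
    exact (hinner n v (u s)).symm
  have hconsist : ∀ᵐ t, ∀ m n, m ≤ n → ∀ v : V m,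
      inner ℝ (v : H) (D m t) = inner ℝ (v : H) (D n t) := by
    filter_upwards [hderivV] with t ht m n hmn v
    exact (ht m v).unique (ht n ⟨v, hVmono hmn v.2⟩)
  have hcauchy : ∀ᵐ t, CauchySeq fun n => D n t := by
    filter_upwards [hconsist] with t ht
    -- Pythagoras: by consistency `D m t` is the orthogonal projection of `D n t` onto `V m`.
    -- Bounded monotone norms therefore force a Cauchy sequence.
    have hsub : ∀ m n, m ≤ n → ‖D n t - D m t‖ ^ 2 = ‖D n t‖ ^ 2 - ‖D m t‖ ^ 2 := by
      intro m n hmn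
      have h := ht m n hmn (deriv (fun s => P m (u s)) t)
      change inner ℝ (D m t) (D m t) = inner ℝ (D m t) (D n t) at h
      rw [real_inner_self_eq_norm_sq] at h
      rw [norm_sub_sq_real, real_inner_comm, ← h]
      ring
    have hmono : Monotone fun n => ‖D n t‖ ^ 2 := fun m n hmn => by
      have := hsub m n hmn
      have h0 := sq_nonneg ‖D n t - D m t‖
      simp only
      linarith
    have hbd : BddAbove (range fun n => ‖D n t‖ ^ 2) := by
      refine ⟨(K : ℝ) ^ 2, ?_⟩
      rintro _ ⟨n, rfl⟩
      exact pow_le_pow_left₀ (norm_nonneg _) (hDnorm n t) 2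
    have hc := (tendsto_atTop_ciSup hmono hbd).cauchySeq
    refine Metric.cauchySeq_iff'.2 fun ε hε => ?_
    obtain ⟨N, hN⟩ := Metric.cauchySeq_iff'.1 hc (ε ^ 2) (by positivity)
    refine ⟨N, fun n hn => ?_⟩
    rw [dist_eq_norm]
    refine lt_of_pow_lt_pow_left₀ 2 hε.le ?_
    rw [hsub N n hn]
    exact (le_abs_self _).trans_lt (hN n hn)
  set w : ℝ → H := fun t => limUnder atTop fun n => D n t
  have hw : ∀ᵐ t, Tendsto (fun n => D n t) atTop (𝓝 (w t)) :=
    hcauchy.mono fun t ht => ht.tendsto_limUnder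
  have hwmeas : AEStronglyMeasurable w volume := aestronglyMeasurable_of_tendsto_ae _ hDmeas hw
  have hwnorm : ∀ᵐ t, ‖w t‖ ≤ K := hw.mono fun t ht =>
    le_of_tendsto ht.norm (Eventually.of_forall fun n => hDnorm n t)
  have hwloc : LocallyIntegrable w volume := by
    refine LocallyIntegrable.mono (f := fun _ : ℝ => (K : ℝ)) (locallyIntegrable_const _) hwmeas ?_
    filter_upwards [hwnorm] with t ht
    simpa using ht
  have hwderiv : ∀ᵐ t, ∀ k, HasDerivAt (fun s => inner ℝ (d k) (u s)) (inner ℝ (d k) (w t)) t := by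
    filter_upwards [hderivV, hw] with t ht hwt k
    have hlim : Tendsto (fun n => inner ℝ (d k) (D n t)) atTop (𝓝 (inner ℝ (d k) (w t))) :=
      tendsto_const_nhds.inner hwt
    have hev : ∀ᶠ n in atTop, inner ℝ (d k) (D n t) = deriv (fun s => inner ℝ (d k) (u s)) t := by
      filter_upwards [eventually_ge_atTop k] with n hn
      exact ((ht n ⟨d k, hdV k n hn⟩).deriv).symm
    have heq := tendsto_nhds_unique (tendsto_const_nhds.congr' (EventuallyEq.symm hev)) hlim
    rw [← heq]
    exact (ht k ⟨d k, hdV k k le_rfl⟩).differentiableAt.hasDerivAt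
  have hint : ∀ x, u x = u 0 + ∫ s in (0 : ℝ)..x, w s := by
    intro x
    rw [← sub_eq_iff_eq_add']
    -- Against each `d k` this is the fundamental theorem of calculus for a scalar Lipschitz
    -- function.
    refine hd.eq_of_inner_left (𝕜 := ℝ) ?_
    intro k
    have hwI : IntervalIntegrable w volume 0 x :=
      (hwloc.integrableOn_isCompact isCompact_uIcc).intervalIntegrable
    have hac : AbsolutelyContinuousOnInterval (fun s => inner ℝ (d k) (u s)) 0 x := by
      have : LipschitzWith (‖innerSL ℝ (d k)‖₊ * K) fun s => inner ℝ (d k) (u s) :=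
        (innerSL ℝ (d k)).lipschitz.comp hu
      exact this.lipschitzOnWith.absolutelyContinuousOnInterval
    have h1 := hac.integral_deriv_eq_sub
    have h2 : ∫ s in (0 : ℝ)..x, deriv (fun s => inner ℝ (d k) (u s)) s
        = ∫ s in (0 : ℝ)..x, inner ℝ (d k) (w s) := by
      refine intervalIntegral.integral_congr_ae ?_
      filter_upwards [hwderiv] with s hs _
      exact (hs k).deriv
    have h3 := (innerSL ℝ (d k)).intervalIntegral_comp_comm hwI
    simp only [innerSL_apply_apply] at h3
    rw [real_inner_comm, real_inner_comm _ (∫ s in (0 : ℝ)..x, w s), inner_sub_right, ← h1, h2, h3]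
  have hderiv := LocallyIntegrable.ae_hasDerivAt_integral hwloc
  filter_upwards [hderiv] with t ht
  have h := (ht 0).const_add (u 0)
  exact (h.congr_of_eventuallyEq (Eventually.of_forall hint)).differentiableAt

theorem ae_differentiableAt_of_lipschitzOnWith_Ici [CompleteSpace H] [SecondCountableTopology H]
    {u : ℝ → H} (hu : ∀ a : ℝ, 0 < a → ∃ K, LipschitzOnWith K u (Ici a)) :
    ∀ᵐ t : ℝ, 0 < t → DifferentiableAt ℝ u t := by
  have key : ∀ n : ℕ, ∀ᵐ t : ℝ, 1 / ((n : ℝ) + 1) < t → DifferentiableAt ℝ u t := by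
    intro n
    set a : ℝ := 1 / ((n : ℝ) + 1)
    obtain ⟨K, hK⟩ := hu a (by positivity)
    -- Freezing the curve before time `a` makes it globally Lipschitz without changing it on `(a,
    -- ∞)`.
    have hlip : LipschitzWith K fun t => u (max a t) := by
      have h1 : LipschitzWith 1 fun t : ℝ => max a t := LipschitzWith.id.const_max a
      refine LipschitzWith.of_dist_le_mul fun x y =>
        (hK.dist_le_mul _ (le_max_left a x) _ (le_max_left a y)).trans ?_
      gcongr
      simpa using h1.dist_le_mul x y
    filter_upwards [ae_differentiableAt_of_lipschitzWith hlip] with t ht hat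
    refine ht.congr_of_eventuallyEq ?_
    filter_upwards [Ioi_mem_nhds hat] with s hs
    rw [max_eq_right (le_of_lt hs)]
  filter_upwards [ae_all_iff.2 key] with t ht h0
  obtain ⟨n, hn⟩ := exists_nat_one_div_lt h0
  exact ht n hn

/-- An absolutely continuous real function with nonpositive derivative is nonincreasing. -/
theorem le_of_absolutelyContinuousOnInterval {A : ℝ → ℝ} {a b : ℝ} (hab : a ≤ b)
    (hA : AbsolutelyContinuousOnInterval A a b)
    (hd : ∀ᵐ t : ℝ, t ∈ Ioc a b → deriv A t ≤ 0) : A b ≤ A a := by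
  have h1 := hA.integral_deriv_eq_sub
  have h2 : ∫ t in a..b, deriv A t ≤ 0 := by
    rw [intervalIntegral.integral_of_le hab]
    refine setIntegral_nonpos_of_ae_restrict ?_
    exact (ae_restrict_iff' measurableSet_Ioc).2 hd
  linarith

theorem norm_sq_absolutelyContinuousOnInterval {H : Type*} [NormedAddCommGroup H] {u : ℝ → H} {a b : ℝ}
    (hu : AbsolutelyContinuousOnInterval u a b) :
    AbsolutelyContinuousOnInterval (fun t => ‖u t‖ ^ 2) a b := by
  have h : AbsolutelyContinuousOnInterval (fun t => ‖u t‖) a b := by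
    refine squeeze_zero (fun E => Finset.sum_nonneg fun i _ => dist_nonneg)
      (fun E => Finset.sum_le_sum fun i _ => ?_) hu
    rw [Real.dist_eq, dist_eq_norm]
    exact abs_norm_sub_norm_le _ _
  simpa [pow_two] using h.fun_mul h

/-- Uniqueness of the gradient flow of a functional, in the class of locally absolutely continuous
curves. -/
theorem eq_of_ae_hasDerivAt {φ : H → ℝ≥0∞} {u w : ℝ → H} {x : H}
    (hu0 : Tendsto u (𝓝[>] 0) (𝓝 x)) (hw0 : Tendsto w (𝓝[>] 0) (𝓝 x))
    (huac : ∀ a b : ℝ, 0 < a → a ≤ b → AbsolutelyContinuousOnInterval u a b)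
    (hwac : ∀ a b : ℝ, 0 < a → a ≤ b → AbsolutelyContinuousOnInterval w a b)
    (hu : ∀ᵐ t : ℝ, 0 < t → ∃ l ∈ subdifferential φ (u t), HasDerivAt u (-l) t)
    (hw : ∀ᵐ t : ℝ, 0 < t → ∃ l ∈ subdifferential φ (w t), HasDerivAt w (-l) t)
    {t : ℝ} (ht : 0 < t) : u t = w t := by
  have hle : ∀ s, 0 < s → s ≤ t → ‖u t - w t‖ ^ 2 ≤ ‖u s - w s‖ ^ 2 := by
    intro s hs hst
    refine le_of_absolutelyContinuousOnInterval (A := fun t => ‖u t - w t‖ ^ 2) hst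
      (norm_sq_absolutelyContinuousOnInterval ((huac s t hs hst).fun_sub (hwac s t hs hst))) ?_
    filter_upwards [hu, hw] with r hur hwr hr
    obtain ⟨l, hl, hdl⟩ := hur (hs.trans hr.1)
    obtain ⟨k, hk, hdk⟩ := hwr (hs.trans hr.1)
    rw [((hdl.fun_sub hdk).norm_sq : HasDerivAt (fun t => ‖u t - w t‖ ^ 2) _ r).deriv]
    -- Adding the two subgradient inequalities cancels the energies: the subdifferential is
    -- monotone.
    have h1 := hl.2 _ hk.1
    have h2 := hk.2 _ hl.1
    have e : inner ℝ (u r - w r) (-l - -k) = inner ℝ l (w r - u r) + inner ℝ k (u r - w r) := by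
      rw [← neg_sub (u r), inner_neg_right, real_inner_comm, inner_sub_left, inner_neg_left,
        inner_neg_left]
      ring
    rw [e]
    linarith
  have hlim : Tendsto (fun s => ‖u s - w s‖ ^ 2) (𝓝[>] 0) (𝓝 0) := by
    simpa using (hu0.sub hw0).norm.pow 2
  have := ge_of_tendsto hlim (by
    filter_upwards [Ioc_mem_nhdsGT ht] with s hs
    exact hle s hs.1 hs.2)
  have h0 : ‖u t - w t‖ = 0 := by
    have := sq_nonneg ‖u t - w t‖
    exact pow_eq_zero_iff two_ne_zero |>.1 (by linarith)
  exact sub_eq_zero.1 (norm_eq_zero.1 h0)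

end

end GradientFlow

/-! ### Calculus of slopes; convexity and lower semicontinuity of the Cheeger energy. -/

namespace MetricMeasure

section Slope

variable {X : Type*} [MetricSpace X]

theorem eventually_abs_sub_le_of_localSlope {f : X → ℝ} {x : X} (hf : localSlope f x ≠ ⊤) {ε : ℝ}
    (hε : 0 < ε) :
    ∀ᶠ y in 𝓝[≠] x, |f y - f x| ≤ ((localSlope f x).toReal + ε) * dist y x := by
  have hlt : localSlope f x < ENNReal.ofReal ((localSlope f x).toReal + ε) := by
    rw [ENNReal.lt_ofReal_iff_toReal_lt hf]
    linarith
  filter_upwards [eventually_lt_of_limsup_lt hlt, self_mem_nhdsWithin] with y hy hyx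
  have hd : 0 < dist y x := dist_pos.2 hyx
  rw [← div_le_iff₀ hd]
  have h0 : (0 : ℝ) ≤ (localSlope f x).toReal := ENNReal.toReal_nonneg
  exact ((ENNReal.ofReal_lt_ofReal_iff (by linarith)).1 hy).le

theorem localSlope_le_of_eventually {f : X → ℝ} {x : X} {r : ℝ}
    (h : ∀ ε > 0, ∀ᶠ y in 𝓝[≠] x, |f y - f x| ≤ (r + ε) * dist y x) :
    localSlope f x ≤ ENNReal.ofReal r := by
  have key : ∀ ε > 0, localSlope f x ≤ ENNReal.ofReal (r + ε) := by
    intro ε hε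
    refine limsup_le_of_le (h := ?_)
    filter_upwards [h ε hε, self_mem_nhdsWithin] with y hy hyx
    exact ENNReal.ofReal_le_ofReal ((div_le_iff₀ (dist_pos.2 hyx)).2 hy)
  have hlim : Tendsto (fun ε : ℝ => ENNReal.ofReal (r + ε)) (𝓝[>] 0) (𝓝 (ENNReal.ofReal r)) := by
    have : Tendsto (fun ε : ℝ => ENNReal.ofReal (r + ε)) (𝓝 0) (𝓝 (ENNReal.ofReal (r + 0))) :=
      (ENNReal.continuous_ofReal.comp (continuous_const.add continuous_id)).tendsto 0
    rw [add_zero] at this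
    exact this.mono_left nhdsWithin_le_nhds
  refine ge_of_tendsto hlim ?_
  filter_upwards [self_mem_nhdsWithin] with ε hε
  exact key ε hε

theorem localSlope_le_of_lipschitzWith {f : X → ℝ} {K : NNReal} (hf : LipschitzWith K f) (x : X) :
    localSlope f x ≤ K := by
  rw [← ENNReal.ofReal_coe_nnreal]
  refine localSlope_le_of_eventually fun ε hε => Eventually.of_forall fun y => ?_
  have h := hf.dist_le_mul y x
  rw [Real.dist_eq] at h
  have : 0 ≤ ε * dist y x := by positivity
  linarith

theorem localSlope_ne_top {f : X → ℝ} (hf : IsLipBdd f) (x : X) : localSlope f x ≠ ⊤ := by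
  obtain ⟨⟨K, hK⟩, -⟩ := hf
  exact ne_top_of_le_ne_top ENNReal.coe_ne_top (localSlope_le_of_lipschitzWith hK x)

/-- A chain rule: if the increments of `h` are controlled by those of `f` and `g`, then so is its
slope. -/
theorem toReal_localSlope_le {f g h : X → ℝ} {x : X} (hf : localSlope f x ≠ ⊤)
    (hg : localSlope g x ≠ ⊤) {α β : ℝ} (hα : 0 ≤ α) (hβ : 0 ≤ β)
    (H : ∀ ε > 0, ∀ᶠ y in 𝓝[≠] x,
      |h y - h x| ≤ α * |f y - f x| + β * |g y - g x| + ε * dist y x) :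
    localSlope h x ≤
      ENNReal.ofReal (α * (localSlope f x).toReal + β * (localSlope g x).toReal) := by
  refine localSlope_le_of_eventually fun ε hε => ?_
  have hpos : 0 < α + β + 1 := by positivity
  have hδ : 0 < ε / (α + β + 1) := by positivity
  filter_upwards [H _ hδ, eventually_abs_sub_le_of_localSlope hf hδ,
    eventually_abs_sub_le_of_localSlope hg hδ] with y h1 h2 h3
  have h4 := mul_le_mul_of_nonneg_left h2 hα
  have h5 := mul_le_mul_of_nonneg_left h3 hβ
  have h6 : (α + β + 1) * (ε / (α + β + 1)) = ε := by field_simp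
  calc |h y - h x| ≤ α * (((localSlope f x).toReal + ε / (α + β + 1)) * dist y x)
        + β * (((localSlope g x).toReal + ε / (α + β + 1)) * dist y x)
        + ε / (α + β + 1) * dist y x := by linarith
    _ = (α * (localSlope f x).toReal + β * (localSlope g x).toReal
        + (α + β + 1) * (ε / (α + β + 1))) * dist y x := by ring
    _ = _ := by rw [h6]

theorem localSlope_eq_zero_of_eventuallyEq {f : X → ℝ} {x : X} (h : f =ᶠ[𝓝 x] 0) :
    localSlope f x = 0 := by
  have h0 : f x = 0 := h.self_of_nhds
  have : localSlope f x ≤ ENNReal.ofReal 0 := by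
    refine localSlope_le_of_eventually fun ε hε => ?_
    filter_upwards [h.filter_mono nhdsWithin_le_nhds] with y hy
    simp only [hy, h0, Pi.zero_apply, sub_zero, abs_zero]
    positivity
  simpa using this

/-- The slope is a countable infimum of suprema over punctured balls. Each supremum has open
superlevel sets, since all conditions on the base point are strict and continuous. -/
theorem measurable_localSlope [MeasurableSpace X] [BorelSpace X] {f : X → ℝ} (hf : Continuous f) :
    Measurable (localSlope f) := by
  have heq : localSlope f = fun x => ⨅ n : ℕ, ⨆ y ∈ Metric.ball x (1 / ((n : ℝ) + 1)) ∩ {x}ᶜ,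
      ENNReal.ofReal (|f y - f x| / dist y x) := by
    funext x
    have := (nhdsWithin_hasBasis (Metric.nhds_basis_ball_inv_nat_succ (x := x)) {x}ᶜ)
    rw [localSlope, this.limsup_eq_iInf_iSup]
    simp
  rw [heq]
  refine Measurable.iInf fun n => measurable_of_Ioi fun c => IsOpen.measurableSet ?_
  have hset : (fun x => ⨆ y ∈ Metric.ball x (1 / ((n : ℝ) + 1)) ∩ {x}ᶜ,
      ENNReal.ofReal (|f y - f x| / dist y x)) ⁻¹' Ioi c
      = ⋃ y, {x | dist y x < 1 / ((n : ℝ) + 1) ∧ 0 < dist y x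
          ∧ c < ENNReal.ofReal (|f y - f x| / dist y x)} := by
    ext x
    simp only [mem_preimage, mem_Ioi, lt_iSup_iff, mem_iUnion, mem_ofPred_eq, mem_inter_iff,
      Metric.mem_ball, mem_compl_iff, mem_singleton_iff, dist_pos, exists_prop, and_assoc, ne_eq]
  rw [hset]
  refine isOpen_iUnion fun y => isOpen_iff_mem_nhds.2 fun x ⟨h1, h2, h3⟩ => ?_
  have hd : ContinuousAt (fun x => dist y x) x := by fun_prop
  have hq : ContinuousAt (fun x => ENNReal.ofReal (|f y - f x| / dist y x)) x :=
    ENNReal.continuous_ofReal.continuousAt.comp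
      (((continuous_const.sub hf).abs.continuousAt).div hd h2.ne')
  filter_upwards [hd.eventually (gt_mem_nhds h1), hd.eventually (lt_mem_nhds h2),
    hq.eventually (lt_mem_nhds h3)] with z a b c
  exact ⟨a, b, c⟩

theorem IsLipBdd.combo {F G : X → ℝ} (hF : IsLipBdd F) (hG : IsLipBdd G) (a b : ℝ) :
    IsLipBdd fun x => a * F x + b * G x := by
  obtain ⟨⟨K, hK⟩, C, hC⟩ := hF
  obtain ⟨⟨L, hL⟩, D, hD⟩ := hG
  refine ⟨⟨_, ((lipschitzWith_smul a).comp hK).add ((lipschitzWith_smul b).comp hL)⟩,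
    |a| * C + |b| * D, fun x => (abs_add_le _ _).trans ?_⟩
  rw [abs_mul, abs_mul]
  gcongr
  · exact hC x
  · exact hD x

theorem IsLipBdd.continuous {F : X → ℝ} (hF : IsLipBdd F) : Continuous F :=
  hF.1.choose_spec.continuous

end Slope

section Cheeger

variable {X : Type*} [MetricSpace X] [MeasurableSpace X]

/-- The energy `½ ∫ |Df|² dm` of a function. -/
noncomputable def slopeEnergy (m : Measure X) (f : X → ℝ) : ℝ≥0∞ :=
  2⁻¹ * ∫⁻ x, localSlope f x ^ 2 ∂m

variable {m : Measure X}

theorem cheegerEnergy_le_liminf {f : Lp ℝ 2 m} {F : ℕ → X → ℝ} (h1 : ∀ n, IsLipBdd (F n))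
    (h2 : ∀ n, MemLp (F n) 2 m)
    (h3 : Tendsto (fun n => eLpNorm (fun x => F n x - f x) 2 m) atTop (𝓝 0)) :
    cheegerEnergy m f ≤ liminf (fun n => slopeEnergy m (F n)) atTop :=
  sInf_le ⟨F, h1, h2, h3, rfl⟩

theorem exists_slopeEnergy_lt {f : Lp ℝ 2 m} {c : ℝ≥0∞} (hc : cheegerEnergy m f < c) {ε : ℝ≥0∞}
    (hε : ε ≠ 0) : ∃ F, IsLipBdd F ∧ MemLp F 2 m ∧ eLpNorm (fun x => F x - f x) 2 m < ε ∧
      slopeEnergy m F < c := by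
  obtain ⟨_, ⟨F, h1, h2, h3, rfl⟩, hlt⟩ := sInf_lt_iff.1 hc
  obtain ⟨n, hn1, hn2⟩ := ((frequently_lt_of_liminf_lt (by isBoundedDefault) hlt).and_eventually
    (h3.eventually (gt_mem_nhds (pos_iff_ne_zero.2 hε)))).exists
  exact ⟨F n, h1 n, h2 n, hn2, hn1⟩

theorem tendsto_inv_natCast_add_one :
    Tendsto (fun n : ℕ => ((n : ℝ≥0∞) + 1)⁻¹) atTop (𝓝 0) := by
  have := (tendsto_add_atTop_iff_nat 1).2 ENNReal.tendsto_inv_nat_nhds_zero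
  simpa using this

theorem exists_recovery {f : Lp ℝ 2 m} (hf : cheegerEnergy m f ≠ ⊤) :
    ∃ F : ℕ → X → ℝ, (∀ n, IsLipBdd (F n)) ∧ (∀ n, MemLp (F n) 2 m) ∧
      Tendsto (fun n => eLpNorm (fun x => F n x - f x) 2 m) atTop (𝓝 0) ∧
      ∀ n, slopeEnergy m (F n) ≤ cheegerEnergy m f + ((n : ℝ≥0∞) + 1)⁻¹ := by
  have h : ∀ n : ℕ, ∃ F, IsLipBdd F ∧ MemLp F 2 m ∧
      eLpNorm (fun x => F x - f x) 2 m < ((n : ℝ≥0∞) + 1)⁻¹ ∧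
      slopeEnergy m F < cheegerEnergy m f + ((n : ℝ≥0∞) + 1)⁻¹ := fun n =>
    exists_slopeEnergy_lt (ENNReal.lt_add_right hf (by simp)) (by simp)
  choose F h1 h2 h3 h4 using h
  exact ⟨F, h1, h2, tendsto_of_tendsto_of_tendsto_of_le_of_le tendsto_const_nhds
    tendsto_inv_natCast_add_one (fun n => zero_le) fun n => (h3 n).le, fun n => (h4 n).le⟩

theorem eLpNorm_le_of_abs_le {X : Type*} [MeasurableSpace X] {m : Measure X} {u v w : X → ℝ} (hv : AEStronglyMeasurable v m)
    (hw : AEStronglyMeasurable w m) {α β : ℝ} (hα : 0 ≤ α) (hβ : 0 ≤ β)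
    (h : ∀ᵐ x ∂m, |u x| ≤ α * |v x| + β * |w x|) :
    eLpNorm u 2 m ≤ ENNReal.ofReal α * eLpNorm v 2 m + ENNReal.ofReal β * eLpNorm w 2 m := by
  have h1 : eLpNorm u 2 m ≤ eLpNorm ((fun x => α * |v x|) + fun x => β * |w x|) 2 m := by
    refine eLpNorm_mono_ae (h.mono fun x hx => ?_)
    rw [Real.norm_eq_abs, Real.norm_eq_abs, Pi.add_apply]
    exact hx.trans (le_abs_self _)
  have h2 : ∀ (γ : ℝ) (z : X → ℝ), 0 ≤ γ →
      eLpNorm (fun x => γ * |z x|) 2 m = ENNReal.ofReal γ * eLpNorm z 2 m := by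
    intro γ z hγ
    have := eLpNorm_const_smul γ (fun x => ‖z x‖) 2 m
    rw [eLpNorm_norm, Real.enorm_of_nonneg hγ] at this
    exact this
  refine h1.trans ((eLpNorm_add_le ?_ ?_ (by norm_num)).trans ?_)
  · exact hv.norm.const_mul α
  · exact hw.norm.const_mul β
  · rw [h2 _ _ hα, h2 _ _ hβ]

theorem tendsto_eLpNorm_sub {X : Type*} [MeasurableSpace X] {m : Measure X} {f g h : Lp ℝ 2 m} {F G H : ℕ → X → ℝ}
    (hF : ∀ n, MemLp (F n) 2 m) (hG : ∀ n, MemLp (G n) 2 m)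
    (hFf : Tendsto (fun n => eLpNorm (fun x => F n x - f x) 2 m) atTop (𝓝 0))
    (hGg : Tendsto (fun n => eLpNorm (fun x => G n x - g x) 2 m) atTop (𝓝 0))
    {α β : ℝ} (hα : 0 ≤ α) (hβ : 0 ≤ β)
    (hH : ∀ n, ∀ᵐ x ∂m, |H n x - h x| ≤ α * |F n x - f x| + β * |G n x - g x|) :
    Tendsto (fun n => eLpNorm (fun x => H n x - h x) 2 m) atTop (𝓝 0) := by
  refine tendsto_of_tendsto_of_tendsto_of_le_of_le tendsto_const_nhds
    (h := fun n => ENNReal.ofReal α * eLpNorm (fun x => F n x - f x) 2 m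
      + ENNReal.ofReal β * eLpNorm (fun x => G n x - g x) 2 m) ?_ (fun n => zero_le)
    fun n => eLpNorm_le_of_abs_le ((hF n).1.sub (Lp.aestronglyMeasurable f))
      ((hG n).1.sub (Lp.aestronglyMeasurable g)) hα hβ (hH n)
  have h1 := ENNReal.Tendsto.const_mul hFf (Or.inr (ENNReal.ofReal_ne_top (r := α)))
  have h2 := ENNReal.Tendsto.const_mul hGg (Or.inr (ENNReal.ofReal_ne_top (r := β)))
  simpa using h1.add h2

/-- Diagonal argument: near a limit of points of a sublevel set one finds Lipschitz functions whose
slope energy is almost below the level. -/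
theorem lowerSemicontinuous_cheegerEnergy : LowerSemicontinuous (cheegerEnergy m) := by
  refine lowerSemicontinuous_iff_isClosed_preimage.2 fun c => ?_
  rcases eq_or_ne c ⊤ with rfl | hc
  · simp
  refine isClosed_of_closure_subset fun f hf => ?_
  have h : ∀ n : ℕ, ∃ F, IsLipBdd F ∧ MemLp F 2 m ∧
      eLpNorm (fun x => F x - f x) 2 m ≤ 2 * ((n : ℝ≥0∞) + 1)⁻¹ ∧
      slopeEnergy m F ≤ c + ((n : ℝ≥0∞) + 1)⁻¹ := by
    intro n
    obtain ⟨g, hg, hfg⟩ := EMetric.mem_closure_iff.1 hf ((n : ℝ≥0∞) + 1)⁻¹ (by simp)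
    have hg' : cheegerEnergy m g ≤ c := hg
    obtain ⟨F, h1, h2, h3, h4⟩ := exists_slopeEnergy_lt (ε := ((n : ℝ≥0∞) + 1)⁻¹)
      (hg'.trans_lt (ENNReal.lt_add_right hc (show ((n : ℝ≥0∞) + 1)⁻¹ ≠ 0 by simp))) (by simp)
    refine ⟨F, h1, h2, ?_, h4.le⟩
    have e : (fun x => F x - f x) = (fun x => F x - g x) + fun x => g x - f x := by
      funext x
      simp
    rw [e, two_mul]
    refine (eLpNorm_add_le (h2.1.sub (Lp.aestronglyMeasurable g))
      ((Lp.aestronglyMeasurable g).sub (Lp.aestronglyMeasurable f)) (by norm_num)).trans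
      (add_le_add h3.le ?_)
    rw [edist_comm, Lp.edist_def] at hfg
    exact hfg.le
  choose F h1 h2 h3 h4 using h
  have hlim := tendsto_inv_natCast_add_one
  have h5 : Tendsto (fun n => eLpNorm (fun x => F n x - f x) 2 m) atTop (𝓝 0) := by
    refine tendsto_of_tendsto_of_tendsto_of_le_of_le tendsto_const_nhds ?_
      (fun n => zero_le) h3
    simpa using ENNReal.Tendsto.const_mul hlim (Or.inr (ENNReal.ofNat_ne_top (n := 2)))
  have h6 : Tendsto (fun n : ℕ => c + ((n : ℝ≥0∞) + 1)⁻¹) atTop (𝓝 c) := by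
    simpa using hlim.const_add c
  calc cheegerEnergy m f ≤ liminf (fun n => slopeEnergy m (F n)) atTop :=
        cheegerEnergy_le_liminf h1 h2 h5
    _ ≤ liminf (fun n : ℕ => c + ((n : ℝ≥0∞) + 1)⁻¹) atTop :=
        liminf_le_liminf (Eventually.of_forall h4)
    _ = c := h6.liminf_eq

theorem slopeEnergy_combo_le [BorelSpace X] {F G : X → ℝ} (hF : IsLipBdd F) (hG : IsLipBdd G)
    {a b : ℝ} (ha : 0 ≤ a) (hb : 0 ≤ b) (hab : a + b = 1) :
    slopeEnergy m (fun x => a * F x + b * G x)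
      ≤ ENNReal.ofReal a * slopeEnergy m F + ENNReal.ofReal b * slopeEnergy m G := by
  have hpt : ∀ x, localSlope (fun x => a * F x + b * G x) x ^ 2
      ≤ ENNReal.ofReal a * localSlope F x ^ 2 + ENNReal.ofReal b * localSlope G x ^ 2 := by
    intro x
    have hFt := localSlope_ne_top hF x
    have hGt := localSlope_ne_top hG x
    have h := toReal_localSlope_le (h := fun x => a * F x + b * G x) hFt hGt ha hb
      (fun ε hε => Eventually.of_forall fun y => by
        have e : a * F y + b * G y - (a * F x + b * G x)
          = a * (F y - F x) + b * (G y - G x) := by ring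
        have h0 : 0 ≤ ε * dist y x := by positivity
        have h1 := abs_add_le (a * (F y - F x)) (b * (G y - G x))
        rw [abs_mul, abs_mul, abs_of_nonneg ha, abs_of_nonneg hb] at h1
        simp only [e]
        linarith)
    have hs : 0 ≤ (localSlope F x).toReal := ENNReal.toReal_nonneg
    have ht : 0 ≤ (localSlope G x).toReal := ENNReal.toReal_nonneg
    refine (pow_le_pow_left' h 2).trans ?_
    rw [← ENNReal.ofReal_toReal hFt, ← ENNReal.ofReal_toReal hGt, ← ENNReal.ofReal_pow hs,
      ← ENNReal.ofReal_pow ht, ← ENNReal.ofReal_mul ha, ← ENNReal.ofReal_mul hb,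
      ← ENNReal.ofReal_add (by positivity) (by positivity), ENNReal.toReal_ofReal hs,
      ENNReal.toReal_ofReal ht, ← ENNReal.ofReal_pow (by positivity)]
    refine ENNReal.ofReal_le_ofReal ?_
    have hb' : b = 1 - a := by linarith
    subst hb'
    nlinarith [mul_nonneg (mul_nonneg ha hb)
      (sq_nonneg ((localSlope F x).toReal - (localSlope G x).toReal))]
  unfold slopeEnergy
  calc 2⁻¹ * ∫⁻ x, localSlope (fun x => a * F x + b * G x) x ^ 2 ∂m
      ≤ 2⁻¹ * ∫⁻ x, (ENNReal.ofReal a * localSlope F x ^ 2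
        + ENNReal.ofReal b * localSlope G x ^ 2) ∂m := by
        gcongr with x
        exact hpt x
    _ = _ := by
        rw [lintegral_add_left (((measurable_localSlope hF.continuous).pow_const 2).const_mul _),
          lintegral_const_mul _ ((measurable_localSlope hF.continuous).pow_const 2),
          lintegral_const_mul _ ((measurable_localSlope hG.continuous).pow_const 2)]
        ring

theorem cheegerEnergy_convex [BorelSpace X] (f g : Lp ℝ 2 m) (a b : ℝ) (ha : 0 ≤ a) (hb : 0 ≤ b)
    (hab : a + b = 1) : cheegerEnergy m (a • f + b • g)
      ≤ ENNReal.ofReal a * cheegerEnergy m f + ENNReal.ofReal b * cheegerEnergy m g := by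
  -- Zero weights are treated apart: as `0 * ⊤ = 0`, the right-hand side may be finite although an
  -- energy is infinite.
  rcases ha.eq_or_lt with rfl | ha'
  · have : b = 1 := by linarith
    simp [this]
  rcases hb.eq_or_lt with rfl | hb'
  · have : a = 1 := by linarith
    simp [this]
  by_cases hf : cheegerEnergy m f = ⊤
  · simp [hf, ENNReal.mul_top, ha']
  by_cases hg : cheegerEnergy m g = ⊤
  · simp [hg, ENNReal.mul_top, hb']
  obtain ⟨F, F1, F2, F3, F4⟩ := exists_recovery hf
  obtain ⟨G, G1, G2, G3, G4⟩ := exists_recovery hg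
  have hcoe : ∀ᵐ x ∂m, (a • f + b • g : Lp ℝ 2 m) x = a * f x + b * g x := by
    filter_upwards [Lp.coeFn_add (a • f) (b • g), Lp.coeFn_smul a f, Lp.coeFn_smul b g]
      with x h1 h2 h3
    rw [h1, Pi.add_apply, h2, h3]
    simp
  have hlim := tendsto_eLpNorm_sub (h := a • f + b • g) (H := fun n x => a * F n x + b * G n x)
    F2 G2 F3 G3 ha hb (fun n => by
      filter_upwards [hcoe] with x hx
      rw [hx]
      have e : a * F n x + b * G n x - (a * f x + b * g x)
        = a * (F n x - f x) + b * (G n x - g x) := by ring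
      have h1 := abs_add_le (a * (F n x - f x)) (b * (G n x - g x))
      rw [abs_mul, abs_mul, abs_of_nonneg ha, abs_of_nonneg hb] at h1
      rwa [e])
  have hlim2 : Tendsto (fun n : ℕ => ENNReal.ofReal a * (cheegerEnergy m f + ((n : ℝ≥0∞) + 1)⁻¹)
      + ENNReal.ofReal b * (cheegerEnergy m g + ((n : ℝ≥0∞) + 1)⁻¹)) atTop
      (𝓝 (ENNReal.ofReal a * cheegerEnergy m f + ENNReal.ofReal b * cheegerEnergy m g)) := by
    refine Tendsto.add ?_ ?_
    · refine ENNReal.Tendsto.const_mul ?_ (Or.inr ENNReal.ofReal_ne_top)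
      simpa using tendsto_inv_natCast_add_one.const_add (cheegerEnergy m f)
    · refine ENNReal.Tendsto.const_mul ?_ (Or.inr ENNReal.ofReal_ne_top)
      simpa using tendsto_inv_natCast_add_one.const_add (cheegerEnergy m g)
  refine (cheegerEnergy_le_liminf (fun n => (F1 n).combo (G1 n) a b)
    (fun n => ((F2 n).const_mul a).add ((G2 n).const_mul b)) hlim).trans ?_
  rw [← hlim2.liminf_eq]
  refine liminf_le_liminf (Eventually.of_forall fun n => ?_)
  refine (slopeEnergy_combo_le (F1 n) (G1 n) ha hb hab).trans ?_
  gcongr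
  · exact F4 n
  · exact G4 n

theorem GrowthCondition.measure_ball_lt_top {o : X} {κ : ℝ}
    (h : ∀ r : ℝ, 0 < r → m (Metric.ball o r) ≤ ENNReal.ofReal (Real.exp (κ * r ^ 2))) (r : ℝ) :
    m (Metric.ball o r) < ⊤ :=
  (measure_mono (Metric.ball_subset_ball (le_max_left r 1))).trans_lt
    ((h (max r 1) (by positivity)).trans_lt ENNReal.ofReal_lt_top)

theorem isLocallyFiniteMeasure_of_ball {o : X} (h : ∀ r, m (Metric.ball o r) < ⊤) :
    IsLocallyFiniteMeasure m :=
  ⟨fun x => ⟨Metric.ball o (dist x o + 1),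
    Metric.isOpen_ball.mem_nhds (by simp [Metric.mem_ball]), h _⟩⟩

end Cheeger

/-! ### Density of the functions of finite Cheeger energy. -/

section Density

variable {X : Type*} [MetricSpace X] [MeasurableSpace X] [BorelSpace X] {m : Measure X}

theorem memLp_of_boundedSupport {o : X} (h : ∀ r, m (Metric.ball o r) < ⊤) {F : X → ℝ}
    (hF : IsLipBdd F) {R : ℝ} (hR : ∀ x, x ∉ Metric.ball o R → F x = 0) : MemLp F 2 m := by
  obtain ⟨C, hC⟩ := hF.2
  refine MemLp.of_le (g := (Metric.ball o R).indicator fun _ => C)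
    (memLp_indicator_const 2 measurableSet_ball C (Or.inr (h R).ne))
    hF.continuous.aestronglyMeasurable ?_
  refine Eventually.of_forall fun x => ?_
  by_cases hx : x ∈ Metric.ball o R
  · rw [indicator_of_mem hx, Real.norm_eq_abs, Real.norm_eq_abs]
    exact (hC x).trans (le_abs_self _)
  · simp [hR x hx]

theorem slopeEnergy_ne_top_of_boundedSupport {o : X} (h : ∀ r, m (Metric.ball o r) < ⊤) {F : X → ℝ}
    (hF : IsLipBdd F) {R : ℝ} (hR : ∀ x, x ∉ Metric.ball o R → F x = 0) :
    slopeEnergy m F ≠ ⊤ := by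
  obtain ⟨⟨K, hK⟩, -⟩ := hF
  refine ENNReal.mul_ne_top (by simp) ?_
  have hle : ∀ x, localSlope F x ^ 2
      ≤ (Metric.ball o (R + 1)).indicator (fun _ => (K : ℝ≥0∞) ^ 2) x := by
    intro x
    by_cases hx : x ∈ Metric.ball o (R + 1)
    · rw [indicator_of_mem hx]
      exact pow_le_pow_left' (localSlope_le_of_lipschitzWith hK x) 2
    · have hev : F =ᶠ[𝓝 x] 0 := by
        have hx' : x ∈ (Metric.closedBall o R)ᶜ := by
          simp only [Metric.mem_ball, mem_compl_iff, Metric.mem_closedBall] at hx ⊢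
          linarith
        filter_upwards [Metric.isClosed_closedBall.isOpen_compl.mem_nhds hx'] with y hy
        exact hR y fun hy' => hy (Metric.ball_subset_closedBall hy')
      rw [localSlope_eq_zero_of_eventuallyEq hev]
      simp
  refine ne_top_of_le_ne_top ?_ (lintegral_mono hle)
  rw [lintegral_indicator_const measurableSet_ball]
  exact ENNReal.mul_ne_top (by simp) (h _).ne

/-- Approximate `s` from inside by a closed set, cut it to a ball, and take a thickened indicator.
Outside a set of measure at most `η` nothing changes. -/
theorem exists_lipBdd_approx_indicator {o : X} (h : ∀ r, m (Metric.ball o r) < ⊤)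
    [m.WeaklyRegular] (c : ℝ) {s : Set X} (hs : MeasurableSet s) (hms : m s < ⊤) {ε : ℝ≥0∞}
    (hε : ε ≠ 0) : ∃ g : X → ℝ, eLpNorm (g - s.indicator fun _ => c) 2 m ≤ ε ∧
      IsLipBdd g ∧ ∃ R, ∀ x, x ∉ Metric.ball o R → g x = 0 := by
  obtain ⟨η, hη, hηε⟩ := exists_eLpNorm_indicator_le (μ := m) (p := 2) (by norm_num) c hε
  have hη3 : ((η : ℝ≥0∞) / 3) ≠ 0 := by simp [hη.ne']
  obtain ⟨F, hFs, hFc, hFm⟩ := hs.exists_isClosed_sdiff_lt hms.ne hη3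
  obtain ⟨n, hn⟩ : ∃ n : ℕ, m (F \ Metric.closedBall o n) < (η : ℝ≥0∞) / 3 := by
    have hlim := tendsto_measure_iInter_atTop (μ := m)
      (s := fun n : ℕ => F \ Metric.closedBall o n)
      (fun n => (hFc.measurableSet.diff measurableSet_closedBall).nullMeasurableSet)
      (fun i j hij => sdiff_subset_sdiff_right
        (Metric.closedBall_subset_closedBall (by exact_mod_cast hij)))
      ⟨0, ((measure_mono (sdiff_subset.trans hFs)).trans_lt hms).ne⟩
    have hempty : (⋂ n : ℕ, F \ Metric.closedBall o n) = ∅ := by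
      refine eq_empty_of_forall_notMem fun x hx => ?_
      obtain ⟨k, hk⟩ := exists_nat_ge (dist x o)
      exact (mem_iInter.1 hx k).2 hk
    rw [hempty, measure_empty] at hlim
    exact (hlim.eventually (gt_mem_nhds (pos_iff_ne_zero.2 hη3))).exists
  set K := F ∩ Metric.closedBall o n
  have hKc : IsClosed K := hFc.inter Metric.isClosed_closedBall
  have hthick : ∀ δ ≤ 1, Metric.thickening δ K ⊆ Metric.ball o (n + 1) := by
    intro δ hδ x hx
    obtain ⟨y, hy, hxy⟩ := Metric.mem_thickening_iff.1 hx
    have h2 : dist y o ≤ n := hy.2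
    rw [Metric.mem_ball]
    linarith [dist_triangle x y o]
  have hKfin : m K ≠ ⊤ := ((measure_mono (inter_subset_left.trans hFs)).trans_lt hms).ne
  obtain ⟨δ, hδm, hδ0, hδ1⟩ : ∃ δ : ℝ, m (Metric.thickening δ K) < m K + (η : ℝ≥0∞) / 3 ∧
      0 < δ ∧ δ ≤ 1 := by
    have hlim := tendsto_measure_thickening_of_isClosed (μ := m) (s := K)
      ⟨1, one_pos, ((measure_mono (hthick 1 le_rfl)).trans_lt (h _)).ne⟩ hKc
    obtain ⟨δ, h1, h2⟩ := ((hlim.eventually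
      (gt_mem_nhds (ENNReal.lt_add_right hKfin hη3))).and (Ioc_mem_nhdsGT one_pos)).exists
    exact ⟨δ, h1, h2.1, h2.2⟩
  set θ : X → ℝ := fun x => thickenedIndicator hδ0 K x with hθ
  have hθ0 : ∀ x, 0 ≤ θ x := fun x => NNReal.coe_nonneg _
  have hθ1 : ∀ x, θ x ≤ 1 := fun x => by exact_mod_cast thickenedIndicator_le_one hδ0 K x
  have hθK : ∀ x ∈ K, θ x = 1 := fun x hx => by
    simp only [hθ, thickenedIndicator_one hδ0 K hx, NNReal.coe_one]
  have hθout : ∀ x, x ∉ Metric.thickening δ K → θ x = 0 := fun x hx => by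
    simp only [hθ, thickenedIndicator_zero hδ0 K hx, NNReal.coe_zero]
  refine ⟨fun x => c * θ x, ?_, ⟨?_, |c|, fun x => ?_⟩, n + 1, fun x hx => ?_⟩
  -- The three exceptional pieces, of measure at most `η / 3` each: the collar of `K`, the loss in
  -- the closed approximation, and the part cut off by the ball.
  · set B := (Metric.thickening δ K \ K) ∪ (s \ F) ∪ (F \ Metric.closedBall o n)
    have hB : m B ≤ η := by
      have h1 : m (Metric.thickening δ K \ K) ≤ (η : ℝ≥0∞) / 3 :=
        (measure_sdiff_lt_of_lt_add hKc.nullMeasurableSet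
          (Metric.self_subset_thickening hδ0 K) hKfin hδm).le
      calc m B ≤ m (Metric.thickening δ K \ K) + m (s \ F) + m (F \ Metric.closedBall o n) :=
            (measure_union_le _ _).trans (by gcongr; exact measure_union_le _ _)
        _ ≤ (η : ℝ≥0∞) / 3 + η / 3 + η / 3 := by gcongr
        _ = η := ENNReal.add_thirds _
    refine le_trans (eLpNorm_mono fun x => ?_) (hηε B hB)
    by_cases hxB : x ∈ B
    · rw [indicator_of_mem hxB, Pi.sub_apply]
      have hle : ∀ q : ℝ, 0 ≤ q → q ≤ 1 → ‖c * θ x - c * q‖ ≤ ‖c‖ := by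
        intro q h0 h1
        rw [← mul_sub, norm_mul]
        refine mul_le_of_le_one_right (norm_nonneg _) ?_
        rw [Real.norm_eq_abs, abs_le]
        constructor <;> linarith [hθ0 x, hθ1 x]
      by_cases hxs : x ∈ s
      · rw [indicator_of_mem hxs]
        simpa using hle 1 zero_le_one le_rfl
      · rw [indicator_of_notMem hxs]
        simpa using hle 0 le_rfl zero_le_one
    · rw [indicator_of_notMem hxB, Pi.sub_apply]
      simp only [B, mem_union, Set.mem_sdiff, not_or, not_and, not_not] at hxB
      obtain ⟨⟨h1, h2⟩, h3⟩ := hxB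
      by_cases hxs : x ∈ s
      · rw [indicator_of_mem hxs, hθK x ⟨h2 hxs, h3 (h2 hxs)⟩]
        simp
      · rw [indicator_of_notMem hxs, hθout x fun hx => hxs (hFs (h1 hx).1)]
        simp
  · have h1 : LipschitzWith δ.toNNReal⁻¹ θ :=
      LipschitzWith.of_dist_le_mul fun x y =>
        (lipschitzWith_thickenedIndicator hδ0 K).dist_le_mul x y
    exact ⟨_, (lipschitzWith_smul c).comp h1⟩
  · rw [abs_mul, abs_of_nonneg (hθ0 x)]
    exact mul_le_of_le_one_right (abs_nonneg _) (hθ1 x)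
  · simp only [hθout x fun hx' => hx (hthick δ hδ1 hx'), mul_zero]

theorem dense_cheegerEnergy_ne_top {o : X} (h : ∀ r, m (Metric.ball o r) < ⊤)
    [m.WeaklyRegular] : Dense {f : Lp ℝ 2 m | cheegerEnergy m f ≠ ⊤} := by
  refine EMetric.dense_iff.2 fun f ε hε => ?_
  obtain ⟨g, hg, hgL, R, hR⟩ := (Lp.memLp f).induction_dense (by norm_num)
    (fun g => IsLipBdd g ∧ ∃ R, ∀ x, x ∉ Metric.ball o R → g x = 0)
    (fun c s hs hms ε hε => exists_lipBdd_approx_indicator h c hs hms hε)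
    (fun f g ⟨hf, Rf, hRf⟩ ⟨hg, Rg, hRg⟩ => by
      refine ⟨by simpa using! hf.combo hg 1 1, max Rf Rg, fun x hx => ?_⟩
      have h1 := hRf x fun hx' => hx (Metric.ball_subset_ball (le_max_left _ _) hx')
      have h2 := hRg x fun hx' => hx (Metric.ball_subset_ball (le_max_right _ _) hx')
      simp [h1, h2])
    (fun f hf => (memLp_of_boundedSupport h hf.1 hf.2.choose_spec).1)
    -- `ε` may be `⊤`; after the minimum with 1, halving is strict.
    (ε := min ε 1 / 2) (by simp [hε.ne'])
  have hgm := memLp_of_boundedSupport h hgL hR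
  refine ⟨hgm.toLp g, ?_, ?_⟩
  · rw [Metric.mem_eball, edist_comm, Lp.edist_def]
    refine lt_of_le_of_lt (le_of_eq_of_le (eLpNorm_congr_ae ?_) hg)
      ((ENNReal.half_lt_self ?_ ?_).trans_le (min_le_left ε 1))
    · filter_upwards [hgm.coeFn_toLp] with x hx
      simp [hx]
    · simp [hε.ne']
    · simp
  · have hle : cheegerEnergy m (hgm.toLp g) ≤ slopeEnergy m g := by
      refine (cheegerEnergy_le_liminf (F := fun _ => g) (fun _ => hgL) (fun _ => hgm) ?_).trans ?_
      · have : eLpNorm (fun x => g x - hgm.toLp g x) 2 m = 0 := by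
          refine (eLpNorm_congr_ae (g := fun _ => 0) ?_).trans eLpNorm_zero
          filter_upwards [hgm.coeFn_toLp] with x hx
          simp [hx]
        simp [this]
      · simp
    exact ne_top_of_le_ne_top (slopeEnergy_ne_top_of_boundedSupport h hgL hR) hle

end Density

end MetricMeasure

/-! ### Pairs of functions under slope contractions, and smooth convex functions on the plane. -/

namespace MetricMeasure

/-- The linear form `(s, t) ↦ a s + b t` on `ℝ²`. -/
noncomputable def linForm (a b : ℝ) : ℝ × ℝ →L[ℝ] ℝ :=
  a • ContinuousLinearMap.fst ℝ ℝ ℝ + b • ContinuousLinearMap.snd ℝ ℝ ℝ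

@[simp]
theorem linForm_apply (a b : ℝ) (p : ℝ × ℝ) : linForm a b p = a * p.1 + b * p.2 := by
  simp [linForm]

theorem norm_linForm_le (a b : ℝ) : ‖linForm a b‖ ≤ |a| + |b| := by
  refine ContinuousLinearMap.opNorm_le_bound _ (by positivity) fun p => ?_
  rw [linForm_apply, Real.norm_eq_abs, add_mul]
  refine (abs_add_le _ _).trans ?_
  rw [abs_mul, abs_mul]
  gcongr
  · exact norm_fst_le p
  · exact norm_snd_le p

/-- A pair of Lipschitz functions on `ℝ²` whose Jacobian matrix is everywhere symmetric and stays
a contraction when its entries are replaced with their absolute values. -/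
structure IsSlopeContraction (T₁ T₂ : ℝ × ℝ → ℝ) : Prop where
  lipschitz : ∃ K : NNReal, LipschitzWith K T₁ ∧ LipschitzWith K T₂
  hasFDerivAt : ∀ p, ∃ a b c : ℝ, HasFDerivAt T₁ (linForm a b) p ∧ HasFDerivAt T₂ (linForm b c) p ∧
    ∀ s t : ℝ, 0 ≤ s → 0 ≤ t → (|a| * s + |b| * t) ^ 2 + (|b| * s + |c| * t) ^ 2 ≤ s ^ 2 + t ^ 2

theorem abs_sub_le_of_lipschitzWith {T : ℝ × ℝ → ℝ} {K : NNReal} (hT : LipschitzWith K T)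
    (p q : ℝ × ℝ) : |T p - T q| ≤ K * |p.1 - q.1| + K * |p.2 - q.2| := by
  have h := hT.dist_le_mul p q
  rw [Real.dist_eq, Prod.dist_eq, Real.dist_eq, Real.dist_eq] at h
  rw [← mul_add]
  refine h.trans (mul_le_mul_of_nonneg_left ?_ K.coe_nonneg)
  exact max_le_add_of_nonneg (abs_nonneg _) (abs_nonneg _)

section Lp

variable {X : Type*} [MeasurableSpace X] {m : Measure X}

theorem memLp_const_of {c : ℝ} (hc : m univ = ⊤ → c = 0) : MemLp (fun _ : X => c) 2 m := by
  by_cases h : m univ = ⊤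
  · simp [hc h]
  · have : IsFiniteMeasure m := ⟨lt_top_iff_ne_top.2 h⟩
    exact memLp_const c

theorem memLp_comp {T : ℝ × ℝ → ℝ} {K : NNReal} (hT : LipschitzWith K T)
    (h0 : m univ = ⊤ → T 0 = 0) {f g : X → ℝ} (hf : MemLp f 2 m) (hg : MemLp g 2 m) :
    MemLp (fun x => T (f x, g x)) 2 m := by
  refine MemLp.of_le (g := fun x => |T 0| + (K * |f x| + K * |g x|))
    (((memLp_const_of h0).norm).add ((hf.norm.const_mul _).add (hg.norm.const_mul _)))
    (hT.continuous.comp_aestronglyMeasurable (hf.1.prodMk hg.1)) (Eventually.of_forall fun x => ?_)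
  have h := abs_sub_le_of_lipschitzWith hT (f x, g x) 0
  simp only [Prod.fst_zero, Prod.snd_zero, sub_zero] at h
  rw [Real.norm_eq_abs, Real.norm_eq_abs]
  refine le_trans ?_ (le_abs_self _)
  have := abs_sub_abs_le_abs_sub (T (f x, g x)) (T 0)
  linarith

end Lp

section Cheeger

variable {X : Type*} [MetricSpace X]

theorem IsLipBdd.comp_lipschitzWith {T : ℝ × ℝ → ℝ} {K : NNReal} (hT : LipschitzWith K T)
    {F G : X → ℝ} (hF : IsLipBdd F) (hG : IsLipBdd G) : IsLipBdd fun x => T (F x, G x) := by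
  obtain ⟨⟨A, hA⟩, C, hC⟩ := hF
  obtain ⟨⟨B, hB⟩, D, hD⟩ := hG
  refine ⟨⟨_, hT.comp (hA.prodMk hB)⟩, |T 0| + (K * C + K * D), fun x => ?_⟩
  have h := abs_sub_le_of_lipschitzWith hT (F x, G x) 0
  simp only [Prod.fst_zero, Prod.snd_zero, sub_zero] at h
  have h1 := abs_sub_abs_le_abs_sub (T (F x, G x)) (T 0)
  have h2 := mul_le_mul_of_nonneg_left (hC x) K.coe_nonneg
  have h3 := mul_le_mul_of_nonneg_left (hD x) K.coe_nonneg
  linarith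

/-- First-order expansion of `T` at `(F x, G x)`, with remainder absorbed by the Lipschitz bound on
`(F, G)`. Slopes carry no sign, hence the absolute values here and in `IsSlopeContraction`. -/
theorem localSlope_comp_le {T : ℝ × ℝ → ℝ} {F G : X → ℝ} (hF : IsLipBdd F) (hG : IsLipBdd G) {x : X}
    {a b : ℝ} (hT : HasFDerivAt T (linForm a b) (F x, G x)) :
    localSlope (fun x => T (F x, G x)) x ≤
      ENNReal.ofReal (|a| * (localSlope F x).toReal + |b| * (localSlope G x).toReal) := by
  refine toReal_localSlope_le (localSlope_ne_top hF x) (localSlope_ne_top hG x) (abs_nonneg _)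
    (abs_nonneg _) fun ε hε => ?_
  obtain ⟨⟨A, hA⟩, -⟩ := hF
  obtain ⟨⟨B, hB⟩, -⟩ := hG
  have hAB := hA.prodMk hB
  set M : NNReal := max A B
  have hc : 0 < ε / (M + 1) := by positivity
  have hev := (hT.isLittleO.def hc)
  have hcont : Tendsto (fun y => (F y, G y)) (𝓝[≠] x) (𝓝 (F x, G x)) :=
    (hAB.continuous.tendsto x).mono_left nhdsWithin_le_nhds
  filter_upwards [hcont.eventually hev] with y hy
  have h1 : ‖(F y, G y) - (F x, G x)‖ ≤ M * dist y x := by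
    rw [← dist_eq_norm]
    exact hAB.dist_le_mul y x
  have h2 : ε / (M + 1) * ‖(F y, G y) - (F x, G x)‖ ≤ ε * dist y x := by
    calc ε / (M + 1) * ‖(F y, G y) - (F x, G x)‖ ≤ ε / (M + 1) * (M * dist y x) := by gcongr
      _ ≤ ε / (M + 1) * ((M + 1) * dist y x) := by gcongr; linarith
      _ = ε * dist y x := by field_simp
  have h3 : |linForm a b ((F y, G y) - (F x, G x))| ≤ |a| * |F y - F x| + |b| * |G y - G x| := by
    rw [linForm_apply, ← abs_mul, ← abs_mul]
    exact abs_add_le _ _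
  have h4 := abs_sub_abs_le_abs_sub (T (F y, G y) - T (F x, G x))
    (linForm a b ((F y, G y) - (F x, G x)))
  rw [Real.norm_eq_abs] at hy
  linarith

variable [MeasurableSpace X] [BorelSpace X] {m : Measure X}

theorem slopeEnergy_comp_add_le {T₁ T₂ : ℝ × ℝ → ℝ} (hT : IsSlopeContraction T₁ T₂) {F G : X → ℝ}
    (hF : IsLipBdd F) (hG : IsLipBdd G) :
    slopeEnergy m (fun x => T₁ (F x, G x)) + slopeEnergy m (fun x => T₂ (F x, G x))
      ≤ slopeEnergy m F + slopeEnergy m G := by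
  have hpt : ∀ x, localSlope (fun x => T₁ (F x, G x)) x ^ 2
      + localSlope (fun x => T₂ (F x, G x)) x ^ 2 ≤ localSlope F x ^ 2 + localSlope G x ^ 2 := by
    intro x
    obtain ⟨a, b, c, h1, h2, h3⟩ := hT.hasFDerivAt (F x, G x)
    have g1 := pow_le_pow_left' (localSlope_comp_le hF hG h1) 2
    have g2 := pow_le_pow_left' (localSlope_comp_le hF hG h2) 2
    have hs : 0 ≤ (localSlope F x).toReal := ENNReal.toReal_nonneg
    have ht : 0 ≤ (localSlope G x).toReal := ENNReal.toReal_nonneg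
    refine (add_le_add g1 g2).trans ?_
    rw [← ENNReal.ofReal_pow (by positivity), ← ENNReal.ofReal_pow (by positivity),
      ← ENNReal.ofReal_add (by positivity) (by positivity)]
    refine (ENNReal.ofReal_le_ofReal (h3 _ _ hs ht)).trans (le_of_eq ?_)
    rw [ENNReal.ofReal_add (by positivity) (by positivity), ENNReal.ofReal_pow hs,
      ENNReal.ofReal_pow ht, ENNReal.ofReal_toReal (localSlope_ne_top hF x),
      ENNReal.ofReal_toReal (localSlope_ne_top hG x)]
  unfold slopeEnergy
  rw [← mul_add, ← mul_add]
  refine mul_le_mul' le_rfl ((le_lintegral_add _ _).trans ?_)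
  rw [← lintegral_add_left ((measurable_localSlope hF.continuous).pow_const 2)]
  exact lintegral_mono hpt

theorem liminf_add_liminf_le (u v : ℕ → ℝ≥0∞) :
    liminf u atTop + liminf v atTop ≤ liminf (fun n => u n + v n) atTop := by
  simp only [liminf_eq_iSup_iInf_of_nat]
  have hmono : ∀ w : ℕ → ℝ≥0∞, Monotone fun n => ⨅ i ≥ n, w i := fun w a b hab =>
    le_iInf₂ fun i hi => iInf₂_le i (hab.trans hi)
  rw [ENNReal.iSup_add_iSup_of_monotone (hmono u) (hmono v)]
  exact iSup_mono fun n => le_iInf₂ fun i hi => add_le_add (iInf₂_le i hi) (iInf₂_le i hi)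

/-- Compose recovery sequences of `f` and `g` with the Lipschitz maps; superadditivity of `liminf`
keeps the sum together. The hypothesis `h0` keeps the compositions in L² when the mass is infinite.
-/
theorem cheegerEnergy_comp_add_le {T₁ T₂ : ℝ × ℝ → ℝ} (hT : IsSlopeContraction T₁ T₂)
    (h0 : m univ = ⊤ → T₁ 0 = 0 ∧ T₂ 0 = 0) {f g f' g' : Lp ℝ 2 m}
    (hf' : ∀ᵐ x ∂m, f' x = T₁ (f x, g x)) (hg' : ∀ᵐ x ∂m, g' x = T₂ (f x, g x)) :
    cheegerEnergy m f' + cheegerEnergy m g' ≤ cheegerEnergy m f + cheegerEnergy m g := by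
  by_cases hf : cheegerEnergy m f = ⊤
  · simp [hf]
  by_cases hg : cheegerEnergy m g = ⊤
  · simp [hg]
  obtain ⟨F, F1, F2, F3, F4⟩ := exists_recovery hf
  obtain ⟨G, G1, G2, G3, G4⟩ := exists_recovery hg
  obtain ⟨K, hK₁, hK₂⟩ := hT.lipschitz
  have e1 := cheegerEnergy_le_liminf (f := f') (F := fun n x => T₁ (F n x, G n x))
    (fun n => (F1 n).comp_lipschitzWith hK₁ (G1 n))
    (fun n => memLp_comp hK₁ (fun h => (h0 h).1) (F2 n) (G2 n))
    (tendsto_eLpNorm_sub F2 G2 F3 G3 K.coe_nonneg K.coe_nonneg fun n => by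
      filter_upwards [hf'] with x hx
      rw [hx]
      exact abs_sub_le_of_lipschitzWith hK₁ (F n x, G n x) (f x, g x))
  have e2 := cheegerEnergy_le_liminf (f := g') (F := fun n x => T₂ (F n x, G n x))
    (fun n => (F1 n).comp_lipschitzWith hK₂ (G1 n))
    (fun n => memLp_comp hK₂ (fun h => (h0 h).2) (F2 n) (G2 n))
    (tendsto_eLpNorm_sub F2 G2 F3 G3 K.coe_nonneg K.coe_nonneg fun n => by
      filter_upwards [hg'] with x hx
      rw [hx]
      exact abs_sub_le_of_lipschitzWith hK₂ (F n x, G n x) (f x, g x))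
  have hlim : Tendsto (fun n : ℕ => (cheegerEnergy m f + ((n : ℝ≥0∞) + 1)⁻¹)
      + (cheegerEnergy m g + ((n : ℝ≥0∞) + 1)⁻¹)) atTop
      (𝓝 (cheegerEnergy m f + cheegerEnergy m g)) := by
    simpa using (tendsto_inv_natCast_add_one.const_add (cheegerEnergy m f)).add
      (tendsto_inv_natCast_add_one.const_add (cheegerEnergy m g))
  refine (add_le_add e1 e2).trans ((liminf_add_liminf_le _ _).trans ?_)
  rw [← hlim.liminf_eq]
  exact liminf_le_liminf (Eventually.of_forall fun n =>
    (slopeEnergy_comp_add_le hT (F1 n) (G1 n)).trans (add_le_add (F4 n) (G4 n)))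

end Cheeger

theorem quadraticForm_nonneg {a b c : ℝ} (ha : 0 ≤ a) (hc : 0 ≤ c) (hb : b ^ 2 ≤ a * c) (s t : ℝ) :
    0 ≤ a * s ^ 2 + 2 * b * (s * t) + c * t ^ 2 := by
  rcases ha.eq_or_lt with rfl | ha
  · have hb0 : b = 0 := pow_eq_zero_iff two_ne_zero |>.1
      (le_antisymm (by linarith) (sq_nonneg b))
    subst hb0
    have := mul_nonneg hc (sq_nonneg t)
    linarith
  · have h : 0 ≤ a * (a * s ^ 2 + 2 * b * (s * t) + c * t ^ 2) := by
      nlinarith [sq_nonneg (a * s + b * t), mul_nonneg (sub_nonneg.2 hb) (sq_nonneg t)]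
    exact nonneg_of_mul_nonneg_right h ha

/-- Twice differentiable convex functions on `ℝ²` with bounded first and second derivatives;
`E₁` and `E₂` are the partial derivatives. -/
structure IsSmoothConvex (E E₁ E₂ : ℝ × ℝ → ℝ) (L : ℝ) : Prop where
  hasFDerivAt : ∀ p, HasFDerivAt E (linForm (E₁ p) (E₂ p)) p
  abs_le : ∀ p, |E₁ p| ≤ L ∧ |E₂ p| ≤ L
  hessian : ∀ p, ∃ a b c : ℝ, HasFDerivAt E₁ (linForm a b) p ∧ HasFDerivAt E₂ (linForm b c) p ∧
    0 ≤ a ∧ 0 ≤ c ∧ b ^ 2 ≤ a * c ∧ a + c ≤ L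

namespace IsSmoothConvex

variable {E E₁ E₂ : ℝ × ℝ → ℝ} {L : ℝ} (hE : IsSmoothConvex E E₁ E₂ L)
include hE

theorem nonneg : 0 ≤ L := (abs_nonneg _).trans (hE.abs_le 0).1

theorem lipschitzWith : LipschitzWith (Real.toNNReal (2 * L)) E₁ ∧
    LipschitzWith (Real.toNNReal (2 * L)) E₂ := by
  have hL := hE.nonneg
  have hb : ∀ {a b c : ℝ}, 0 ≤ a → 0 ≤ c → b ^ 2 ≤ a * c → a + c ≤ L → |b| ≤ L := by
    intro a b c ha hc hbc hac
    exact abs_le_of_sq_le_sq (by nlinarith) hL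
  constructor
  · refine lipschitzWith_of_nnnorm_fderiv_le (𝕜 := ℝ) (fun p => ?_) fun p => ?_
    · obtain ⟨a, b, c, h1, h2, h⟩ := hE.hessian p
      exact h1.differentiableAt
    · obtain ⟨a, b, c, h1, h2, h3, h4, h5, h6⟩ := hE.hessian p
      rw [h1.fderiv, ← NNReal.coe_le_coe, coe_nnnorm, Real.coe_toNNReal _ (by positivity)]
      refine (norm_linForm_le a b).trans ?_
      rw [abs_of_nonneg h3]
      linarith [hb h3 h4 h5 h6]
  · refine lipschitzWith_of_nnnorm_fderiv_le (𝕜 := ℝ) (fun p => ?_) fun p => ?_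
    · obtain ⟨a, b, c, h1, h2, h⟩ := hE.hessian p
      exact h2.differentiableAt
    · obtain ⟨a, b, c, h1, h2, h3, h4, h5, h6⟩ := hE.hessian p
      rw [h2.fderiv, ← NNReal.coe_le_coe, coe_nnnorm, Real.coe_toNNReal _ (by positivity)]
      refine (norm_linForm_le b c).trans ?_
      rw [abs_of_nonneg h4]
      linarith [hb h3 h4 h5 h6]

theorem continuous : Continuous E :=
  continuous_iff_continuousAt.2 fun p => (hE.hasFDerivAt p).continuousAt

/-- A smooth convex function lies above its tangent planes. -/
theorem tangent_le (p q : ℝ × ℝ) :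
    E p + (E₁ p * (q.1 - p.1) + E₂ p * (q.2 - p.2)) ≤ E q := by
  set v : ℝ × ℝ := q - p with hv
  have hline : ∀ t : ℝ, HasDerivAt (fun t : ℝ => p + t • v) v t := fun t => by
    simpa using ((hasDerivAt_id t).smul_const v).const_add p
  have hg : ∀ t : ℝ, HasDerivAt (fun t : ℝ => E (p + t • v))
      (E₁ (p + t • v) * v.1 + E₂ (p + t • v) * v.2) t := fun t => by
    simpa [Function.comp_def] using (hE.hasFDerivAt (p + t • v)).comp_hasDerivAt t (hline t)
  -- The second derivative of `E` along the line is the Hessian form, which is nonnegative.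
  have hmono : Monotone fun t : ℝ => E₁ (p + t • v) * v.1 + E₂ (p + t • v) * v.2 := by
    have hd : ∀ t : ℝ, ∃ d, 0 ≤ d ∧
        HasDerivAt (fun t : ℝ => E₁ (p + t • v) * v.1 + E₂ (p + t • v) * v.2) d t := by
      intro t
      obtain ⟨a, b, c, h1, h2, h3, h4, h5, -⟩ := hE.hessian (p + t • v)
      refine ⟨_, ?_, ((h1.comp_hasDerivAt t (hline t)).mul_const v.1).add
        ((h2.comp_hasDerivAt t (hline t)).mul_const v.2)⟩
      simp only [linForm_apply]
      have e : (a * v.1 + b * v.2) * v.1 + (b * v.1 + c * v.2) * v.2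
        = a * v.1 ^ 2 + 2 * b * (v.1 * v.2) + c * v.2 ^ 2 := by ring
      rw [e]
      exact quadraticForm_nonneg h3 h4 h5 _ _
    refine monotone_of_deriv_nonneg (fun t => (hd t).choose_spec.2.differentiableAt) fun t => ?_
    rw [(hd t).choose_spec.2.deriv]
    exact (hd t).choose_spec.1
  obtain ⟨ξ, hξ, hslope⟩ := exists_hasDerivAt_eq_slope (fun t : ℝ => E (p + t • v)) _ one_pos
    (fun t _ => (hg t).continuousAt.continuousWithinAt) fun t _ => hg t
  have h := hmono hξ.1.le
  simp only at h
  rw [hslope] at h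
  simp only [zero_smul, add_zero, one_smul, sub_zero, div_one] at h
  have e : p + v = q := by simp [hv]
  rw [e] at h
  simp only [hv, Prod.fst_sub, Prod.snd_sub] at h
  linarith

/-- A small gradient descent step for a smooth convex function. -/
theorem isSlopeContraction :
    IsSlopeContraction (fun p => p.1 - (L + 1)⁻¹ * E₁ p) (fun p => p.2 - (L + 1)⁻¹ * E₂ p) := by
  have hL := hE.nonneg
  obtain ⟨l1, l2⟩ := hE.lipschitzWith
  have hε : 0 < (L + 1)⁻¹ := by positivity
  have hεL : (L + 1)⁻¹ * L ≤ 1 := by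
    rw [inv_mul_le_iff₀ (by positivity)]
    linarith
  set ε := (L + 1)⁻¹
  refine ⟨⟨_, LipschitzWith.prod_fst.sub ((lipschitzWith_smul ε).comp l1),
    LipschitzWith.prod_snd.sub ((lipschitzWith_smul ε).comp l2)⟩, fun p => ?_⟩
  obtain ⟨a, b, c, h1, h2, h3, h4, h5, h6⟩ := hE.hessian p
  refine ⟨1 - ε * a, -(ε * b), 1 - ε * c, ?_, ?_, fun s t hs ht => ?_⟩
  · refine (hasFDerivAt_fst.sub (h1.const_mul ε)).congr_fderiv ?_
    ext <;> simp
  · refine (hasFDerivAt_snd.sub (h2.const_mul ε)).congr_fderiv ?_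
    ext <;> simp
  · have g1 : ε * a ≤ 1 := le_trans (by gcongr; linarith) hεL
    have g2 : ε * c ≤ 1 := le_trans (by gcongr; linarith) hεL
    have g3 : ε * a + ε * c ≤ 1 := by
      rw [← mul_add]
      exact le_trans (by gcongr) hεL
    rw [abs_of_nonneg (sub_nonneg.2 g1), abs_of_nonneg (sub_nonneg.2 g2), abs_neg]
    have g4 : |ε * b| ^ 2 ≤ (ε * a) * (ε * c) := by
      rw [sq_abs]
      nlinarith [sq_nonneg ε]
    have g5 : 0 ≤ ε * a := by positivity
    have g6 : 0 ≤ ε * c := by positivity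
    have g7 : 0 ≤ |ε * b| := abs_nonneg _
    generalize ε * a = x at *
    generalize ε * c = z at *
    generalize |ε * b| = y at *
    -- with `N = [[x, -y], [-y, z]]` one has `N² ≤ (tr N) N ≤ N`
    have k1 : 0 ≤ x * s ^ 2 - 2 * y * (s * t) + z * t ^ 2 := by
      have := quadraticForm_nonneg (b := -y) g5 g6 (by linarith [neg_sq y]) s t
      linarith
    have k2 : (x * s - y * t) ^ 2 + (z * t - y * s) ^ 2
        ≤ (x + z) * (x * s ^ 2 - 2 * y * (s * t) + z * t ^ 2) := by
      nlinarith [mul_nonneg (sub_nonneg.2 g4) (add_nonneg (sq_nonneg s) (sq_nonneg t))]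
    nlinarith [mul_nonneg (sub_nonneg.2 g3) k1]

end IsSmoothConvex

end MetricMeasure

/-! ### Integrals of smooth convex functions along resolvents and along the flow. -/

namespace MetricMeasure

section Integral

variable {X : Type*} [MeasurableSpace X] {m : Measure X} {E E₁ E₂ : ℝ × ℝ → ℝ} {L : ℝ}

theorem integrable_mul_of_memLp {f g : X → ℝ} (hf : MemLp f 2 m) (hg : MemLp g 2 m) :
    Integrable (fun x => f x * g x) m :=
  hf.integrable_mul hg

/-- The tangent planes at 0 and at `(f x, g x)` bound `E (f x, g x)` from both sides by a constant
and products of L² functions. -/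
theorem IsSmoothConvex.integrable_comp (hE : IsSmoothConvex E E₁ E₂ L)
    (h0 : m univ = ⊤ → E 0 = 0 ∧ E₁ 0 = 0 ∧ E₂ 0 = 0) {f g : X → ℝ} (hf : MemLp f 2 m)
    (hg : MemLp g 2 m) : Integrable (fun x => E (f x, g x)) m := by
  obtain ⟨l1, l2⟩ := hE.lipschitzWith
  have hc : Integrable (fun _ : X => E 0) m := by
    by_cases h : m univ = ⊤
    · simp [(h0 h).1]
    · have : IsFiniteMeasure m := ⟨lt_top_iff_ne_top.2 h⟩
      exact integrable_const _
  have i1 := integrable_mul_of_memLp (memLp_const_of (X := X) fun h => (h0 h).2.1) hf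
  have i2 := integrable_mul_of_memLp (memLp_const_of (X := X) fun h => (h0 h).2.2) hg
  have i3 := integrable_mul_of_memLp (memLp_comp l1 (fun h => (h0 h).2.1) hf hg) hf
  have i4 := integrable_mul_of_memLp (memLp_comp l2 (fun h => (h0 h).2.2) hf hg) hg
  refine ((hc.norm.add (i1.norm.add i2.norm)).add (i3.norm.add i4.norm)).mono'
    (hE.continuous.comp_aestronglyMeasurable (hf.1.prodMk hg.1)) (Eventually.of_forall fun x => ?_)
  have h1 := hE.tangent_le 0 (f x, g x)
  have h2 := hE.tangent_le (f x, g x) 0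
  simp only [Prod.fst_zero, Prod.snd_zero, sub_zero, zero_sub, mul_neg] at h1 h2
  simp only [Real.norm_eq_abs, Pi.add_apply]
  rw [_root_.abs_le]
  have a0 := _root_.abs_le.1 (le_refl |E 0|)
  have a1 := _root_.abs_le.1 (le_refl |E₁ 0 * f x|)
  have a2 := _root_.abs_le.1 (le_refl |E₂ 0 * g x|)
  have a3 := _root_.abs_le.1 (le_refl |E₁ (f x, g x) * f x|)
  have a4 := _root_.abs_le.1 (le_refl |E₂ (f x, g x) * g x|)
  have b3 := abs_nonneg (E₁ (f x, g x) * f x)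
  have b4 := abs_nonneg (E₂ (f x, g x) * g x)
  have b1 := abs_nonneg (E₁ 0 * f x)
  have b2 := abs_nonneg (E₂ 0 * g x)
  constructor <;> linarith

/-- Used twice: to compare a pair with its resolvents, and to obtain lower semicontinuity of the
integral along the Euler scheme. -/
theorem IsSmoothConvex.integral_tangent_le (hE : IsSmoothConvex E E₁ E₂ L)
    (h0 : m univ = ⊤ → E 0 = 0 ∧ E₁ 0 = 0 ∧ E₂ 0 = 0) {f g G₁ G₂ : Lp ℝ 2 m}
    (hG₁ : ∀ᵐ x ∂m, G₁ x = E₁ (f x, g x)) (hG₂ : ∀ᵐ x ∂m, G₂ x = E₂ (f x, g x))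
    (f' g' : Lp ℝ 2 m) :
    ∫ x, E (f x, g x) ∂m + (inner ℝ G₁ (f' - f) + inner ℝ G₂ (g' - g))
      ≤ ∫ x, E (f' x, g' x) ∂m := by
  have i0 := hE.integrable_comp h0 (Lp.memLp f) (Lp.memLp g)
  have i1 := L2.integrable_inner (𝕜 := ℝ) G₁ (f' - f)
  have i2 := L2.integrable_inner (𝕜 := ℝ) G₂ (g' - g)
  have e : ∫ x, (E (f x, g x) + (inner ℝ (G₁ x) ((f' - f : Lp ℝ 2 m) x)
      + inner ℝ (G₂ x) ((g' - g : Lp ℝ 2 m) x))) ∂m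
      = ∫ x, E (f x, g x) ∂m + (inner ℝ G₁ (f' - f) + inner ℝ G₂ (g' - g)) := by
    rw [L2.inner_def, L2.inner_def, ← integral_add i1 i2]
    exact integral_add i0 (i1.add i2)
  rw [← e]
  refine integral_mono_ae (i0.add (i1.add i2))
    (hE.integrable_comp h0 (Lp.memLp f') (Lp.memLp g')) ?_
  filter_upwards [hG₁, hG₂, Lp.coeFn_sub f' f, Lp.coeFn_sub g' g] with x h1 h2 h3 h4
  have h := hE.tangent_le (f x, g x) (f' x, g' x)
  simp only [h1, h2, h3, h4, Pi.sub_apply, RCLike.inner_apply, conj_trivial]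
  linarith

end Integral

section Flow

open GradientFlow

variable {X : Type*} [MetricSpace X] [MeasurableSpace X] {m : Measure X}

theorem isHeatFlow_flow (hCh : IsConvexLsc (cheegerEnergy m)) [SecondCountableTopology (Lp ℝ 2 m)]
    (f : Lp ℝ 2 m) : IsHeatFlow m f (flow (cheegerEnergy m) f) where
  zero := flow_zero hCh f
  tendsto := tendsto_flow_zero hCh f
  absolutelyContinuous a b ha hab := by
    obtain ⟨K, hK⟩ := (isEVI_flow hCh f).exists_lipschitzOnWith ha
    refine (hK.mono ?_).absolutelyContinuousOnInterval
    rw [uIcc_of_le hab]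
    exact Icc_subset_Ici_self
  deriv_mem := by
    filter_upwards [ae_differentiableAt_of_lipschitzOnWith_Ici
      fun a ha => (isEVI_flow hCh f).exists_lipschitzOnWith ha] with t ht h0
    have hd := (ht h0).hasDerivAt
    exact ⟨_, (isEVI_flow hCh f).neg_mem_subdifferential hCh h0 hd, by rwa [neg_neg]⟩

theorem IsHeatFlow.eq {f : Lp ℝ 2 m} {u w : ℝ → Lp ℝ 2 m} (hu : IsHeatFlow m f u)
    (hw : IsHeatFlow m f w) {t : ℝ} (ht : 0 ≤ t) : u t = w t := by
  rcases ht.eq_or_lt with rfl | ht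
  · rw [hu.zero, hw.zero]
  · exact eq_of_ae_hasDerivAt hu.tendsto hw.tendsto hu.absolutelyContinuous
      hw.absolutelyContinuous hu.deriv_mem hw.deriv_mem ht

theorem isHeatFlow_heatSemigroup (hCh : IsConvexLsc (cheegerEnergy m))
    [SecondCountableTopology (Lp ℝ 2 m)] (f : Lp ℝ 2 m) :
    IsHeatFlow m f fun t => heatSemigroup m t f :=
  Classical.epsilon_spec (p := IsHeatFlow m f) ⟨_, isHeatFlow_flow hCh f⟩

variable [BorelSpace X] {E E₁ E₂ : ℝ × ℝ → ℝ} {L : ℝ}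

/-- The resolvents of the Cheeger energy decrease integrals of smooth convex functions. -/
theorem integral_resolvent_le (hCh : IsConvexLsc (cheegerEnergy m))
    (hE : IsSmoothConvex E E₁ E₂ L) (h0 : m univ = ⊤ → E 0 = 0 ∧ E₁ 0 = 0 ∧ E₂ 0 = 0) {τ : ℝ}
    (hτ : 0 < τ) (f g : Lp ℝ 2 m) :
    ∫ x, E (resolvent (cheegerEnergy m) τ f x, resolvent (cheegerEnergy m) τ g x) ∂m
      ≤ ∫ x, E (f x, g x) ∂m := by
  set y := resolvent (cheegerEnergy m) τ f with hy
  set z := resolvent (cheegerEnergy m) τ g with hz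
  have hyt : cheegerEnergy m y ≠ ⊤ := resolvent_ne_top hCh hτ f
  have hzt : cheegerEnergy m z ≠ ⊤ := resolvent_ne_top hCh hτ g
  obtain ⟨l1, l2⟩ := hE.lipschitzWith
  have m1 := memLp_comp l1 (fun h => (h0 h).2.1) (Lp.memLp y) (Lp.memLp z)
  have m2 := memLp_comp l2 (fun h => (h0 h).2.2) (Lp.memLp y) (Lp.memLp z)
  set G₁ : Lp ℝ 2 m := m1.toLp _
  set G₂ : Lp ℝ 2 m := m2.toLp _
  have hG₁ : ∀ᵐ x ∂m, G₁ x = E₁ (y x, z x) := m1.coeFn_toLp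
  have hG₂ : ∀ᵐ x ∂m, G₂ x = E₂ (y x, z x) := m2.coeFn_toLp
  set ε := (L + 1)⁻¹
  have hε : 0 < ε := by
    have := hE.nonneg
    positivity
  have hcoe : ∀ (v G : Lp ℝ 2 m), ∀ᵐ x ∂m, (v - ε • G : Lp ℝ 2 m) x = v x - ε * G x := by
    intro v G
    filter_upwards [Lp.coeFn_sub v (ε • G), Lp.coeFn_smul ε G] with x h1 h2
    rw [h1, Pi.sub_apply, h2, Pi.smul_apply, smul_eq_mul]
  -- The competitor is a gradient descent step for `E` from `(y, z)`; it does not increase the total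
  -- energy.
  have hsum := cheegerEnergy_comp_add_le hE.isSlopeContraction
    (fun h => by simp [(h0 h).2.1, (h0 h).2.2]) (f := y) (g := z) (f' := y - ε • G₁)
    (g' := z - ε • G₂) (m := m)
    (by filter_upwards [hcoe y G₁, hG₁] with x h1 h2; rw [h1, h2])
    (by filter_upwards [hcoe z G₂, hG₂] with x h1 h2; rw [h1, h2])
  have hfin : cheegerEnergy m (y - ε • G₁) + cheegerEnergy m (z - ε • G₂) ≠ ⊤ :=
    ne_top_of_le_ne_top (ENNReal.add_ne_top.2 ⟨hyt, hzt⟩) hsum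
  obtain ⟨f1, f2⟩ := ENNReal.add_ne_top.1 hfin
  have hreal := ENNReal.toReal_mono (ENNReal.add_ne_top.2 ⟨hyt, hzt⟩) hsum
  rw [ENNReal.toReal_add f1 f2, ENNReal.toReal_add hyt hzt] at hreal
  have r1 := inner_resolvent_le hCh hτ f f1
  have r2 := inner_resolvent_le hCh hτ g f2
  rw [← hy, sub_sub_cancel_left, inner_neg_right, real_inner_smul_right] at r1
  rw [← hz, sub_sub_cancel_left, inner_neg_right, real_inner_smul_right] at r2
  -- Sum of the two resolvent inequalities, tested with the competitor.
  have hpos : 0 ≤ ε * (inner ℝ G₁ (f - y) + inner ℝ G₂ (g - z)) := by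
    rw [real_inner_comm, real_inner_comm _ G₂]
    nlinarith
  have htan := hE.integral_tangent_le h0 hG₁ hG₂ f g
  linarith [nonneg_of_mul_nonneg_right hpos hε]

theorem integral_euler_le (hCh : IsConvexLsc (cheegerEnergy m))
    (hE : IsSmoothConvex E E₁ E₂ L) (h0 : m univ = ⊤ → E 0 = 0 ∧ E₁ 0 = 0 ∧ E₂ 0 = 0) {τ : ℝ}
    (hτ : 0 < τ) (n : ℕ) (f g : Lp ℝ 2 m) :
    ∫ x, E (euler (cheegerEnergy m) τ n f x, euler (cheegerEnergy m) τ n g x) ∂m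
      ≤ ∫ x, E (f x, g x) ∂m := by
  induction n with
  | zero => rfl
  | succ n ih =>
    rw [euler_succ, euler_succ]
    exact (integral_resolvent_le hCh hE h0 hτ _ _).trans ih

/-- The integral at the limit is bounded through its tangent plane there, whose linear part tends to
zero along the Euler approximations. -/
theorem integral_flow_le (hCh : IsConvexLsc (cheegerEnergy m))
    (hE : IsSmoothConvex E E₁ E₂ L) (h0 : m univ = ⊤ → E 0 = 0 ∧ E₁ 0 = 0 ∧ E₂ 0 = 0) (t : ℝ)
    (f g : Lp ℝ 2 m) :
    ∫ x, E (flow (cheegerEnergy m) f t x, flow (cheegerEnergy m) g t x) ∂m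
      ≤ ∫ x, E (f x, g x) ∂m := by
  set y := flow (cheegerEnergy m) f t
  set z := flow (cheegerEnergy m) g t
  obtain ⟨l1, l2⟩ := hE.lipschitzWith
  have m1 := memLp_comp l1 (fun h => (h0 h).2.1) (Lp.memLp y) (Lp.memLp z)
  have m2 := memLp_comp l2 (fun h => (h0 h).2.2) (Lp.memLp y) (Lp.memLp z)
  have hlim : Tendsto (fun k => ∫ x, E (y x, z x) ∂m
      + (inner ℝ (m1.toLp _) (eulerAt (cheegerEnergy m) f k t - y)
      + inner ℝ (m2.toLp _) (eulerAt (cheegerEnergy m) g k t - z))) atTop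
      (𝓝 (∫ x, E (y x, z x) ∂m)) := by
    have e1 := (tendsto_const_nhds (x := m1.toLp _)).inner (𝕜 := ℝ)
      ((tendsto_eulerAt hCh f t).sub_const y)
    have e2 := (tendsto_const_nhds (x := m2.toLp _)).inner (𝕜 := ℝ)
      ((tendsto_eulerAt hCh g t).sub_const z)
    rw [sub_self, inner_zero_right] at e1 e2
    simpa using (e1.add e2).const_add (∫ x, E (y x, z x) ∂m)
  refine le_of_tendsto' hlim fun k => ?_
  exact (hE.integral_tangent_le h0 m1.coeFn_toLp m2.coeFn_toLp _ _).trans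
    (integral_euler_le hCh hE h0 (by positivity) _ f g)

/-- The growth condition enters through finiteness of balls, which yields density of the
finite-energy functions and separability of L². -/
theorem isConvexLsc_cheegerEnergy [TopologicalSpace.SeparableSpace X] (hm : GrowthCondition m) :
    IsConvexLsc (cheegerEnergy m) ∧ SecondCountableTopology (Lp ℝ 2 m) := by
  obtain ⟨o, κ, -, hκ⟩ := hm
  have hball := GrowthCondition.measure_ball_lt_top hκ
  have hloc := isLocallyFiniteMeasure_of_ball hball
  have : SecondCountableTopology X := UniformSpace.secondCountable_of_separable X
  have : Fact ((2 : ℝ≥0∞) ≠ ⊤) := ⟨by norm_num⟩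
  exact ⟨⟨lowerSemicontinuous_cheegerEnergy, cheegerEnergy_convex,
    dense_cheegerEnergy_ne_top hball⟩, inferInstance⟩

theorem integral_heatSemigroup_le (hCh : IsConvexLsc (cheegerEnergy m))
    [SecondCountableTopology (Lp ℝ 2 m)] (hE : IsSmoothConvex E E₁ E₂ L)
    (h0 : m univ = ⊤ → E 0 = 0 ∧ E₁ 0 = 0 ∧ E₂ 0 = 0) {t : ℝ} (ht : 0 ≤ t) (f g : Lp ℝ 2 m) :
    ∫ x, E (heatSemigroup m t f x, heatSemigroup m t g x) ∂m ≤ ∫ x, E (f x, g x) ∂m := by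
  rw [(isHeatFlow_heatSemigroup hCh f).eq (isHeatFlow_flow hCh f) ht,
    (isHeatFlow_heatSemigroup hCh g).eq (isHeatFlow_flow hCh g) ht]
  exact integral_flow_le hCh hE h0 t f g

end Flow

end MetricMeasure

/-! ### Affine minorants of convex functions. -/

namespace MetricMeasure

section Affine

variable {E : ℝ × ℝ → EReal}

theorem coe_le_of_forall_eq_coe (hbot : ∀ p, E p ≠ ⊥) {p : ℝ × ℝ} {c : ℝ}
    (h : ∀ r : ℝ, E p = r → c ≤ r) : (c : EReal) ≤ E p := by
  induction hp : E p with
  | bot => exact absurd hp (hbot p)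
  | top => exact le_top
  | coe r => exact EReal.coe_le_coe_iff.2 (h r hp)

/-- Hahn–Banach separation of `(p₀, r₀)` from the epigraph, which is closed and convex. -/
theorem exists_separation (hconv : IsConvexEReal E) (hlsc : LowerSemicontinuous E) {p₀ : ℝ × ℝ}
    {r₀ : ℝ} (h : (r₀ : EReal) < E p₀) :
    ∃ a b β u : ℝ, a * p₀.1 + b * p₀.2 + β * r₀ < u ∧
      ∀ (p : ℝ × ℝ) (r : ℝ), E p ≤ r → u < a * p.1 + b * p.2 + β * r := by
  set S : Set ((ℝ × ℝ) × ℝ) := {q | E q.1 ≤ (q.2 : EReal)}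
  have hcl : IsClosed S := hlsc.isClosed_epigraph.preimage
    (f := fun q : (ℝ × ℝ) × ℝ => (q.1, (q.2 : EReal)))
    (continuous_fst.prodMk (continuous_coe_real_ereal.comp continuous_snd))
  have hcv : Convex ℝ S := by
    rintro ⟨p, r⟩ (hp : E p ≤ r) ⟨q, s⟩ (hq : E q ≤ s) a b ha hb hab
    change E (a • p + b • q) ≤ ((a • r + b • s : ℝ) : EReal)
    refine (hconv p q a b ha hb hab).trans ?_
    rw [EReal.coe_add, smul_eq_mul, smul_eq_mul, EReal.coe_mul, EReal.coe_mul]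
    exact add_le_add (mul_le_mul_of_nonneg_left hp (EReal.coe_nonneg.2 ha))
      (mul_le_mul_of_nonneg_left hq (EReal.coe_nonneg.2 hb))
  obtain ⟨f, u, h1, h2⟩ := geometric_hahn_banach_point_closed hcv hcl
    (x := (p₀, r₀)) (fun hmem => absurd hmem (not_le.2 h))
  have hf : ∀ (p : ℝ × ℝ) (r : ℝ), f (p, r)
      = f ((1, 0), 0) * p.1 + f ((0, 1), 0) * p.2 + f (0, 1) * r := by
    intro p r
    have e : (p, r) = p.1 • (((1, 0), 0) : (ℝ × ℝ) × ℝ) + p.2 • (((0, 1), 0) : (ℝ × ℝ) × ℝ)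
        + r • ((0, 1) : (ℝ × ℝ) × ℝ) := by
      ext <;> simp
    conv_lhs => rw [e]
    simp only [map_add, map_smul, smul_eq_mul]
    ring
  refine ⟨f ((1, 0), 0), f ((0, 1), 0), f (0, 1), u, by rwa [← hf], fun p r hr => ?_⟩
  rw [← hf]
  exact h2 (p, r) hr

/-- A non-vertical separating hyperplane (`β > 0`) is the graph of the minorant. A vertical one (`β
= 0`) vanishes at height and only separates points; a large multiple of it is added to a minorant
obtained at a point of finite value. -/
theorem exists_affine_le (hconv : IsConvexEReal E) (hlsc : LowerSemicontinuous E)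
    (hbot : ∀ p, E p ≠ ⊥) (htop : ∃ p, E p ≠ ⊤) {p₀ : ℝ × ℝ} {r₀ : ℝ} (h : (r₀ : EReal) < E p₀) :
    ∃ a b c : ℝ, (∀ p : ℝ × ℝ, ((a * p.1 + b * p.2 + c : ℝ) : EReal) ≤ E p) ∧
      r₀ < a * p₀.1 + b * p₀.2 + c := by
  obtain ⟨q, hq⟩ := htop
  obtain ⟨s, hs⟩ : ∃ s : ℝ, E q = s := ⟨(E q).toReal, (EReal.coe_toReal hq (hbot q)).symm⟩
  have key : ∀ (p₀ : ℝ × ℝ) (r₀ a b β u : ℝ), 0 < β → a * p₀.1 + b * p₀.2 + β * r₀ < u →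
      (∀ (p : ℝ × ℝ) (r : ℝ), E p ≤ r → u < a * p.1 + b * p.2 + β * r) →
      ∃ a b c : ℝ, (∀ p : ℝ × ℝ, ((a * p.1 + b * p.2 + c : ℝ) : EReal) ≤ E p) ∧
        r₀ < a * p₀.1 + b * p₀.2 + c := by
    intro p₀ r₀ a b β u hβ h1 h2
    have e : ∀ p : ℝ × ℝ, -a / β * p.1 + -b / β * p.2 + u / β
        = (u - (a * p.1 + b * p.2)) / β := fun p => by
      field_simp
      ring
    refine ⟨-a / β, -b / β, u / β, fun p => coe_le_of_forall_eq_coe hbot fun r hr => ?_, ?_⟩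
    · rw [e, div_le_iff₀ hβ]
      linarith [h2 p r hr.le]
    · rw [e, lt_div_iff₀ hβ]
      linarith
  obtain ⟨a, b, β, u, h1, h2⟩ := exists_separation hconv hlsc h
  -- Otherwise the separating inequality fails high above `q`.
  have hβ : 0 ≤ β := by
    by_contra! hneg
    obtain ⟨n, hn⟩ := exists_nat_gt ((a * q.1 + b * q.2 + β * s - u) / (-β))
    rw [div_lt_iff₀ (by linarith)] at hn
    have hle : E q ≤ ((s + n : ℝ) : EReal) := by
      rw [hs, EReal.coe_le_coe_iff]
      linarith [n.cast_nonneg (α := ℝ)]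
    have := h2 q (s + n) hle
    linarith
  rcases hβ.eq_or_lt with rfl | hβ
  · have hlt : ((s - 1 : ℝ) : EReal) < E q := by
      rw [hs, EReal.coe_lt_coe_iff]
      linarith
    obtain ⟨a', b', β', u', h1', h2'⟩ := exists_separation hconv hlsc hlt
    have hβ' : 0 < β' := by
      have := h2' q s hs.le
      linarith
    obtain ⟨x, y, z, h3, -⟩ := key q (s - 1) a' b' β' u' hβ' h1' h2'
    have hgap : 0 < u - (a * p₀.1 + b * p₀.2) := by linarith
    obtain ⟨n, hn⟩ := exists_nat_gt ((r₀ - (x * p₀.1 + y * p₀.2 + z)) /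
      (u - (a * p₀.1 + b * p₀.2)))
    rw [div_lt_iff₀ hgap] at hn
    refine ⟨x - n * a, y - n * b, z + n * u, fun p => coe_le_of_forall_eq_coe hbot fun r hr => ?_,
      by linarith⟩
    have g1 := h3 p
    rw [hr, EReal.coe_le_coe_iff] at g1
    have g2 := h2 p r hr.le
    have g3 : 0 ≤ (n : ℝ) * (a * p.1 + b * p.2 - u) :=
      mul_nonneg n.cast_nonneg (by linarith)
    linarith
  · exact key p₀ r₀ a b β u hβ h1 h2

/-- A proper, lower semicontinuous and convex function is the supremum of countably many affine
functions. -/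
theorem exists_seq_affine (hconv : IsConvexEReal E) (hlsc : LowerSemicontinuous E)
    (hbot : ∀ p, E p ≠ ⊥) (htop : ∃ p, E p ≠ ⊤) :
    ∃ a b c : ℕ → ℝ, (∀ n (p : ℝ × ℝ), ((a n * p.1 + b n * p.2 + c n : ℝ) : EReal) ≤ E p) ∧
      ∀ (p : ℝ × ℝ) (r : ℝ), (r : EReal) < E p → ∃ n, r < a n * p.1 + b n * p.2 + c n := by
  set ι := {l : ℝ × ℝ × ℝ // ∀ p : ℝ × ℝ, ((l.1 * p.1 + l.2.1 * p.2 + l.2.2 : ℝ) : EReal) ≤ E p}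
  set s : ι → Set ((ℝ × ℝ) × ℝ) := fun l =>
    {q | q.2 < l.1.1 * q.1.1 + l.1.2.1 * q.1.2 + l.1.2.2}
  -- Lindelöf: the strict hypographs are open, so countably many affine minorants have the same
  -- union.
  obtain ⟨T, hT, hTs⟩ := TopologicalSpace.isOpen_iUnion_countable s fun l =>
    isOpen_lt (by fun_prop) (by fun_prop)
  have hmem : ∀ (p : ℝ × ℝ) (r : ℝ), (r : EReal) < E p → ∃ l ∈ T, (p, r) ∈ s l := by
    intro p r hr
    obtain ⟨a, b, c, h1, h2⟩ := exists_affine_le hconv hlsc hbot htop hr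
    have : (p, r) ∈ ⋃ l, s l := mem_iUnion.2 ⟨⟨(a, b, c), h1⟩, h2⟩
    rw [← hTs] at this
    simpa using this
  have hne : T.Nonempty := by
    obtain ⟨r, -, hr⟩ := EReal.lt_iff_exists_real_btwn.1 (bot_lt_iff_ne_bot.2 (hbot 0))
    obtain ⟨l, hl, -⟩ := hmem 0 r hr
    exact ⟨l, hl⟩
  obtain ⟨e, rfl⟩ := hT.exists_eq_range hne
  refine ⟨fun n => (e n).1.1, fun n => (e n).1.2.1, fun n => (e n).1.2.2, fun n p => (e n).2 p,
    fun p r hr => ?_⟩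
  obtain ⟨_, ⟨n, rfl⟩, hn⟩ := hmem p r hr
  exact ⟨n, hn⟩

end Affine

/-! ### Smoothed maxima and increasing smooth approximation. -/

section Smoothing

/-- Since the derivative of `ψ` vanishes at 0, the constant branch and `ψ` fit together to first
order. -/
theorem hasDerivAt_comp_max {ψ ψ' : ℝ → ℝ} (hψ : ∀ r, HasDerivAt ψ (ψ' r) r) (h0' : ψ' 0 = 0)
    (r : ℝ) : HasDerivAt (fun r => ψ (max r 0)) (ψ' (max r 0)) r := by
  rcases lt_trichotomy r 0 with hr | rfl | hr
  · rw [max_eq_right hr.le, h0']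
    refine (hasDerivAt_const r (ψ 0)).congr_of_eventuallyEq ?_
    filter_upwards [Iio_mem_nhds hr] with s hs
    rw [max_eq_right (le_of_lt hs)]
  · rw [max_self, h0', ← hasDerivWithinAt_univ, ← Iic_union_Ici (a := (0 : ℝ))]
    refine HasDerivWithinAt.union ?_ ?_
    · refine (hasDerivWithinAt_const 0 (Iic 0) (ψ 0)).congr (fun s hs => ?_) (by simp)
      rw [max_eq_right hs]
    · have := (hψ 0).hasDerivWithinAt (s := Ici 0)
      rw [h0'] at this
      refine this.congr (fun s hs => ?_) (by simp)
      rw [max_eq_left hs]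
  · rw [max_eq_left hr.le]
    refine (hψ r).congr_of_eventuallyEq ?_
    filter_upwards [Ioi_mem_nhds hr] with s hs
    rw [max_eq_left (le_of_lt hs)]

/-- A smooth minorant of the positive part. -/
noncomputable def softPos (r : ℝ) : ℝ := max r 0 - Real.arctan (max r 0)

/-- The derivative of `softPos`. -/
noncomputable def softPosDeriv (r : ℝ) : ℝ := (max r 0) ^ 2 / (1 + (max r 0) ^ 2)

theorem hasDerivAt_softPos (r : ℝ) : HasDerivAt softPos (softPosDeriv r) r := by
  refine hasDerivAt_comp_max (ψ := fun r => r - Real.arctan r) (ψ' := fun r => r ^ 2 / (1 + r ^ 2))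
    (fun r => ?_) (by simp) r
  refine ((hasDerivAt_id r).sub (Real.hasDerivAt_arctan r)).congr_deriv ?_
  have : 0 < 1 + r ^ 2 := by positivity
  field_simp
  ring

theorem exists_hasDerivAt_softPosDeriv (r : ℝ) :
    ∃ d, 0 ≤ d ∧ d ≤ 1 ∧ HasDerivAt softPosDeriv d r := by
  refine ⟨_, ?_, ?_, hasDerivAt_comp_max (ψ := fun r => r ^ 2 / (1 + r ^ 2))
    (ψ' := fun r => 2 * r / (1 + r ^ 2) ^ 2) (fun r => ?_) (by simp) r⟩
  · have := le_max_right r 0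
    positivity
  · rw [div_le_one (by positivity)]
    -- With `s = max r 0`, this is `2s ≤ 1 + s² ≤ (1 + s²)²`.
    nlinarith [sq_nonneg (max r 0 - 1), sq_nonneg (max r 0)]
  · have : 0 < 1 + r ^ 2 := by positivity
    refine ((hasDerivAt_pow 2 r).div ((hasDerivAt_pow 2 r).const_add 1) this.ne').congr_deriv ?_
    field_simp
    simp
    ring

theorem softPosDeriv_nonneg (r : ℝ) : 0 ≤ softPosDeriv r := by
  unfold softPosDeriv
  positivity

theorem softPosDeriv_le_one (r : ℝ) : softPosDeriv r ≤ 1 := by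
  unfold softPosDeriv
  rw [div_le_one (by positivity)]
  linarith

theorem monotone_softPos : Monotone softPos :=
  monotone_of_deriv_nonneg (fun r => (hasDerivAt_softPos r).differentiableAt) fun r => by
    rw [(hasDerivAt_softPos r).deriv]
    exact softPosDeriv_nonneg r

theorem softPos_of_nonpos {r : ℝ} (hr : r ≤ 0) : softPos r = 0 ∧ softPosDeriv r = 0 := by
  simp [softPos, softPosDeriv, max_eq_right hr]

theorem softPos_nonneg (r : ℝ) : 0 ≤ softPos r := by
  rcases le_total r 0 with h | h
  · rw [(softPos_of_nonpos h).1]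
  · exact (softPos_of_nonpos le_rfl).1.symm.le.trans (monotone_softPos h)

theorem softPos_le (r : ℝ) : softPos r ≤ max r 0 := by
  have : 0 ≤ Real.arctan (max r 0) := Real.arctan_nonneg.2 (le_max_right _ _)
  unfold softPos
  linarith

theorem softPos_pos {r : ℝ} (hr : 0 < r) : 0 < softPos r := by
  have h : Real.arctan r < r := by
    have := Real.lt_tan (Real.arctan_pos.2 hr) (Real.arctan_lt_pi_div_two r)
    rwa [Real.tan_arctan] at this
  rw [softPos, max_eq_left hr.le]
  linarith

theorem isSmoothConvex_affine (a b c : ℝ) :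
    IsSmoothConvex (fun p => a * p.1 + b * p.2 + c) (fun _ => a) (fun _ => b) (|a| + |b|) where
  hasFDerivAt p := by
    have := ((linForm a b).hasFDerivAt (x := p)).add_const c
    simpa using! this
  abs_le p := ⟨by linarith [abs_nonneg b], by linarith [abs_nonneg a]⟩
  hessian p := by
    refine ⟨0, 0, 0, ?_, ?_, le_rfl, le_rfl, by simp,
      by rw [add_zero]; positivity⟩
    · exact (hasFDerivAt_const a p).congr_fderiv (by ext <;> simp)
    · exact (hasFDerivAt_const b p).congr_fderiv (by ext <;> simp)

/-- The smoothed maximum of a smooth convex function and an affine function. -/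
theorem IsSmoothConvex.softMax {E E₁ E₂ : ℝ × ℝ → ℝ} {L : ℝ} (hE : IsSmoothConvex E E₁ E₂ L)
    (a b c : ℝ) :
    IsSmoothConvex (fun p => E p + softPos (a * p.1 + b * p.2 + c - E p))
      (fun p => E₁ p + softPosDeriv (a * p.1 + b * p.2 + c - E p) * (a - E₁ p))
      (fun p => E₂ p + softPosDeriv (a * p.1 + b * p.2 + c - E p) * (b - E₂ p))
      (L + |a| + |b| + (|a| + L) ^ 2 + (|b| + L) ^ 2) := by
  have hL := hE.nonneg
  have hl : ∀ p, HasFDerivAt (fun p : ℝ × ℝ => a * p.1 + b * p.2 + c - E p)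
      (linForm (a - E₁ p) (b - E₂ p)) p := fun p => by
    refine (((isSmoothConvex_affine a b c).hasFDerivAt p).sub (hE.hasFDerivAt p)).congr_fderiv ?_
    ext <;> simp
  refine ⟨fun p => ?_, fun p => ?_, fun p => ?_⟩
  · refine ((hE.hasFDerivAt p).add
      ((hasDerivAt_softPos _).comp_hasFDerivAt p (hl p))).congr_fderiv ?_
    ext <;> simp
  -- Each partial derivative is a convex combination of the old one and the slope of the affine
  -- function.
  · have hcv : ∀ x y σ : ℝ, |x| ≤ L → 0 ≤ σ → σ ≤ 1 → |x + σ * (y - x)| ≤ L + |y| := by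
      intro x y σ hx h0 h1
      have e : x + σ * (y - x) = (1 - σ) * x + σ * y := by ring
      rw [e]
      refine (abs_add_le _ _).trans ?_
      rw [abs_mul, abs_mul, abs_of_nonneg h0, abs_of_nonneg (sub_nonneg.2 h1)]
      nlinarith [abs_nonneg x, abs_nonneg y]
    have h1 := hcv _ a _ (hE.abs_le p).1 (softPosDeriv_nonneg (a * p.1 + b * p.2 + c - E p))
      (softPosDeriv_le_one _)
    have h2 := hcv _ b _ (hE.abs_le p).2 (softPosDeriv_nonneg (a * p.1 + b * p.2 + c - E p))
      (softPosDeriv_le_one _)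
    have g1 := abs_nonneg a
    have g2 := abs_nonneg b
    constructor <;> nlinarith [sq_nonneg (|a| + L), sq_nonneg (|b| + L)]
  · obtain ⟨x, y, z, h1, h2, h3, h4, h5, h6⟩ := hE.hessian p
    obtain ⟨d, d0, d1, hd⟩ := exists_hasDerivAt_softPosDeriv (a * p.1 + b * p.2 + c - E p)
    have hd' := hd.comp_hasFDerivAt p (hl p)
    have s0 := softPosDeriv_nonneg (a * p.1 + b * p.2 + c - E p)
    have s1 := softPosDeriv_le_one (a * p.1 + b * p.2 + c - E p)
    set σ := softPosDeriv (a * p.1 + b * p.2 + c - E p) with hσ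
    set v := a - E₁ p with hv
    set w := b - E₂ p with hw
    have hv2 : v ^ 2 ≤ (|a| + L) ^ 2 := sq_le_sq' (by
        linarith [neg_abs_le a, (_root_.abs_le.1 (hE.abs_le p).1).2])
      (by linarith [le_abs_self a, (_root_.abs_le.1 (hE.abs_le p).1).1])
    have hw2 : w ^ 2 ≤ (|b| + L) ^ 2 := sq_le_sq' (by
        linarith [neg_abs_le b, (_root_.abs_le.1 (hE.abs_le p).2).2])
      (by linarith [le_abs_self b, (_root_.abs_le.1 (hE.abs_le p).2).1])
    have t0 : 0 ≤ 1 - σ := by linarith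
    -- The new Hessian is `(1 - σ) D²E + d (v, w) ⊗ (v, w)`, a sum of nonnegative forms.
    refine ⟨(1 - σ) * x + d * v ^ 2, (1 - σ) * y + d * (v * w), (1 - σ) * z + d * w ^ 2,
      ?_, ?_, by positivity, by positivity, ?_, ?_⟩
    · refine (h1.add (hd'.mul (h1.const_sub a))).congr_fderiv ?_
      ext <;> simp [← hσ, ← hv] <;> ring
    · refine (h2.add (hd'.mul (h2.const_sub b))).congr_fderiv ?_
      ext <;> simp [← hσ, ← hw] <;> ring
    · have q := quadraticForm_nonneg h3 h4 h5 w (-v)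
      have q1 := mul_nonneg (mul_nonneg t0 d0) q
      have q2 := mul_nonneg (mul_nonneg t0 t0) (sub_nonneg.2 h5)
      nlinarith
    · have e1 : (1 - σ) * (x + z) ≤ 1 * (x + z) :=
        mul_le_mul_of_nonneg_right (by linarith) (by linarith)
      have e2 : d * (v ^ 2 + w ^ 2) ≤ 1 * (v ^ 2 + w ^ 2) :=
        mul_le_mul_of_nonneg_right d1 (by positivity)
      linarith [abs_nonneg a, abs_nonneg b]

/-- Iterated smoothed maxima of a sequence of affine functions, each of which is used infinitely
often. -/
noncomputable def iterSoftMax (a₀ b₀ c₀ : ℝ) (a b c : ℕ → ℝ) : ℕ → ℝ × ℝ → ℝ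
  | 0, p => a₀ * p.1 + b₀ * p.2 + c₀
  | n + 1, p => iterSoftMax a₀ b₀ c₀ a b c n p +
      softPos (a n.unpair.1 * p.1 + b n.unpair.1 * p.2 + c n.unpair.1
        - iterSoftMax a₀ b₀ c₀ a b c n p)

/-- `softPos` and its derivative vanish on nonpositive arguments, so starting from zero with all `c
n ≤ 0` keeps value and gradient zero at the origin. Integrability over infinite mass needs this. -/
theorem exists_isSmoothConvex_iterSoftMax (a₀ b₀ c₀ : ℝ) (a b c : ℕ → ℝ) (n : ℕ) :
    ∃ E₁ E₂ L, IsSmoothConvex (iterSoftMax a₀ b₀ c₀ a b c n) E₁ E₂ L ∧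
      ((a₀ = 0 ∧ b₀ = 0 ∧ c₀ = 0) → (∀ n, c n ≤ 0) →
        iterSoftMax a₀ b₀ c₀ a b c n 0 = 0 ∧ E₁ 0 = 0 ∧ E₂ 0 = 0) := by
  induction n with
  | zero =>
    refine ⟨_, _, _, isSmoothConvex_affine a₀ b₀ c₀, fun ⟨ha, hb, hc⟩ _ => ⟨?_, ha, hb⟩⟩
    simp [iterSoftMax, hc]
  | succ n ih =>
    obtain ⟨E₁, E₂, L, h1, h2⟩ := ih
    refine ⟨_, _, _, h1.softMax (a n.unpair.1) (b n.unpair.1) (c n.unpair.1), fun h0 hc => ?_⟩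
    obtain ⟨g1, g2, g3⟩ := h2 h0 hc
    have hs := softPos_of_nonpos (hc n.unpair.1)
    simp [iterSoftMax, g1, g2, g3, hs.1, hs.2]

theorem monotone_iterSoftMax (a₀ b₀ c₀ : ℝ) (a b c : ℕ → ℝ) (p : ℝ × ℝ) :
    Monotone fun n => iterSoftMax a₀ b₀ c₀ a b c n p :=
  monotone_nat_of_le_succ fun _ => le_add_of_nonneg_right (softPos_nonneg _)

theorem iterSoftMax_le {a₀ b₀ c₀ : ℝ} {a b c : ℕ → ℝ} {p : ℝ × ℝ} {r : ℝ}
    (h0 : a₀ * p.1 + b₀ * p.2 + c₀ ≤ r) (h : ∀ n, a n * p.1 + b n * p.2 + c n ≤ r) (n : ℕ) :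
    iterSoftMax a₀ b₀ c₀ a b c n p ≤ r := by
  induction n with
  | zero => exact h0
  | succ n ih =>
    have h1 := softPos_le (a n.unpair.1 * p.1 + b n.unpair.1 * p.2 + c n.unpair.1
        - iterSoftMax a₀ b₀ c₀ a b c n p)
    have h2 := h n.unpair.1
    rw [iterSoftMax]
    rcases max_cases (a n.unpair.1 * p.1 + b n.unpair.1 * p.2 + c n.unpair.1
        - iterSoftMax a₀ b₀ c₀ a b c n p) 0 with h | h <;> linarith

/-- If all values stayed below `r`, each visit to the index `i`, at the times `Nat.pair i k`, would
add at least a fixed `δ > 0`, which cannot happen infinitely often. -/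
theorem exists_lt_iterSoftMax (a₀ b₀ c₀ : ℝ) {a b c : ℕ → ℝ} {p : ℝ × ℝ} {r : ℝ} {i : ℕ}
    (hi : r < a i * p.1 + b i * p.2 + c i) : ∃ n, r < iterSoftMax a₀ b₀ c₀ a b c n p := by
  by_contra! hle
  set δ := softPos (a i * p.1 + b i * p.2 + c i - r)
  have hδ : 0 < δ := softPos_pos (by linarith)
  have hmono := monotone_iterSoftMax a₀ b₀ c₀ a b c p
  have step : ∀ k, iterSoftMax a₀ b₀ c₀ a b c (Nat.pair i k) p + δ
      ≤ iterSoftMax a₀ b₀ c₀ a b c (Nat.pair i k + 1) p := by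
    intro k
    rw [iterSoftMax, Nat.unpair_pair]
    exact add_le_add le_rfl (monotone_softPos (by linarith [hle (Nat.pair i k)]))
  have ind : ∀ k : ℕ, iterSoftMax a₀ b₀ c₀ a b c 0 p + k * δ
      ≤ iterSoftMax a₀ b₀ c₀ a b c (Nat.pair i k) p := by
    intro k
    induction k with
    | zero => simpa using hmono (Nat.zero_le _)
    | succ k ih =>
      have h1 := hmono (Nat.succ_le_of_lt (Nat.pair_lt_pair_right i (Nat.lt_succ_self k)))
      have h2 := step k
      push_cast
      simp only [Nat.succ_eq_add_one] at h1
      linarith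
  obtain ⟨k, hk⟩ := exists_nat_gt ((r - iterSoftMax a₀ b₀ c₀ a b c 0 p) / δ)
  rw [div_lt_iff₀ hδ] at hk
  linarith [ind k, hle (Nat.pair i k)]

/-- Convex integrands are increasing limits of smooth convex functions. -/
theorem IsConvexIntegrand.exists_smooth_approx {X : Type*} [MeasurableSpace X] {m : Measure X}
    {E : ℝ × ℝ → EReal} (hE : IsConvexIntegrand m E) :
    ∃ F : ℕ → ℝ × ℝ → ℝ, (∀ n, ∃ E₁ E₂ L, IsSmoothConvex (F n) E₁ E₂ L ∧
        (m univ = ⊤ → F n 0 = 0 ∧ E₁ 0 = 0 ∧ E₂ 0 = 0)) ∧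
      (∀ p, Monotone fun n => F n p) ∧ (∀ n p, (F n p : EReal) ≤ E p) ∧
      ∀ (p : ℝ × ℝ) (r : ℝ), (r : EReal) < E p → ∃ n, r < F n p := by
  obtain ⟨a, b, c, h1, h2⟩ := exists_seq_affine hE.convex hE.lsc hE.ne_bot hE.ne_top
  obtain ⟨a₀, b₀, c₀, h3, h4⟩ : ∃ a₀ b₀ c₀ : ℝ,
      (∀ p : ℝ × ℝ, ((a₀ * p.1 + b₀ * p.2 + c₀ : ℝ) : EReal) ≤ E p) ∧
      (m univ = ⊤ → a₀ = 0 ∧ b₀ = 0 ∧ c₀ = 0) := by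
    -- For infinite mass the zero function is a minorant and has the right value and gradient at the
    -- origin; for finite mass any minorant will do.
    by_cases hm : m univ = ⊤
    · exact ⟨0, 0, 0, fun p => by simpa using hE.nonneg hm p, fun _ => ⟨rfl, rfl, rfl⟩⟩
    · exact ⟨a 0, b 0, c 0, h1 0, fun h => absurd h hm⟩
  refine ⟨iterSoftMax a₀ b₀ c₀ a b c, fun n => ?_, monotone_iterSoftMax a₀ b₀ c₀ a b c,
    fun n p => coe_le_of_forall_eq_coe hE.ne_bot fun r hr => ?_, fun p r hr => ?_⟩
  · obtain ⟨E₁, E₂, L, g1, g2⟩ := exists_isSmoothConvex_iterSoftMax a₀ b₀ c₀ a b c n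
    refine ⟨E₁, E₂, L, g1, fun hm => g2 (h4 hm) fun k => ?_⟩
    -- Evaluating at the origin, where `E` vanishes, gives `c k ≤ 0`.
    have := h1 k (0, 0)
    rw [hE.zero hm] at this
    simpa using this
  · refine iterSoftMax_le ?_ (fun k => ?_) n
    · have := h3 p
      rwa [hr, EReal.coe_le_coe_iff] at this
    · have := h1 k p
      rwa [hr, EReal.coe_le_coe_iff] at this
  · obtain ⟨i, hi⟩ := h2 p r hr
    exact exists_lt_iterSoftMax a₀ b₀ c₀ hi

end Smoothing

end MetricMeasure

/-! ### Extended integrals and the passage to general integrands. -/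

namespace MetricMeasure

section

variable {X : Type*} [MeasurableSpace X] {m : Measure X}

/-- The identity `h = (h - g) + g` in terms of positive and negative parts, rearranged to avoid
subtraction in `[0, ∞]`. -/
theorem toENNReal_add_ofReal_neg {h : EReal} {g : ℝ} (hg : (g : EReal) ≤ h) :
    h.toENNReal + ENNReal.ofReal (-g)
      = (h - g).toENNReal + ENNReal.ofReal g + (-h).toENNReal := by
  induction h with
  | bot => exact absurd hg (by simp)
  | top => simp
  | coe r =>
    have hgr : g ≤ r := EReal.coe_le_coe_iff.1 hg
    rw [← EReal.coe_sub, ← EReal.coe_neg, EReal.toENNReal_of_ne_top (EReal.coe_ne_top _),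
      EReal.toENNReal_of_ne_top (EReal.coe_ne_top _), EReal.toENNReal_of_ne_top (EReal.coe_ne_top _),
      EReal.toReal_coe, EReal.toReal_coe, EReal.toReal_coe]
    rw [← ENNReal.toReal_eq_toReal_iff' (by simp) (by simp),
      ENNReal.toReal_add (by simp) (by simp), ENNReal.toReal_add (by simp) (by simp),
      ENNReal.toReal_add (by simp) (by simp)]
    simp only [ENNReal.toReal_ofReal']
    rw [max_eq_left (sub_nonneg.2 hgr)]
    have h1 := max_zero_sub_max_neg_zero_eq_self r
    have h2 := max_zero_sub_max_neg_zero_eq_self g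
    linarith

theorem lintegral_neg_toENNReal_ne_top {h : X → EReal} {g : X → ℝ} (hg : Integrable g m)
    (hle : ∀ x, (g x : EReal) ≤ h x) : ∫⁻ x, (-h x).toENNReal ∂m ≠ ⊤ := by
  refine ne_top_of_le_ne_top hg.neg.lintegral_lt_top.ne (lintegral_mono fun x => ?_)
  have h1 : -h x ≤ ((-g x : ℝ) : EReal) := by
    rw [EReal.coe_neg]
    exact EReal.neg_le_neg_iff.2 (hle x)
  refine (EReal.toENNReal_le_toENNReal h1).trans (le_of_eq ?_)
  rw [EReal.toENNReal_of_ne_top (EReal.coe_ne_top _), EReal.toReal_coe, Pi.neg_apply]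

/-- The integral of an extended-real function above an integrable one. -/
theorem integralEReal_eq {h : X → EReal} {g : X → ℝ} (hh : AEMeasurable h m) (hg : Integrable g m)
    (hle : ∀ x, (g x : EReal) ≤ h x) :
    integralEReal m h
      = ((∫⁻ x, (h x - g x).toENNReal ∂m : ℝ≥0∞) : EReal) + ((∫ x, g x ∂m : ℝ) : EReal) := by
  have hB := lintegral_neg_toENNReal_ne_top hg hle
  have hGp := hg.lintegral_lt_top.ne
  have hGn : ∫⁻ x, ENNReal.ofReal (-g x) ∂m ≠ ⊤ := hg.neg.lintegral_lt_top.ne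
  have key : ∫⁻ x, (h x).toENNReal ∂m + ∫⁻ x, ENNReal.ofReal (-g x) ∂m
      = ∫⁻ x, (h x - g x).toENNReal ∂m + ∫⁻ x, ENNReal.ofReal (g x) ∂m
        + ∫⁻ x, (-h x).toENNReal ∂m := by
    have m1 : AEMeasurable (fun x => (-h x).toENNReal) m := hh.neg.ereal_toENNReal
    have m2 : AEMeasurable (fun x => ENNReal.ofReal (g x)) m := hg.1.aemeasurable.ennreal_ofReal
    have m3 : AEMeasurable (fun x => ENNReal.ofReal (-g x)) m :=
      hg.1.aemeasurable.neg.ennreal_ofReal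
    rw [← lintegral_add_right' _ m3, ← lintegral_add_right' _ m2, ← lintegral_add_right' _ m1]
    exact lintegral_congr fun x => toENNReal_add_ofReal_neg (hle x)
  rw [integral_eq_lintegral_pos_part_sub_lintegral_neg_part hg]
  unfold integralEReal
  set A := ∫⁻ x, (h x).toENNReal ∂m
  set B := ∫⁻ x, (-h x).toENNReal ∂m
  set I := ∫⁻ x, (h x - g x).toENNReal ∂m
  set P := ∫⁻ x, ENNReal.ofReal (g x) ∂m
  set N := ∫⁻ x, ENNReal.ofReal (-g x) ∂m
  clear_value A B I P N
  lift B to NNReal using hB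
  lift P to NNReal using hGp
  lift N to NNReal using hGn
  -- Only `A` and `I` can be infinite, and `key` makes them infinite simultaneously.
  rcases eq_or_ne I ⊤ with hI | hI
  · have hA : A = ⊤ := by
      by_contra hA
      rw [hI] at key
      simp only [top_add] at key
      exact ENNReal.add_ne_top.2 ⟨hA, ENNReal.coe_ne_top⟩ key
    rw [hA, hI]
    rw [EReal.coe_ennreal_top, EReal.top_add_coe]
    exact EReal.top_sub_coe _
  · have hA : A ≠ ⊤ := by
      intro hA
      rw [hA, top_add] at key
      exact ENNReal.add_ne_top.2 ⟨ENNReal.add_ne_top.2 ⟨hI, ENNReal.coe_ne_top⟩,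
        ENNReal.coe_ne_top⟩ key.symm
    lift A to NNReal using hA
    lift I to NNReal using hI
    have key' : (A : ℝ) + N = I + P + B := by exact_mod_cast key
    have e : ∀ x : NNReal, (((x : ℝ≥0∞)) : EReal) = ((x : ℝ) : EReal) := fun x => rfl
    rw [e, e, e, ← EReal.coe_sub, ← EReal.coe_add, ENNReal.coe_toReal, ENNReal.coe_toReal]
    congr 1
    linarith

theorem tendsto_ofReal_sub {c : ℝ} {r : EReal} {F : ℕ → ℝ} (hmono : Monotone F)
    (hle : ∀ n, (F n : EReal) ≤ r) (hlt : ∀ s : ℝ, (s : EReal) < r → ∃ n, s < F n) :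
    Tendsto (fun n => ENNReal.ofReal (F n - c)) atTop (𝓝 (r - c).toENNReal) := by
  induction r with
  | bot => exact absurd (hle 0) (by simp)
  | top =>
    have h1 : Tendsto F atTop atTop := tendsto_atTop_mono' _ (Eventually.of_forall fun n => le_rfl)
      (tendsto_atTop_atTop_of_monotone hmono fun b =>
        (hlt b (EReal.coe_lt_top b)).imp fun n hn => hn.le)
    simpa [Function.comp_def, sub_eq_add_neg] using ENNReal.tendsto_ofReal_atTop.comp
      (tendsto_atTop_add_const_right _ (-c) h1)
  | coe r =>
    have h1 : Tendsto F atTop (𝓝 r) := by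
      refine tendsto_order.2 ⟨fun s hs => ?_, fun s hs => Eventually.of_forall fun n =>
        (EReal.coe_le_coe_iff.1 (hle n)).trans_lt hs⟩
      obtain ⟨n, hn⟩ := hlt s (EReal.coe_lt_coe_iff.2 hs)
      filter_upwards [eventually_ge_atTop n] with k hk
      exact hn.trans_le (hmono hk)
    rw [← EReal.coe_sub, EReal.toENNReal_of_ne_top (EReal.coe_ne_top _), EReal.toReal_coe]
    exact (ENNReal.continuous_ofReal.tendsto _).comp (h1.sub_const c)

/-- If the integrals of all smooth approximations decrease, then so does the integral of the
integrand. -/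
theorem convexFunctional_le {E : ℝ × ℝ → EReal} (hE : LowerSemicontinuous E) {F : ℕ → ℝ × ℝ → ℝ}
    (hmono : ∀ p, Monotone fun n => F n p) (hle : ∀ n p, (F n p : EReal) ≤ E p)
    (hlt : ∀ (p : ℝ × ℝ) (r : ℝ), (r : EReal) < E p → ∃ n, r < F n p) {f g f' g' : Lp ℝ 2 m}
    (hint : ∀ n, Integrable (fun x => F n (f x, g x)) m)
    (hint' : ∀ n, Integrable (fun x => F n (f' x, g' x)) m)
    (hF : ∀ n, ∫ x, F n (f' x, g' x) ∂m ≤ ∫ x, F n (f x, g x) ∂m) :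
    convexFunctional m E f' g' ≤ convexFunctional m E f g := by
  have hmeas : ∀ f g : Lp ℝ 2 m, AEMeasurable (fun x => E (f x, g x)) m := fun f g =>
    hE.measurable.comp_aemeasurable ((Lp.stronglyMeasurable f).measurable.prodMk
      (Lp.stronglyMeasurable g).measurable).aemeasurable
  have hI : ∀ (f g : Lp ℝ 2 m) (n : ℕ), Integrable (fun x => F n (f x, g x)) m →
      Integrable (fun x => F 0 (f x, g x)) m →
      ENNReal.ofReal (∫ x, F n (f x, g x) ∂m - ∫ x, F 0 (f x, g x) ∂m)
        = ∫⁻ x, ENNReal.ofReal (F n (f x, g x) - F 0 (f x, g x)) ∂m := by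
    intro f g n hn h0
    rw [← integral_sub hn h0]
    exact ofReal_integral_eq_lintegral_ofReal (f := fun x => F n (f x, g x) - F 0 (f x, g x))
      (hn.sub h0) (Eventually.of_forall fun x => sub_nonneg.2 (hmono _ (Nat.zero_le n)))
  unfold convexFunctional
  rw [integralEReal_eq (hmeas f' g') (hint' 0) fun x => hle 0 _,
    integralEReal_eq (hmeas f g) (hint 0) fun x => hle 0 _]
  set I := ∫⁻ x, (E (f x, g x) - F 0 (f x, g x)).toENNReal ∂m with hIdef
  -- If `I` is infinite, so is the right-hand side. Otherwise `J` is the bound for the integral of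
  -- `E - F 0` along `(f', g')` that the claim requires.
  rcases eq_or_ne I ⊤ with hItop | hItop
  · rw [hItop, EReal.coe_ennreal_top, EReal.top_add_coe]
    exact le_top
  set J := I.toReal + ∫ x, F 0 (f x, g x) ∂m - ∫ x, F 0 (f' x, g' x) ∂m with hJ
  have hJ0 : 0 ≤ J := by
    have := hF 0
    have : 0 ≤ I.toReal := ENNReal.toReal_nonneg
    linarith
  have hbound : ∀ n, ∫⁻ x, ENNReal.ofReal (F n (f' x, g' x) - F 0 (f' x, g' x)) ∂m
      ≤ ENNReal.ofReal J := by
    intro n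
    rw [← hI f' g' n (hint' n) (hint' 0)]
    refine ENNReal.ofReal_le_ofReal ?_
    have h1 : ENNReal.ofReal (∫ x, F n (f x, g x) ∂m - ∫ x, F 0 (f x, g x) ∂m) ≤ I := by
      rw [hI f g n (hint n) (hint 0)]
      refine lintegral_mono fun x => ?_
      have : ((F n (f x, g x) - F 0 (f x, g x) : ℝ) : EReal)
          ≤ E (f x, g x) - F 0 (f x, g x) := by
        rw [EReal.coe_sub]
        exact EReal.sub_le_sub (hle n _) le_rfl
      have h2 := EReal.toENNReal_le_toENNReal this
      rwa [EReal.toENNReal_of_ne_top (EReal.coe_ne_top _), EReal.toReal_coe] at h2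
    have h2 := (ENNReal.ofReal_le_iff_le_toReal hItop).1 h1
    linarith [hF n]
  -- Subtracting `F 0` makes the approximations nonnegative, so monotone convergence carries
  -- `hbound` over to `E`.
  have hlim := lintegral_tendsto_of_tendsto_of_monotone (μ := m)
    (f := fun n x => ENNReal.ofReal (F n (f' x, g' x) - F 0 (f' x, g' x)))
    (F := fun x => (E (f' x, g' x) - F 0 (f' x, g' x)).toENNReal)
    (fun n => ((hint' n).sub (hint' 0)).1.aemeasurable.ennreal_ofReal)
    (Eventually.of_forall fun x a b hab =>
      ENNReal.ofReal_le_ofReal (sub_le_sub_right (hmono _ hab) _))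
    (Eventually.of_forall fun x => tendsto_ofReal_sub (hmono _) (fun n => hle n _) (hlt _))
  have hfin := le_of_tendsto' hlim hbound
  have e1 : ((ENNReal.ofReal J : ℝ≥0∞) : EReal) = (J : EReal) := by
    rw [EReal.coe_ennreal_ofReal, max_eq_left hJ0]
  have e2 : (I : EReal) = ((I.toReal : ℝ) : EReal) := (EReal.coe_ennreal_toReal hItop).symm
  calc _ ≤ ((ENNReal.ofReal J : ℝ≥0∞) : EReal) + ((∫ x, F 0 (f' x, g' x) ∂m : ℝ) : EReal) :=
        add_le_add (EReal.coe_ennreal_le_coe_ennreal_iff.2 hfin) le_rfl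
    _ = _ := by
        rw [e1, e2, ← EReal.coe_add, ← EReal.coe_add, hJ]
        congr 1
        ring

end

end MetricMeasure

/-- On a complete separable metric measure space with full support and the growth condition, the
heat semigroup (the `L²`-gradient flow of the Cheeger energy) is well defined, the functionals
`∫ E(f, g) dm` are well defined, and they decrease along pairs of heat flows. -/
theorem mainTheorem1 {X : Type*} [MetricSpace X] [CompleteSpace X]
    [TopologicalSpace.SeparableSpace X] [MeasurableSpace X] [BorelSpace X]
    (m : Measure X) [m.IsOpenPosMeasure] (hm : MetricMeasure.GrowthCondition m) :
    (∀ f : Lp ℝ 2 m,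
      MetricMeasure.IsHeatFlow m f (fun t => MetricMeasure.heatSemigroup m t f) ∧
      ∀ u : ℝ → Lp ℝ 2 m, MetricMeasure.IsHeatFlow m f u →
        ∀ t : ℝ, 0 ≤ t → u t = MetricMeasure.heatSemigroup m t f) ∧
    ∀ E : ℝ × ℝ → EReal, MetricMeasure.IsConvexIntegrand m E →
      (∀ f g : Lp ℝ 2 m, ∫⁻ x, (-E (f x, g x)).toENNReal ∂m ≠ ⊤) ∧
      ∀ f g : Lp ℝ 2 m, ∀ t : ℝ, 0 ≤ t →
        MetricMeasure.convexFunctional m E (MetricMeasure.heatSemigroup m t f)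
            (MetricMeasure.heatSemigroup m t g) ≤
          MetricMeasure.convexFunctional m E f g := by
  obtain ⟨hCh, hsep⟩ := MetricMeasure.isConvexLsc_cheegerEnergy hm
  refine ⟨fun f => ⟨MetricMeasure.isHeatFlow_heatSemigroup hCh f, fun u hu t ht =>
    hu.eq (MetricMeasure.isHeatFlow_heatSemigroup hCh f) ht⟩, fun E hE => ?_⟩
  obtain ⟨F, hF, hmono, hle, hlt⟩ := hE.exists_smooth_approx
  have hint : ∀ (f g : Lp ℝ 2 m) (n : ℕ), Integrable (fun x => F n (f x, g x)) m := by
    intro f g n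
    obtain ⟨E₁, E₂, L, h1, h2⟩ := hF n
    exact h1.integrable_comp h2 (Lp.memLp f) (Lp.memLp g)
  refine ⟨fun f g => MetricMeasure.lintegral_neg_toENNReal_ne_top (hint f g 0) fun x => hle 0 _,
    fun f g t ht => MetricMeasure.convexFunctional_le hE.lsc hmono hle hlt (hint f g)
      (hint _ _) fun n => ?_⟩
  obtain ⟨E₁, E₂, L, h1, h2⟩ := hF n
  exact MetricMeasure.integral_heatSemigroup_le hCh h1 h2 ht f g
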